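/- Let $L_0\in\mathbb R$ and let $N$ be the 4-dimensional neutral space form of constant sectional curvature $L_0$: $N=E^4_2$ if $L_0=0$, $N=\{x\in E^5_2 : \langle x,x\rangle=1/L_0\}$ if $L_0>0$, $N=\{x\in E^5_3 : \langle x,x\rangle=1/L_0\}$ if $L_0<0$, with neutral metric $h$ (here $E^n_k$ is $\mathbb R^n$ with a metric having $k$ negative squares). Everything is $C^\infty$. A Lorentz surface is a surface with an atlas of local paracomplex coordinates $\check w=u+jv$ ($j^2=1$) whose transition maps are paraholomorphic with positive Jacobian. Let $M$ be a Lorentz surface and $F:M\to N$ a time-like conformal immersion with zero mean curvature vector; thus in each local paracomplex coordinate $g:=F^*h=e^{2\lambda}d\check w\,d\overline{\check w}=e^{2\lambda}(du^2-dv^2)$ for a function $\lambda$. Let $K$ be the curvature of $g$ and $R^\perp$ the curvature tensor of the normal connection of $F$. For a local paracomplex coordinate put $T_1=dF(\partial_u)$, $T_2=dF(\partial_v)$. A normal frame is a pair of normal vector fields $N_1,N_2$ of $F$ with $h(N_1,N_1)=-h(N_2,N_2)=e^{2\lambda}$, $h(N_1,N_2)=0$. The coefficients $\alpha_k,\beta_k,\mu_k$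 ($k=1,2$) of $F$ with respect to it are the functions with $$\tilde\nabla_{T_1}(T_1\,T_2\,N_1\,N_2\,F)=(T_1\,T_2\,N_1\,N_2\,F)S,\qquad \tilde\nabla_{T_2}(T_1\,T_2\,N_1\,N_2\,F)=(T_1\,T_2\,N_1\,N_2\,F)T,$$ where $\tilde\nabla$ is the flat connection of the ambient space and $$S=\begin{pmatrix}\lambda_u&\lambda_v&-\alpha_1&\beta_1&1\\ \lambda_v&\lambda_u&\alpha_2&-\beta_2&0\\ \alpha_1&\alpha_2&\lambda_u&\mu_1&0\\ \beta_1&\beta_2&\mu_1&\lambda_u&0\\ -L_0e^{2\lambda}&0&0&0&0\end{pmatrix},\quad T=\begin{pmatrix}\lambda_v&\lambda_u&-\alpha_2&\beta_2&0\\ \lambda_u&\lambda_v&\alpha_1&-\beta_1&1\\ \alpha_2&\alpha_1&\lambda_v&\mu_2&0\\ \beta_2&\beta_1&\mu_2&\lambda_v&0\\ 0&L_0e^{2\lambda}&0&0&0\end{pmatrix}.$$ Put $s=(u+v)/\sqrt2$, $t=(u-v)/\sqrt2$. For $\varepsilon\in\{1,-1\}$, say that $\alpha_k,\beta_k,\mu_k$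 are given by the explicit formulas $(\ast)$ if there are signs $\varepsilon'_\pm\in\{1,-1\}$, a constant $c$ and functions $P_\pm,Q_\pm$ with $$-2\lambda=P_\pm+Q_\pm,\quad Q_-=P_++c,\quad Q_+=P_-+c,$$ $$\mu_1=\tfrac1{2\sqrt2}\big((Q_+-Q_-)_s-(P_+-P_-)_t\big),\quad \mu_2=\tfrac1{2\sqrt2}\big((Q_+-Q_-)_s+(P_+-P_-)_t\big),$$ and, with $X_\pm=\tfrac{\varepsilon'_\pm}2(e^{P_\pm}+\varepsilon e^{Q_\pm})$, $Y_\pm=\tfrac{\varepsilon'_\pm}2(e^{P_\pm}-\varepsilon e^{Q_\pm})$, $$\alpha_1=\tfrac12(X_++X_-),\quad \alpha_2=\tfrac12(Y_++Y_-),\quad \beta_1=\tfrac12(Y_+-Y_-),\quad \beta_2=\tfrac12(X_+-X_-).$$ **Theorem 5.1.** The following are equivalent: (a) $K\neq L_0$ at every point of $M$, and $R^\perp=0$; (b) around each point of $M$ there are a local paracomplex coordinate $\check w=u+jv$ and an $\varepsilon\in\{1,-1\}$ such that $g=e^{2\lambda}d\check w\,d\overline{\check w}$ with $$\lambda_{uu}-\lambda_{vv}=-L_0e^{2\lambda}+\varepsilon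 e^{-2\lambda}, \tag{1}$$ and such that the coefficients $\alpha_k,\beta_k,\mu_k$ with respect to some normal frame on the coordinate domain are given by $(\ast)$; (b') the same as (b), but with normal frames existing on the coordinate domain and with $(\ast)$ holding for every normal frame on it (with $\varepsilon'_\pm,c,P_\pm,Q_\pm$ depending on the frame). Conversely, let $U\subset\mathbb R^2$ be open, $\varepsilon\in\{1,-1\}$, let $\lambda$ satisfy (1) on $U$, and let $\alpha_k,\beta_k,\mu_k$ be functions given on $U$ by $(\ast)$. Then each point of $U$ has an open neighborhood $W\subset U$ on which there is a time-like surface $f:W\to N$ with zero mean curvature vector, induced metric $e^{2\lambda}(du^2-dv^2)$, and coefficients $\alpha_k,\beta_k,\mu_k$ with respect to some normal frame, and it satisfies $K\neq L_0$ everywhere and $R^\perp=0$. It is unique up to an isometry of $N$: if $W\subset U$ is open and connected and $f,f'$ are two time-like surfaces on $W$ with zero mean curvature vector, that induced metric, and these coefficients (each with respect to some normal frame), then $f'=\Phi\circ f$ for an isometry $\Phi$ of $N$. -/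

import Mathlib

open scoped ContDiff

noncomputable section

namespace NeutralSurface

/-! ## Partial derivatives in the plane with coordinates `(u, v)` -/

/-- The partial derivative `∂f/∂u`. -/
def dU {E : Type*} [NormedAddCommGroup E] [NormedSpace ℝ E] (f : ℝ × ℝ → E) (x : ℝ × ℝ) : E :=
  fderiv ℝ f x (1, 0)

/-- The partial derivative `∂f/∂v`. -/
def dV {E : Type*} [NormedAddCommGroup E] [NormedSpace ℝ E] (f : ℝ × ℝ → E) (x : ℝ × ℝ) : E :=
  fderiv ℝ f x (0, 1)

/-- The partial derivative `∂f/∂s` for `s = (u + v) / √2`, `t = (u - v) / √2`. -/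
def dS (f : ℝ × ℝ → ℝ) (x : ℝ × ℝ) : ℝ := (dU f x + dV f x) / Real.sqrt 2

/-- The partial derivative `∂f/∂t` for `s = (u + v) / √2`, `t = (u - v) / √2`. -/
def dT (f : ℝ × ℝ → ℝ) (x : ℝ × ℝ) : ℝ := (dU f x - dV f x) / Real.sqrt 2

/-- The partial derivatives indexed by `Fin 2`: index `0` is `u`, index `1` is `v`. -/
def pd {E : Type*} [NormedAddCommGroup E] [NormedSpace ℝ E] (i : Fin 2) (f : ℝ × ℝ → E) :
    ℝ × ℝ → E := ![dU f, dV f] i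

/-! ## Lorentz surfaces -/

/-- `f = (ũ, ṽ)` is smooth on `s`, satisfies the para-Cauchy-Riemann equations
`ũ_u = ṽ_v`, `ũ_v = ṽ_u`, and has positive Jacobian `ũ_u ^ 2 - ũ_v ^ 2` there; equivalently it
is paraholomorphic and pulls `dũ ^ 2 - dṽ ^ 2` back to a positive multiple of
`du ^ 2 - dv ^ 2`. -/
def IsParaholomorphicOn (f : ℝ × ℝ → ℝ × ℝ) (s : Set (ℝ × ℝ)) : Prop :=
  ContDiffOn ℝ ∞ f s ∧ ∀ x ∈ s,
    (dU f x).1 = (dV f x).2 ∧ (dV f x).1 = (dU f x).2 ∧ 0 < (dU f x).1 ^ 2 - (dV f x).1 ^ 2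

/-- The pregroupoid of paraholomorphic maps with positive Jacobian between open sets of the
plane. -/
def paraPregroupoid : Pregroupoid (ℝ × ℝ) where
  property := IsParaholomorphicOn
  comp := by
    intro f g u v hf hg hu hv huv
    refine ⟨hg.1.comp (hf.1.mono Set.inter_subset_left) (fun x hx => hx.2), ?_⟩
    rintro x ⟨hxu, hxv⟩
    have hfd : DifferentiableAt ℝ f x :=
      (hf.1.contDiffAt (hu.mem_nhds hxu)).differentiableAt (by simp)
    have hgd : DifferentiableAt ℝ g (f x) :=
      (hg.1.contDiffAt (hv.mem_nhds hxv)).differentiableAt (by simp)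
    obtain ⟨a1, a2, a3⟩ := hf.2 x hxu
    obtain ⟨b1, b2, b3⟩ := hg.2 (f x) hxv
    have key : ∀ w : ℝ × ℝ, fderiv ℝ (g ∘ f) x w
        = (fderiv ℝ f x w).1 • dU g (f x) + (fderiv ℝ f x w).2 • dV g (f x) := by
      intro w
      rw [fderiv_comp x hgd hfd]
      unfold dU dV
      rw [← map_smul, ← map_smul, ← map_add]
      simp
    have kU : dU (g ∘ f) x = (dU f x).1 • dU g (f x) + (dU f x).2 • dV g (f x) := key (1, 0)
    have kV : dV (g ∘ f) x = (dV f x).1 • dU g (f x) + (dV f x).2 • dV g (f x) := key (0, 1)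
    rw [kU, kV]
    simp only [Prod.fst_add, Prod.snd_add, Prod.smul_fst, Prod.smul_snd, smul_eq_mul]
    rw [← a1, ← b1, ← b2, ← a2]
    refine ⟨by ring, by ring, ?_⟩
    nlinarith [mul_pos a3 b3]
  id_mem := by
    refine ⟨contDiffOn_id, fun x _ => ?_⟩
    have hU : dU (id : ℝ × ℝ → ℝ × ℝ) x = (1, 0) := by simp [dU]
    have hV : dV (id : ℝ × ℝ → ℝ × ℝ) x = (0, 1) := by simp [dV]
    rw [hU, hV]
    norm_num
  locality := by
    intro f u _ h
    refine ⟨fun x hx => ?_, fun x hx => ?_⟩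
    · obtain ⟨v, hv, hxv, hf⟩ := h x hx
      exact ((hf.1 x ⟨hx, hxv⟩).mono_of_mem_nhdsWithin
        (Filter.inter_mem self_mem_nhdsWithin (mem_nhdsWithin_of_mem_nhds (hv.mem_nhds hxv))))
    · obtain ⟨v, hv, hxv, hf⟩ := h x hx
      exact hf.2 x ⟨hx, hxv⟩
  congr := by
    intro f g u hu hfg hf
    refine ⟨hf.1.congr hfg, fun x hx => ?_⟩
    have hev : g =ᶠ[nhds x] f := Filter.eventuallyEq_of_mem (hu.mem_nhds hx) hfg
    have hU : dU g x = dU f x := by unfold dU; rw [hev.fderiv_eq]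
    have hV : dV g x = dV f x := by unfold dV; rw [hev.fderiv_eq]
    rw [hU, hV]
    exact hf.2 x hx

/-- The structure groupoid of a Lorentz surface. A *Lorentz surface* is a space `M` with
`[ChartedSpace (ℝ × ℝ) M] [HasGroupoid M lorentzGroupoid]`, and the *local paracomplex
coordinates* `w = u + j v` of `M` are the members of `lorentzGroupoid.maximalAtlas M`. -/
def lorentzGroupoid : StructureGroupoid (ℝ × ℝ) := paraPregroupoid.groupoid

/-! ## The neutral space forms -/

/-- The ambient space has dimension `4` in the flat case and `5` otherwise. -/
def ambDim (L : ℝ) : ℕ := if L = 0 then 4 else 5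

/-- The diagonal entries of the ambient metric: `1, 1, -1, -1` if `L = 0`, `1, 1, -1, -1, 1`
if `L > 0`, and `1, 1, -1, -1, -1` if `L < 0`. -/
def ambSign (L : ℝ) (i : Fin (ambDim L)) : ℝ :=
  if i.val < 2 then 1 else if i.val < 4 then -1 else if 0 < L then 1 else -1

/-- The ambient space `E^4_2` (`L = 0`), `E^5_2` (`L > 0`) or `E^5_3` (`L < 0`). -/
abbrev Amb (L : ℝ) : Type := Fin (ambDim L) → ℝ

/-- The ambient metric `⟨x, y⟩`. -/
def form (L : ℝ) (x y : Amb L) : ℝ := ∑ i, ambSign L i * x i * y i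

/-- The neutral space form `N` of constant sectional curvature `L`: the whole of `E^4_2` if
`L = 0`, and the quadric `⟨x, x⟩ = 1 / L` in `E^5_2` or `E^5_3` if `L ≠ 0`. -/
def spaceForm (L : ℝ) : Set (Amb L) := {x | L ≠ 0 → form L x x = 1 / L}

/-- The tangent space of `N` at `x`, as a subset of the ambient space. -/
def tangentN (L : ℝ) (x : Amb L) : Set (Amb L) := {w | L ≠ 0 → form L w x = 0}

/-- `Φ` (restricted to `N`) is an isometry of `N`: a smooth bijection of `N` whose differential
preserves the metric of the tangent spaces (so that its inverse is smooth as well). -/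
structure IsIsometryOfN (L : ℝ) (Φ : Amb L → Amb L) : Prop where
  smooth : ContDiff ℝ ∞ Φ
  bijOn : Set.BijOn Φ (spaceForm L) (spaceForm L)
  isometric : ∀ x ∈ spaceForm L, ∀ w ∈ tangentN L x, ∀ w' ∈ tangentN L x,
    form L (fderiv ℝ Φ x w) (fderiv ℝ Φ x w') = form L w w'

/-! ## Curvature of a metric in coordinates -/

/-- The Christoffel symbol `Γ^k_{ij}` of the Levi-Civita connection of `g`. -/
def christoffel (g : ℝ × ℝ → Matrix (Fin 2) (Fin 2) ℝ) (k i j : Fin 2) (x : ℝ × ℝ) : ℝ :=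
  (1 / 2) * ∑ l, (g x)⁻¹ k l *
    (pd i (fun y => g y j l) x + pd j (fun y => g y i l) x - pd l (fun y => g y i j) x)

/-- The component `R^l` of the curvature tensor: `R(∂_i, ∂_j) ∂_k = ∑ l, R^l ∂_l`, where
`R(X, Y) Z = ∇_X ∇_Y Z - ∇_Y ∇_X Z - ∇_[X, Y] Z`. -/
def riemann (g : ℝ × ℝ → Matrix (Fin 2) (Fin 2) ℝ) (l i j k : Fin 2) (x : ℝ × ℝ) : ℝ :=
  pd i (christoffel g l j k) x - pd j (christoffel g l i k) x
    + ∑ m, (christoffel g m j k x * christoffel g l i m x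
      - christoffel g m i k x * christoffel g l j m x)

/-- The curvature `K = g(R(∂_u, ∂_v) ∂_v, ∂_u) / det g` of the metric `g`. -/
def curvature (g : ℝ × ℝ → Matrix (Fin 2) (Fin 2) ℝ) (x : ℝ × ℝ) : ℝ :=
  (∑ l, riemann g l 0 1 1 x * g x l 0) / (g x).det

/-! ## Surfaces in `N`, in a local coordinate

Here `f` is a map into the ambient space, considered on an open set of the `(u, v)`-plane. -/

/-- The components of the induced metric. -/
def metric (L : ℝ) (f : ℝ × ℝ → Amb L) (x : ℝ × ℝ) : Matrix (Fin 2) (Fin 2) ℝ :=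
  Matrix.of fun i j => form L (pd i f x) (pd j f x)

/-- The normal component of the ambient vector `w` at `f x`: the orthogonal projection of `w` to
the orthogonal complement of `∂f/∂u`, `∂f/∂v` in the tangent space of `N` at `f x`. -/
def normalPart (L : ℝ) (f : ℝ × ℝ → Amb L) (x : ℝ × ℝ) (w : Amb L) : Amb L :=
  w - (∑ i, ∑ j, ((metric L f x)⁻¹ i j * form L w (pd j f x)) • pd i f x)
    - (L * form L w (f x)) • f x

/-- The second fundamental form `σ(∂_i, ∂_j)`. -/
def secondFF (L : ℝ) (f : ℝ × ℝ → Amb L) (i j : Fin 2) (x : ℝ × ℝ) : Amb L :=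
  normalPart L f x (pd i (pd j f) x)

/-- The mean curvature vector, half of the trace of the second fundamental form. -/
def meanCurvature (L : ℝ) (f : ℝ × ℝ → Amb L) (x : ℝ × ℝ) : Amb L :=
  (1 / 2 : ℝ) • ∑ i, ∑ j, (metric L f x)⁻¹ i j • secondFF L f i j x

/-- On `U`, `f` is a smooth map into `N` which is a time-like immersion, conformal with respect
to `w = u + j v` (the induced metric is a positive multiple of `du ^ 2 - dv ^ 2`), with zero
mean curvature vector. -/
structure IsZeroMeanOn (L : ℝ) (f : ℝ × ℝ → Amb L) (U : Set (ℝ × ℝ)) : Prop where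
  smooth : ContDiffOn ℝ ∞ f U
  mapsTo : Set.MapsTo f U (spaceForm L)
  timelike : ∀ x ∈ U, 0 < form L (dU f x) (dU f x)
  conformal : ∀ x ∈ U, form L (dV f x) (dV f x) = - form L (dU f x) (dU f x) ∧
    form L (dU f x) (dV f x) = 0
  meanCurvature_eq : ∀ x ∈ U, meanCurvature L f x = 0

/-- `ξ` is a smooth normal vector field of `f` on `W`. -/
structure IsNormalField (L : ℝ) (f : ℝ × ℝ → Amb L) (ξ : ℝ × ℝ → Amb L)
    (W : Set (ℝ × ℝ)) : Prop where
  smooth : ContDiffOn ℝ ∞ ξ W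
  tangent : ∀ x ∈ W, ξ x ∈ tangentN L (f x)
  normal : ∀ x ∈ W, form L (ξ x) (dU f x) = 0 ∧ form L (ξ x) (dV f x) = 0

/-- The covariant derivative `∇^⊥_{∂_i} ξ` with respect to the normal connection. -/
def normalDeriv (L : ℝ) (f : ℝ × ℝ → Amb L) (i : Fin 2) (ξ : ℝ × ℝ → Amb L) (x : ℝ × ℝ) :
    Amb L := normalPart L f x (pd i ξ x)

/-- The curvature tensor of the normal connection: `R^⊥(∂_u, ∂_v) ξ`. -/
def normalCurvature (L : ℝ) (f : ℝ × ℝ → Amb L) (ξ : ℝ × ℝ → Amb L) (x : ℝ × ℝ) : Amb L :=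
  normalDeriv L f 0 (normalDeriv L f 1 ξ) x - normalDeriv L f 1 (normalDeriv L f 0 ξ) x

/-- The normal connection of `f` is flat on `U`: its curvature tensor vanishes on all local
normal vector fields. -/
def HasFlatNormalConnectionOn (L : ℝ) (f : ℝ × ℝ → Amb L) (U : Set (ℝ × ℝ)) : Prop :=
  ∀ W ⊆ U, IsOpen W → ∀ ξ : ℝ × ℝ → Amb L, IsNormalField L f ξ W →
    ∀ x ∈ W, normalCurvature L f ξ x = 0

/-- The induced metric of `f` is `exp (2 λ) (du ^ 2 - dv ^ 2)` on `U`. -/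
def IsConformalFactorOn (L : ℝ) (f : ℝ × ℝ → Amb L) (lam : ℝ × ℝ → ℝ)
    (U : Set (ℝ × ℝ)) : Prop :=
  ∀ x ∈ U, form L (dU f x) (dU f x) = Real.exp (2 * lam x) ∧
    form L (dV f x) (dV f x) = - Real.exp (2 * lam x) ∧ form L (dU f x) (dV f x) = 0

/-- Normal vector fields `N₁`, `N₂` with `h(N₁, N₁) = -h(N₂, N₂) = exp (2 λ)`,
`h(N₁, N₂) = 0`. -/
structure IsNormalFrameOn (L : ℝ) (f : ℝ × ℝ → Amb L) (lam : ℝ × ℝ → ℝ)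
    (N₁ N₂ : ℝ × ℝ → Amb L) (U : Set (ℝ × ℝ)) : Prop where
  normal₁ : IsNormalField L f N₁ U
  normal₂ : IsNormalField L f N₂ U
  gram : ∀ x ∈ U, form L (N₁ x) (N₁ x) = Real.exp (2 * lam x) ∧
    form L (N₂ x) (N₂ x) = - Real.exp (2 * lam x) ∧ form L (N₁ x) (N₂ x) = 0

/-- Six functions `α_k`, `β_k`, `μ_k` (`k = 1, 2`). -/
structure Coeffs where
  α₁ : ℝ × ℝ → ℝ
  α₂ : ℝ × ℝ → ℝ
  β₁ : ℝ × ℝ → ℝ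
  β₂ : ℝ × ℝ → ℝ
  μ₁ : ℝ × ℝ → ℝ
  μ₂ : ℝ × ℝ → ℝ

/-- The coefficient matrix `S` of the moving frame equation in the direction `u`. -/
def matS (L : ℝ) (lam : ℝ × ℝ → ℝ) (C : Coeffs) (x : ℝ × ℝ) : Matrix (Fin 5) (Fin 5) ℝ :=
  !![dU lam x, dV lam x, -C.α₁ x, C.β₁ x, 1;
     dV lam x, dU lam x, C.α₂ x, -C.β₂ x, 0;
     C.α₁ x, C.α₂ x, dU lam x, C.μ₁ x, 0;
     C.β₁ x, C.β₂ x, C.μ₁ x, dU lam x, 0;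
     -L * Real.exp (2 * lam x), 0, 0, 0, 0]

/-- The coefficient matrix `T` of the moving frame equation in the direction `v`. -/
def matT (L : ℝ) (lam : ℝ × ℝ → ℝ) (C : Coeffs) (x : ℝ × ℝ) : Matrix (Fin 5) (Fin 5) ℝ :=
  !![dV lam x, dU lam x, -C.α₂ x, C.β₂ x, 0;
     dU lam x, dV lam x, C.α₁ x, -C.β₁ x, 1;
     C.α₂ x, C.α₁ x, dV lam x, C.μ₂ x, 0;
     C.β₂ x, C.β₁ x, C.μ₂ x, dV lam x, 0;
     0, L * Real.exp (2 * lam x), 0, 0, 0]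

/-- The moving frame `(T₁, T₂, N₁, N₂, F)`. -/
def frame (L : ℝ) (f N₁ N₂ : ℝ × ℝ → Amb L) (j : Fin 5) : ℝ × ℝ → Amb L :=
  ![dU f, dV f, N₁, N₂, f] j

/-- The functions `α_k`, `β_k`, `μ_k` are the coefficients of `f` with respect to the normal
frame `N₁`, `N₂`: the derivatives of the moving frame in the directions `u`, `v` are its products
with `S`, `T`. -/
def HasCoeffsOn (L : ℝ) (f : ℝ × ℝ → Amb L) (lam : ℝ × ℝ → ℝ) (N₁ N₂ : ℝ × ℝ → Amb L)
    (C : Coeffs) (U : Set (ℝ × ℝ)) : Prop :=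
  ∀ x ∈ U, ∀ j,
    dU (frame L f N₁ N₂ j) x = ∑ i, matS L lam C x i j • frame L f N₁ N₂ i x ∧
    dV (frame L f N₁ N₂ j) x = ∑ i, matT L lam C x i j • frame L f N₁ N₂ i x

/-! ## The explicit data -/

/-- `λ` is a smooth solution of `λ_uu - λ_vv = -L exp (2 λ) + ε exp (-2 λ)` on `U`. -/
def SolvesEquationOn (L ε : ℝ) (lam : ℝ × ℝ → ℝ) (U : Set (ℝ × ℝ)) : Prop :=
  ContDiffOn ℝ ∞ lam U ∧ ∀ x ∈ U,
    dU (dU lam) x - dV (dV lam) x =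
      -L * Real.exp (2 * lam x) + ε * Real.exp (-2 * lam x)

/-- The functions `α_k`, `β_k`, `μ_k` are given on `U` by the explicit formulas in terms of
smooth functions `P_±`, `Q_±` (here `Pp`, `Pm`, `Qp`, `Qm`), a constant `c` and signs `ε'_±`
(here `εp`, `εm`), where `R = -2 λ = P_± + Q_±`, `Q_- = P_+ + c`, `Q_+ = P_- + c`. -/
def AreExplicitOn (ε : ℝ) (lam : ℝ × ℝ → ℝ) (C : Coeffs) (U : Set (ℝ × ℝ)) : Prop :=
  ∃ (Pp Pm Qp Qm : ℝ × ℝ → ℝ) (c εp εm : ℝ),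
    (ContDiffOn ℝ ∞ Pp U ∧ ContDiffOn ℝ ∞ Pm U ∧ ContDiffOn ℝ ∞ Qp U ∧ ContDiffOn ℝ ∞ Qm U) ∧
    (εp = 1 ∨ εp = -1) ∧ (εm = 1 ∨ εm = -1) ∧
    (∀ x ∈ U, -2 * lam x = Pp x + Qp x ∧ -2 * lam x = Pm x + Qm x ∧
      Qm x = Pp x + c ∧ Qp x = Pm x + c) ∧
    (∀ x ∈ U,
      C.μ₁ x = 1 / (2 * Real.sqrt 2) *
        (dS (fun y => Qp y - Qm y) x - dT (fun y => Pp y - Pm y) x) ∧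
      C.μ₂ x = 1 / (2 * Real.sqrt 2) *
        (dS (fun y => Qp y - Qm y) x + dT (fun y => Pp y - Pm y) x)) ∧
    (∀ x ∈ U, ∃ Xp Xm Yp Ym : ℝ,
      Xp = εp / 2 * (Real.exp (Pp x) + ε * Real.exp (Qp x)) ∧
      Xm = εm / 2 * (Real.exp (Pm x) + ε * Real.exp (Qm x)) ∧
      Yp = εp / 2 * (Real.exp (Pp x) - ε * Real.exp (Qp x)) ∧
      Ym = εm / 2 * (Real.exp (Pm x) - ε * Real.exp (Qm x)) ∧
      C.α₁ x = (Xp + Xm) / 2 ∧ C.α₂ x = (Yp + Ym) / 2 ∧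
      C.β₁ x = (Yp - Ym) / 2 ∧ C.β₂ x = (Xp - Xm) / 2)

/-- On `U`, `f` is a time-like surface in `N` with zero mean curvature vector, induced metric
`exp (2 λ) (du ^ 2 - dv ^ 2)` and, for some normal frame, coefficients `α_k`, `β_k`, `μ_k`. -/
def IsSurfaceWithDataOn (L : ℝ) (lam : ℝ × ℝ → ℝ) (C : Coeffs) (f : ℝ × ℝ → Amb L)
    (U : Set (ℝ × ℝ)) : Prop :=
  IsZeroMeanOn L f U ∧ IsConformalFactorOn L f lam U ∧
    ∃ N₁ N₂ : ℝ × ℝ → Amb L, IsNormalFrameOn L f lam N₁ N₂ U ∧ HasCoeffsOn L f lam N₁ N₂ C U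

/-! ## Surfaces in `N` parametrized by a Lorentz surface -/

section Global

variable {M : Type*} [TopologicalSpace M] [ChartedSpace (ℝ × ℝ) M]

/-- `F : M → N` is a smooth time-like conformal immersion with zero mean curvature vector: it is
one in each local paracomplex coordinate. -/
def IsZeroMean (L : ℝ) (F : M → Amb L) : Prop :=
  ∀ e ∈ lorentzGroupoid.maximalAtlas M, IsZeroMeanOn L (F ∘ e.symm) e.target

/-- The curvature `K` of the induced metric at `p`, computed in the preferred local paracomplex
coordinate at `p`. -/
def gaussCurvature (L : ℝ) (F : M → Amb L) (p : M) : ℝ :=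
  curvature (metric L (F ∘ (chartAt (ℝ × ℝ) p).symm)) (chartAt (ℝ × ℝ) p p)

/-- The normal connection of `F` is flat, `R^⊥ = 0`. -/
def HasFlatNormalConnection (L : ℝ) (F : M → Amb L) : Prop :=
  ∀ e ∈ lorentzGroupoid.maximalAtlas M, HasFlatNormalConnectionOn L (F ∘ e.symm) e.target

/-- Around each point there is a local paracomplex coordinate in which `g = exp (2 λ) dw dw̄`
with `λ` a solution of the equation and in which, *for some* normal frame, the coefficients are
given by the explicit formulas. -/
def HasExplicitFormForSomeFrame (L : ℝ) (F : M → Amb L) : Prop :=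
  ∀ p : M, ∃ e ∈ lorentzGroupoid.maximalAtlas M, p ∈ e.source ∧
    ∃ (lam : ℝ × ℝ → ℝ) (ε : ℝ), (ε = 1 ∨ ε = -1) ∧
      IsConformalFactorOn L (F ∘ e.symm) lam e.target ∧ SolvesEquationOn L ε lam e.target ∧
      ∃ N₁ N₂ : ℝ × ℝ → Amb L, IsNormalFrameOn L (F ∘ e.symm) lam N₁ N₂ e.target ∧
        ∃ C : Coeffs, HasCoeffsOn L (F ∘ e.symm) lam N₁ N₂ C e.target ∧
          AreExplicitOn ε lam C e.target

/-- Around each point there is a local paracomplex coordinate in which `g = exp (2 λ) dw dw̄`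
with `λ` a solution of the equation and in which normal frames exist and, *for every* one of
them, the coefficients are given by the explicit formulas. -/
def HasExplicitFormForEveryFrame (L : ℝ) (F : M → Amb L) : Prop :=
  ∀ p : M, ∃ e ∈ lorentzGroupoid.maximalAtlas M, p ∈ e.source ∧
    ∃ (lam : ℝ × ℝ → ℝ) (ε : ℝ), (ε = 1 ∨ ε = -1) ∧
      IsConformalFactorOn L (F ∘ e.symm) lam e.target ∧ SolvesEquationOn L ε lam e.target ∧
      (∃ N₁ N₂ : ℝ × ℝ → Amb L, IsNormalFrameOn L (F ∘ e.symm) lam N₁ N₂ e.target) ∧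
      ∀ N₁ N₂ : ℝ × ℝ → Amb L, IsNormalFrameOn L (F ∘ e.symm) lam N₁ N₂ e.target →
        ∃ C : Coeffs, HasCoeffsOn L (F ∘ e.symm) lam N₁ N₂ C e.target ∧
          AreExplicitOn ε lam C e.target

end Global

end NeutralSurface

end

/-!
Write `∂_± = ∂_u ± ∂_v` for the null directions of a local paracomplex coordinate (`dP`, `dM` below)
and `σ` for the second fundamental form. Zero mean curvature means `σ(∂_+, ∂_-) = 0`, so that `σ` is
given by the two normal vectors `σ_+ = σ(∂_+, ∂_+)` and `σ_- = σ(∂_-, ∂_-)` (`sffP`, `sffM`).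

**The geometric conditions.** By the Gauss equation (`IsZeroMeanOn.gauss`), `K ≠ L₀` means
`⟨σ_+, σ_-⟩ ≠ 0`, and the equation for `λ` with the sign `ε` means `⟨σ_+, σ_-⟩ = 4 ε`
(`IsZeroMeanOn.curvature_ne_iff`, `IsZeroMeanOn.form_sff_of_solves`,
`IsZeroMeanOn.exists_solvesEquationOn`). By the Ricci equation, `R^⊥ = 0` means that `σ_+` and `σ_-`
are proportional (`IsZeroMeanOn.flat_iff`), which in terms of the coefficients is `α₁ β₂ = α₂ β₁`
(`HasCoeffsOn.hasProportionalSff_iff`). A change of the coordinate multiplies `σ_+` and `σ_-` by the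
squares of nonvanishing factors, so both conditions may be tested in any coordinate. As the explicit
formulas give `α₁ β₂ = α₂ β₁`, they imply the geometric conditions
(`IsZeroMean.curvature_ne_and_flat`).

**The normalized coordinate.** The position vector satisfies a wave equation, from which
`⟨f_++, f_++⟩ = ⟨σ_+, σ_+⟩` is constant along `∂_-`, and `⟨σ_-, σ_-⟩` is constant along `∂_+`. If
`σ_+` and `σ_-` are proportional, then `⟨σ_+, σ_+⟩ ⟨σ_-, σ_-⟩ = ⟨σ_+, σ_-⟩ ^ 2`, so none of these
functions has a zero where `K ≠ L₀`. Integrating the fourth roots of their absolute values, each of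
which depends on one null variable, gives a coordinate in which `⟨σ_+, σ_-⟩ = ± 4`
(`IsZeroMeanOn.exists_normalizing`).

**The coefficients.** In such a coordinate let `N₁`, `N₂` be any normal frame. The Codazzi
equations, multiplied with the null normal fields `N₁ ± N₂`, are linear homogeneous equations of first order,
each for one of the functions `X_± + Y_±`, `X_± - Y_±`. These have no zeros, since
`(X_± + Y_±) (X_± - Y_±) = ε e^{-2λ}`. The logarithms of their absolute values are `P_±` and `Q_±`;
the equations determine `μ_1` and `μ_2`, and say that `Q_- - P_+ = Q_+ - P_-` is constant
(`HasCoeffsOn.areExplicitOn`).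

**The converse.** Explicit data satisfy the equations of Gauss, Codazzi and Ricci
(`AreExplicitOn.satisfiesCompatibility`). These are the integrability condition of the moving
frame equations, which can then be solved by the Frobenius theorem for linear systems
(`exists_flat_section`). It is proved here by solving the ordinary differential equations along rays
and using flatness to show that the result solves the system in all directions. The Gram matrix of
the moving frame `(T₁, T₂, N₁, N₂, L₀ F)` and the Gram matrix expected of it satisfy the same linear
system, and therefore agree if they agree at one point (`form_eq_of_linearSystem`). Two solutions
differ by the isometry of the space form that matches their frames at one point, because both
satisfy the same linear system (`exists_isometry_of_isSurfaceWithDataOn`).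
-/

noncomputable section

namespace NeutralSurface

/-! ### Directional derivatives in the plane -/

section Directional

variable {E : Type*} [NormedAddCommGroup E] [NormedSpace ℝ E]

/-- The derivative of `f` in the constant direction `w`, as a function on the plane. -/
def dd (w : ℝ × ℝ) (f : ℝ × ℝ → E) (x : ℝ × ℝ) : E := fderiv ℝ f x w

/-- The derivative `∂_+ = ∂/∂u + ∂/∂v` in the first null direction. -/
notation "dP" => dd (1, 1)
/-- The derivative `∂_- = ∂/∂u - ∂/∂v` in the second null direction. -/
notation "dM" => dd (1, -1)

theorem dU_eq_dd (f : ℝ × ℝ → E) : dU f = dd (1, 0) f := rfl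

theorem dV_eq_dd (f : ℝ × ℝ → E) : dV f = dd (0, 1) f := rfl

theorem dP_eq (f : ℝ × ℝ → E) (x : ℝ × ℝ) : dP f x = dU f x + dV f x := by
  simp only [dd, dU, dV, ← map_add]; simp

theorem dM_eq (f : ℝ × ℝ → E) (x : ℝ × ℝ) : dM f x = dU f x - dV f x := by
  simp only [dd, dU, dV, ← map_sub]; simp

theorem dU_eq_half (f : ℝ × ℝ → E) (x : ℝ × ℝ) : dU f x = (1 / 2 : ℝ) • (dP f x + dM f x) := by
  rw [dP_eq, dM_eq]; module

theorem dV_eq_half (f : ℝ × ℝ → E) (x : ℝ × ℝ) : dV f x = (1 / 2 : ℝ) • (dP f x - dM f x) := by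
  rw [dP_eq, dM_eq]; module

theorem pd_zero (f : ℝ × ℝ → E) : pd 0 f = dU f := rfl

theorem pd_one (f : ℝ × ℝ → E) : pd 1 f = dV f := rfl

variable {f g : ℝ × ℝ → E} {U : Set (ℝ × ℝ)} {x w w' : ℝ × ℝ}

theorem dd_congr (h : f =ᶠ[nhds x] g) : dd w f x = dd w g x := by
  unfold dd; rw [h.fderiv_eq]

theorem dd_congr_on (hU : IsOpen U) (h : ∀ y ∈ U, f y = g y) (hx : x ∈ U) :
    dd w f x = dd w g x :=
  dd_congr (Filter.eventuallyEq_of_mem (hU.mem_nhds hx) h)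

theorem contDiffOn_dd (hf : ContDiffOn ℝ ∞ f U) (hU : IsOpen U) :
    ContDiffOn ℝ ∞ (dd w f) U :=
  (hf.fderiv_of_isOpen hU (by simp)).clm_apply contDiffOn_const

theorem differentiableAt_of_smooth (hf : ContDiffOn ℝ ∞ f U) (hU : IsOpen U) (hx : x ∈ U) :
    DifferentiableAt ℝ f x :=
  (hf.contDiffAt (hU.mem_nhds hx)).differentiableAt (by simp)

theorem dd_comm (hf : ContDiffOn ℝ ∞ f U) (hU : IsOpen U) (hx : x ∈ U) :
    dd w (dd w' f) x = dd w' (dd w f) x := by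
  have h2 : DifferentiableAt ℝ (fderiv ℝ f) x :=
    differentiableAt_of_smooth (hf.fderiv_of_isOpen hU (by simp)) hU hx
  have hs : IsSymmSndFDerivAt ℝ f x :=
    (hf.contDiffAt (hU.mem_nhds hx)).isSymmSndFDerivAt (by
      simpa using (WithTop.coe_le_coe.2 le_top : ((2 : ℕ∞) : WithTop ℕ∞) ≤ ∞))
  unfold dd
  rw [fderiv_clm_apply h2 (by fun_prop), fderiv_clm_apply h2 (by fun_prop)]
  simpa using hs w w'

theorem dd_const (c : E) : dd w (fun _ => c) x = 0 := by simp [dd]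

theorem dd_add (hf : DifferentiableAt ℝ f x) (hg : DifferentiableAt ℝ g x) :
    dd w (fun y => f y + g y) x = dd w f x + dd w g x := by
  unfold dd; rw [fderiv_fun_add hf hg]; rfl

theorem dd_sub (hf : DifferentiableAt ℝ f x) (hg : DifferentiableAt ℝ g x) :
    dd w (fun y => f y - g y) x = dd w f x - dd w g x := by
  unfold dd; rw [fderiv_fun_sub hf hg]; rfl

theorem dd_smul {a : ℝ × ℝ → ℝ} (ha : DifferentiableAt ℝ a x) (hf : DifferentiableAt ℝ f x) :
    dd w (fun y => a y • f y) x = dd w a x • f x + a x • dd w f x := by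
  unfold dd; rw [fderiv_fun_smul ha hf]; simp [add_comm]

theorem dd_const_smul (c : ℝ) (hf : DifferentiableAt ℝ f x) :
    dd w (fun y => c • f y) x = c • dd w f x := by
  unfold dd; rw [fderiv_fun_const_smul hf]; rfl

theorem dd_mul {a b : ℝ × ℝ → ℝ} (ha : DifferentiableAt ℝ a x) (hb : DifferentiableAt ℝ b x) :
    dd w (fun y => a y * b y) x = dd w a x * b x + a x * dd w b x :=
  dd_smul ha hb

theorem dd_const_mul {a : ℝ × ℝ → ℝ} (c : ℝ) (ha : DifferentiableAt ℝ a x) :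
    dd w (fun y => c * a y) x = c * dd w a x := dd_const_smul c ha

theorem dd_exp {a : ℝ × ℝ → ℝ} (ha : DifferentiableAt ℝ a x) :
    dd w (fun y => Real.exp (a y)) x = Real.exp (a x) * dd w a x := by
  unfold dd; rw [fderiv_exp ha]; rfl

theorem dd_log {a : ℝ × ℝ → ℝ} (ha : DifferentiableAt ℝ a x) (h0 : a x ≠ 0) :
    dd w (fun y => Real.log (a y)) x = dd w a x / a x := by
  unfold dd; rw [fderiv.log ha h0]; simp [div_eq_inv_mul]

theorem dd_comp {φ : ℝ × ℝ → ℝ × ℝ} (hf : DifferentiableAt ℝ f (φ x))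
    (hφ : DifferentiableAt ℝ φ x) : dd w (f ∘ φ) x = dd (dd w φ x) f (φ x) := by
  unfold dd; rw [fderiv_comp x hf hφ]; rfl

theorem dd_smul_dir (c : ℝ) : dd (c • w) f x = c • dd w f x := by simp [dd]

theorem dM_dP_eq_sub (hf : ContDiffOn ℝ ∞ f U) (hU : IsOpen U) (hx : x ∈ U) :
    dM (dP f) x = dU (dU f) x - dV (dV f) x := by
  have h1 : dM (dP f) x = dM (fun y => dU f y + dV f y) x :=
    dd_congr_on hU (fun y _ => dP_eq f y) hx
  have hu := differentiableAt_of_smooth (contDiffOn_dd (w := (1, 0)) hf hU) hU hx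
  have hv := differentiableAt_of_smooth (contDiffOn_dd (w := (0, 1)) hf hU) hU hx
  have h2 : dM (fun y => dU f y + dV f y) x = dM (dU f) x + dM (dV f) x := dd_add hu hv
  have h3 : dU (dV f) x = dV (dU f) x := dd_comm hf hU hx
  rw [h1, h2, dM_eq, dM_eq, h3]; abel

theorem dP_dP_eq (hf : ContDiffOn ℝ ∞ f U) (hU : IsOpen U) (hx : x ∈ U) :
    dP (dP f) x = dU (dU f) x + (2 : ℝ) • dU (dV f) x + dV (dV f) x := by
  have h1 : dP (dP f) x = dP (fun y => dU f y + dV f y) x :=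
    dd_congr_on hU (fun y _ => dP_eq f y) hx
  have hu := differentiableAt_of_smooth (contDiffOn_dd (w := (1, 0)) hf hU) hU hx
  have hv := differentiableAt_of_smooth (contDiffOn_dd (w := (0, 1)) hf hU) hU hx
  have h2 : dP (fun y => dU f y + dV f y) x = dP (dU f) x + dP (dV f) x := dd_add hu hv
  have h3 : dU (dV f) x = dV (dU f) x := dd_comm hf hU hx
  rw [h1, h2, dP_eq, dP_eq, h3]; module

theorem dM_dM_eq (hf : ContDiffOn ℝ ∞ f U) (hU : IsOpen U) (hx : x ∈ U) :
    dM (dM f) x = dU (dU f) x - (2 : ℝ) • dU (dV f) x + dV (dV f) x := by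
  have h1 : dM (dM f) x = dM (fun y => dU f y - dV f y) x :=
    dd_congr_on hU (fun y _ => dM_eq f y) hx
  have hu := differentiableAt_of_smooth (contDiffOn_dd (w := (1, 0)) hf hU) hU hx
  have hv := differentiableAt_of_smooth (contDiffOn_dd (w := (0, 1)) hf hU) hU hx
  have h2 : dM (fun y => dU f y - dV f y) x = dM (dU f) x - dM (dV f) x := dd_sub hu hv
  have h3 : dU (dV f) x = dV (dU f) x := dd_comm hf hU hx
  rw [h1, h2, dM_eq, dM_eq, h3]; module

end Directional

/-! ### The ambient metric -/

section Form

variable {L : ℝ}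

theorem form_comm (a b : Amb L) : form L a b = form L b a := by
  unfold form; exact Finset.sum_congr rfl fun i _ => by ring

theorem form_add_left (a b c : Amb L) : form L (a + b) c = form L a c + form L b c := by
  unfold form; rw [← Finset.sum_add_distrib]
  exact Finset.sum_congr rfl fun i _ => by simp only [Pi.add_apply]; ring

theorem form_smul_left (r : ℝ) (a c : Amb L) : form L (r • a) c = r * form L a c := by
  unfold form; rw [Finset.mul_sum]
  exact Finset.sum_congr rfl fun i _ => by simp only [Pi.smul_apply, smul_eq_mul]; ring

theorem form_add_right (a b c : Amb L) : form L c (a + b) = form L c a + form L c b := by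
  rw [form_comm, form_add_left, form_comm a, form_comm b]

theorem form_smul_right (r : ℝ) (a c : Amb L) : form L c (r • a) = r * form L c a := by
  rw [form_comm, form_smul_left, form_comm a]

/-- The ambient metric as a continuous bilinear map. -/
def formL (L : ℝ) : Amb L →L[ℝ] Amb L →L[ℝ] ℝ :=
  (LinearMap.mk₂ ℝ (form L) form_add_left form_smul_left
    (fun c a b => form_add_right a b c) (fun r c a => form_smul_right r a c)).toContinuousBilinearMap

theorem formL_apply (a b : Amb L) : formL L a b = form L a b := rfl

theorem form_sub_left (a b c : Amb L) : form L (a - b) c = form L a c - form L b c := by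
  simp only [← formL_apply, map_sub, sub_apply]

theorem form_sub_right (a b c : Amb L) : form L c (a - b) = form L c a - form L c b := by
  simp only [← formL_apply, map_sub]

theorem form_zero_right (c : Amb L) : form L c 0 = 0 := by
  simp only [← formL_apply, map_zero]

theorem form_sum_left {ι : Type*} (s : Finset ι) (a : ι → Amb L) (c : Amb L) :
    form L (∑ i ∈ s, a i) c = ∑ i ∈ s, form L (a i) c := by
  simp only [← formL_apply, map_sum, sum_apply]

theorem form_sum_right {ι : Type*} (s : Finset ι) (a : ι → Amb L) (c : Amb L) :
    form L c (∑ i ∈ s, a i) = ∑ i ∈ s, form L c (a i) := by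
  simp only [← formL_apply, map_sum]

variable {a b : ℝ × ℝ → Amb L} {U : Set (ℝ × ℝ)} {x w : ℝ × ℝ}

theorem dd_form (ha : DifferentiableAt ℝ a x) (hb : DifferentiableAt ℝ b x) :
    dd w (fun y => form L (a y) (b y)) x = form L (dd w a x) (b x) + form L (a x) (dd w b x) := by
  have := (formL L).fderiv_of_bilinear ha hb
  simp only [formL_apply] at this
  unfold dd; rw [this, add_comm]; rfl

theorem contDiffOn_form (ha : ContDiffOn ℝ ∞ a U) (hb : ContDiffOn ℝ ∞ b U) :
    ContDiffOn ℝ ∞ (fun y => form L (a y) (b y)) U :=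
  (formL L).isBoundedBilinearMap.contDiff.comp_contDiffOn (ha.prodMk hb)

end Form

/-! ### The normal projection of a conformal surface -/

section Pointwise

variable {L E : ℝ} {f : ℝ × ℝ → Amb L} {x : ℝ × ℝ}

/-- At the point `x`, the metric induced by `f` is `E (du ^ 2 - dv ^ 2)` with `E > 0`, and the
tangent plane is orthogonal to the position vector if the space form is curved. The factor `L` in
`form_U_self`, `form_V_self` and `pos_sq` makes these conditions void in the flat case. -/
structure IsConformalAt (L : ℝ) (f : ℝ × ℝ → Amb L) (E : ℝ) (x : ℝ × ℝ) : Prop where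
  pos : 0 < E
  form_UU : form L (dU f x) (dU f x) = E
  form_VV : form L (dV f x) (dV f x) = -E
  form_UV : form L (dU f x) (dV f x) = 0
  form_U_self : L * form L (dU f x) (f x) = 0
  form_V_self : L * form L (dV f x) (f x) = 0
  pos_sq : L * (L * form L (f x) (f x)) = L

namespace IsConformalAt

theorem form_VU (h : IsConformalAt L f E x) : form L (dV f x) (dU f x) = 0 := by
  rw [form_comm, h.form_UV]

theorem form_PP (h : IsConformalAt L f E x) : form L (dP f x) (dP f x) = 0 := by
  simp only [dP_eq, form_add_left, form_add_right, h.form_UU, h.form_VV, h.form_UV, h.form_VU]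
  ring

theorem form_MM (h : IsConformalAt L f E x) : form L (dM f x) (dM f x) = 0 := by
  simp only [dM_eq, form_sub_left, form_sub_right, h.form_UU, h.form_VV, h.form_UV, h.form_VU]
  ring

theorem form_PM (h : IsConformalAt L f E x) : form L (dP f x) (dM f x) = 2 * E := by
  simp only [dM_eq, dP_eq, form_add_left, form_sub_right, h.form_UU, h.form_VV, h.form_UV,
    h.form_VU]
  ring

theorem form_MP (h : IsConformalAt L f E x) : form L (dM f x) (dP f x) = 2 * E := by
  rw [form_comm, h.form_PM]

theorem form_P_self (h : IsConformalAt L f E x) : L * form L (dP f x) (f x) = 0 := by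
  rw [dP_eq, form_add_left, mul_add, h.form_U_self, h.form_V_self, add_zero]

theorem form_M_self (h : IsConformalAt L f E x) : L * form L (dM f x) (f x) = 0 := by
  rw [dM_eq, form_sub_left, mul_sub, h.form_U_self, h.form_V_self, sub_zero]

theorem metric_eq (h : IsConformalAt L f E x) : metric L f x = !![E, 0; 0, -E] := by
  ext i j
  fin_cases i <;> fin_cases j
  · exact h.form_UU
  · exact h.form_UV
  · exact h.form_VU
  · exact h.form_VV

theorem metric_inv_eq (h : IsConformalAt L f E x) : (metric L f x)⁻¹ = !![1 / E, 0; 0, -(1 / E)] := by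
  have hE := h.pos.ne'
  rw [h.metric_eq]
  apply Matrix.inv_eq_right_inv
  ext i j
  fin_cases i <;> fin_cases j <;> simp [Matrix.mul_apply, hE]

theorem normalPart_eq_UV (h : IsConformalAt L f E x) (w : Amb L) :
    normalPart L f x w = w - (form L w (dU f x) / E) • dU f x + (form L w (dV f x) / E) • dV f x
      - (L * form L w (f x)) • f x := by
  unfold normalPart
  rw [h.metric_inv_eq]
  simp only [Fin.sum_univ_two, pd_zero, pd_one]
  simp only [Matrix.of_apply, Matrix.cons_val', Matrix.cons_val_zero, Matrix.cons_val_one,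
    Matrix.cons_val_fin_one]
  module

/-- The normal projection in terms of the null tangent vectors. -/
theorem normalPart_eq (h : IsConformalAt L f E x) (w : Amb L) :
    normalPart L f x w = w - (form L w (dM f x) / (2 * E)) • dP f x
      - (form L w (dP f x) / (2 * E)) • dM f x - (L * form L w (f x)) • f x := by
  have hE := h.pos.ne'
  rw [h.normalPart_eq_UV, dP_eq, dM_eq, form_add_right, form_sub_right]
  match_scalars <;> field_simp <;> ring

theorem normalPart_add (h : IsConformalAt L f E x) (w w' : Amb L) :
    normalPart L f x (w + w') = normalPart L f x w + normalPart L f x w' := by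
  simp only [h.normalPart_eq, form_add_left]; module

theorem normalPart_sub (h : IsConformalAt L f E x) (w w' : Amb L) :
    normalPart L f x (w - w') = normalPart L f x w - normalPart L f x w' := by
  simp only [h.normalPart_eq, form_sub_left]; module

theorem normalPart_smul (h : IsConformalAt L f E x) (r : ℝ) (w : Amb L) :
    normalPart L f x (r • w) = r • normalPart L f x w := by
  simp only [h.normalPart_eq, form_smul_left]; module

theorem normalPart_P (h : IsConformalAt L f E x) : normalPart L f x (dP f x) = 0 := by
  have hE := h.pos.ne'
  rw [h.normalPart_eq, h.form_PP, h.form_PM, h.form_P_self]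
  rw [div_self (by positivity)]; simp

theorem normalPart_M (h : IsConformalAt L f E x) : normalPart L f x (dM f x) = 0 := by
  have hE := h.pos.ne'
  rw [h.normalPart_eq, h.form_MM, h.form_MP, h.form_M_self]
  rw [div_self (by positivity)]; simp

theorem normalPart_smul_self (h : IsConformalAt L f E x) : normalPart L f x (L • f x) = 0 := by
  rw [h.normalPart_eq]
  simp only [form_smul_left]
  rw [form_comm (f x) (dM f x), form_comm (f x) (dP f x), h.form_M_self, h.form_P_self,
    h.pos_sq]
  simp

theorem form_normalPart_P (h : IsConformalAt L f E x) (w : Amb L) :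
    form L (normalPart L f x w) (dP f x) = 0 := by
  have hE := h.pos.ne'
  have := h.form_P_self
  rw [h.normalPart_eq]
  simp only [form_sub_left, form_smul_left, h.form_PP, h.form_MP]
  rw [form_comm (f x) (dP f x), mul_comm L, mul_assoc, this]
  field_simp; ring

theorem form_normalPart_M (h : IsConformalAt L f E x) (w : Amb L) :
    form L (normalPart L f x w) (dM f x) = 0 := by
  have hE := h.pos.ne'
  have := h.form_M_self
  rw [h.normalPart_eq]
  simp only [form_sub_left, form_smul_left, h.form_MM, h.form_PM]
  rw [form_comm (f x) (dM f x), mul_comm L, mul_assoc, this]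
  field_simp; ring

theorem form_normalPart_self (h : IsConformalAt L f E x) (w : Amb L) :
    L * form L (normalPart L f x w) (f x) = 0 := by
  rw [h.normalPart_eq]
  simp only [form_sub_left, form_smul_left]
  linear_combination (-(form L w (dM f x) / (2 * E))) * h.form_P_self
    - (form L w (dP f x) / (2 * E)) * h.form_M_self - form L w (f x) * h.pos_sq

/-- The normal projection is symmetric; hence pairing with a normal vector may forget it. -/
theorem form_normalPart_comm (h : IsConformalAt L f E x) (w w' : Amb L) :
    form L (normalPart L f x w) w' = form L w (normalPart L f x w') := by
  simp only [h.normalPart_eq, form_sub_left, form_sub_right, form_smul_left, form_smul_right]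
  rw [form_comm (dP f x) w', form_comm (dM f x) w', form_comm (f x) w']
  ring

theorem normalPart_eq_self (h : IsConformalAt L f E x) {w : Amb L} (hP : form L w (dP f x) = 0)
    (hM : form L w (dM f x) = 0) (hs : L * form L w (f x) = 0) : normalPart L f x w = w := by
  rw [h.normalPart_eq, hP, hM, hs]; simp

theorem normalPart_idem (h : IsConformalAt L f E x) (w : Amb L) :
    normalPart L f x (normalPart L f x w) = normalPart L f x w :=
  h.normalPart_eq_self (h.form_normalPart_P w) (h.form_normalPart_M w) (h.form_normalPart_self w)

end IsConformalAt

end Pointwise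

/-! ### Structure equations of a surface with zero mean curvature vector -/

section ZeroMean

variable {L : ℝ} {f : ℝ × ℝ → Amb L} {U : Set (ℝ × ℝ)} {x : ℝ × ℝ}

/-- The position vector of a map into the space form: `⟨f, f⟩ = 1 / L`, multiplied so as to be void
in the flat case. -/
theorem mul_form_self_of_mem {y : Amb L} (h : y ∈ spaceForm L) : L * (L * form L y y) = L := by
  by_cases hL : L = 0
  · simp [hL]
  · rw [h hL]; field_simp

theorem mul_form_dd_self (hU : IsOpen U) (hf : ContDiffOn ℝ ∞ f U)
    (hm : Set.MapsTo f U (spaceForm L)) (w : ℝ × ℝ) (hx : x ∈ U) :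
    L * form L (dd w f x) (f x) = 0 := by
  by_cases hL : L = 0
  · simp only [hL, zero_mul]
  have hd := differentiableAt_of_smooth hf hU hx
  have h1 : dd w (fun y => form L (f y) (f y)) x = 0 := by
    rw [dd_congr_on hU (g := fun _ => 1 / L) (fun y hy => hm hy hL) hx, dd_const]
  rw [dd_form hd hd, form_comm (f x)] at h1
  have : form L (dd w f x) (f x) = 0 := by linarith
  rw [this, mul_zero]

namespace IsZeroMeanOn

theorem mono {V : Set (ℝ × ℝ)} (h : IsZeroMeanOn L f U) (hV : V ⊆ U) : IsZeroMeanOn L f V :=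
  ⟨h.smooth.mono hV, h.mapsTo.mono_left hV, fun x hx => h.timelike x (hV hx),
    fun x hx => h.conformal x (hV hx), fun x hx => h.meanCurvature_eq x (hV hx)⟩

theorem isConformalAt (h : IsZeroMeanOn L f U) (hU : IsOpen U) (hx : x ∈ U) :
    IsConformalAt L f (form L (dU f x) (dU f x)) x where
  pos := h.timelike x hx
  form_UU := rfl
  form_VV := (h.conformal x hx).1
  form_UV := (h.conformal x hx).2
  form_U_self := mul_form_dd_self hU h.smooth h.mapsTo _ hx
  form_V_self := mul_form_dd_self hU h.smooth h.mapsTo _ hx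
  pos_sq := mul_form_self_of_mem (h.mapsTo hx)

variable (h : IsZeroMeanOn L f U) (hU : IsOpen U)

include h hU

theorem smooth_dd (w : ℝ × ℝ) : ContDiffOn ℝ ∞ (dd w f) U := contDiffOn_dd h.smooth hU

theorem smooth_dd_dd (w w' : ℝ × ℝ) : ContDiffOn ℝ ∞ (dd w (dd w' f)) U :=
  contDiffOn_dd (contDiffOn_dd h.smooth hU) hU

theorem normalPart_dUU (hx : x ∈ U) :
    normalPart L f x (dU (dU f) x) = normalPart L f x (dV (dV f) x) := by
  have hc := h.isConformalAt hU hx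
  have hm := h.meanCurvature_eq x hx
  unfold meanCurvature secondFF at hm
  rw [hc.metric_inv_eq] at hm
  simp only [Fin.sum_univ_two, pd_zero, pd_one, Matrix.of_apply, Matrix.cons_val',
    Matrix.cons_val_zero, Matrix.cons_val_one, Matrix.cons_val_fin_one] at hm
  have hE := hc.pos.ne'
  rw [← sub_eq_zero]
  have h2 : (2 * form L (dU f x) (dU f x)) • (0 : Amb L) = 0 := smul_zero _
  nth_rewrite 1 [← hm] at h2
  rw [← h2]
  match_scalars <;> field_simp <;> ring

/-- The position vector of a surface with zero mean curvature vector satisfies the wave equation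
`f_uu - f_vv = -2 L E f`. -/
theorem dM_dP (hx : x ∈ U) :
    dM (dP f) x = (-2 * form L (dU f x) (dU f x)) • (L • f x) := by
  have hc := h.isConformalAt hU hx
  have hP := differentiableAt_of_smooth (h.smooth_dd hU (1, 1)) hU hx
  have hM := differentiableAt_of_smooth (h.smooth_dd hU (1, -1)) hU hx
  have hd := differentiableAt_of_smooth h.smooth hU hx
  have h0 : normalPart L f x (dM (dP f) x) = 0 := by
    rw [dM_dP_eq_sub h.smooth hU hx, hc.normalPart_sub, h.normalPart_dUU hU hx, sub_self]
  have h1 : form L (dM (dP f) x) (dP f x) = 0 := by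
    have : dM (fun y => form L (dP f y) (dP f y)) x = 0 := by
      rw [dd_congr_on hU (g := fun _ => 0) (fun y hy => (h.isConformalAt hU hy).form_PP) hx,
        dd_const]
    rw [dd_form hP hP, form_comm (dP f x)] at this
    linarith
  have h2 : form L (dM (dP f) x) (dM f x) = 0 := by
    have : dP (fun y => form L (dM f y) (dM f y)) x = 0 := by
      rw [dd_congr_on hU (g := fun _ => 0) (fun y hy => (h.isConformalAt hU hy).form_MM) hx,
        dd_const]
    rw [dd_form hM hM, form_comm (dM f x), dd_comm h.smooth hU hx] at this
    linarith
  have h3 : L * form L (dM (dP f) x) (f x) = -2 * L * form L (dU f x) (dU f x) := by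
    have : dM (fun y => L * form L (dP f y) (f y)) x = 0 := by
      rw [dd_congr_on hU (g := fun _ => 0) (fun y hy => (h.isConformalAt hU hy).form_P_self) hx,
        dd_const]
    rw [dd_const_mul _ (differentiableAt_of_smooth
      (contDiffOn_form (h.smooth_dd hU (1, 1)) h.smooth) hU hx), dd_form hP hd, hc.form_PM] at this
    linarith
  rw [hc.normalPart_eq, h1, h2, h3] at h0
  rw [← sub_eq_zero, ← h0]
  module

end IsZeroMeanOn

end ZeroMean

/-! ### The equations of Gauss, Codazzi and Ricci in null directions -/

section GaussRicci

variable {L : ℝ} {f : ℝ × ℝ → Amb L} {U : Set (ℝ × ℝ)} {x : ℝ × ℝ}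

namespace IsZeroMeanOn

variable (h : IsZeroMeanOn L f U) (hU : IsOpen U)

include h hU

theorem smooth_E : ContDiffOn ℝ ∞ (fun y => form L (dU f y) (dU f y)) U :=
  contDiffOn_form (h.smooth_dd hU (1, 0)) (h.smooth_dd hU (1, 0))

theorem dP_dM (hx : x ∈ U) :
    dP (dM f) x = (-2 * form L (dU f x) (dU f x)) • (L • f x) := by
  rw [dd_comm h.smooth hU hx, h.dM_dP hU hx]

theorem form_PP_P (hx : x ∈ U) : form L (dP (dP f) x) (dP f x) = 0 := by
  have hP := differentiableAt_of_smooth (h.smooth_dd hU (1, 1)) hU hx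
  have : dP (fun y => form L (dP f y) (dP f y)) x = 0 := by
    rw [dd_congr_on hU (g := fun _ => 0) (fun y hy => (h.isConformalAt hU hy).form_PP) hx,
      dd_const]
  rw [dd_form hP hP, form_comm (dP f x)] at this
  linarith

theorem form_MM_M (hx : x ∈ U) : form L (dM (dM f) x) (dM f x) = 0 := by
  have hM := differentiableAt_of_smooth (h.smooth_dd hU (1, -1)) hU hx
  have : dM (fun y => form L (dM f y) (dM f y)) x = 0 := by
    rw [dd_congr_on hU (g := fun _ => 0) (fun y hy => (h.isConformalAt hU hy).form_MM) hx,
      dd_const]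
  rw [dd_form hM hM, form_comm (dM f x)] at this
  linarith

theorem form_PP_self (hx : x ∈ U) : L * form L (dP (dP f) x) (f x) = 0 := by
  have hP := differentiableAt_of_smooth (h.smooth_dd hU (1, 1)) hU hx
  have hd := differentiableAt_of_smooth h.smooth hU hx
  have : dP (fun y => L * form L (dP f y) (f y)) x = 0 := by
    rw [dd_congr_on hU (g := fun _ => 0) (fun y hy => (h.isConformalAt hU hy).form_P_self) hx,
      dd_const]
  rw [dd_const_mul _ (differentiableAt_of_smooth
    (contDiffOn_form (h.smooth_dd hU (1, 1)) h.smooth) hU hx), dd_form hP hd,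
    (h.isConformalAt hU hx).form_PP] at this
  linarith

theorem form_MM_self (hx : x ∈ U) : L * form L (dM (dM f) x) (f x) = 0 := by
  have hM := differentiableAt_of_smooth (h.smooth_dd hU (1, -1)) hU hx
  have hd := differentiableAt_of_smooth h.smooth hU hx
  have : dM (fun y => L * form L (dM f y) (f y)) x = 0 := by
    rw [dd_congr_on hU (g := fun _ => 0) (fun y hy => (h.isConformalAt hU hy).form_M_self) hx,
      dd_const]
  rw [dd_const_mul _ (differentiableAt_of_smooth
    (contDiffOn_form (h.smooth_dd hU (1, -1)) h.smooth) hU hx), dd_form hM hd,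
    (h.isConformalAt hU hx).form_MM] at this
  linarith

/-- The derivative of the equation `f_uu - f_vv = -2 L E f` in an arbitrary direction `w`. -/
theorem dd_dM_dP (w : ℝ × ℝ) (hx : x ∈ U) :
    dd w (dM (dP f)) x =
      (-2 * dd w (fun y => form L (dU f y) (dU f y)) x) • (L • f x)
        + (-2 * form L (dU f x) (dU f x)) • (L • dd w f x) := by
  have hE := differentiableAt_of_smooth (h.smooth_E hU) hU hx
  have hd := differentiableAt_of_smooth h.smooth hU hx
  rw [dd_congr_on hU (fun y hy => h.dM_dP hU hy) hx, dd_smul (hE.const_mul _) (hd.fun_const_smul L),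
    dd_const_mul _ hE, dd_const_smul _ hd]

theorem dM_PP (hx : x ∈ U) :
    dM (dP (dP f)) x =
      (-2 * dP (fun y => form L (dU f y) (dU f y)) x) • (L • f x)
        + (-2 * form L (dU f x) (dU f x)) • (L • dP f x) := by
  rw [dd_comm (h.smooth_dd hU _) hU hx, h.dd_dM_dP hU _ hx]

theorem dP_MM (hx : x ∈ U) :
    dP (dM (dM f)) x =
      (-2 * dM (fun y => form L (dU f y) (dU f y)) x) • (L • f x)
        + (-2 * form L (dU f x) (dU f x)) • (L • dM f x) := by
  rw [dd_comm (h.smooth_dd hU _) hU hx,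
    dd_congr_on hU (fun y hy => dd_comm h.smooth hU hy) hx, h.dd_dM_dP hU _ hx]

/-- The function `⟨f_++, f_++⟩`, a coefficient of the Hopf-type quartic differential, is constant in
the other null direction. -/
theorem dM_form_PP (hx : x ∈ U) :
    dM (fun y => form L (dP (dP f) y) (dP (dP f) y)) x = 0 := by
  have hd := differentiableAt_of_smooth (h.smooth_dd_dd hU (1, 1) (1, 1)) hU hx
  rw [dd_form hd hd, form_comm (dP (dP f) x), h.dM_PP hU hx]
  simp only [form_add_left, form_smul_left]
  rw [form_comm (f x), form_comm (dP f x), h.form_PP_P hU hx, h.form_PP_self hU hx]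
  ring

theorem dP_form_MM (hx : x ∈ U) :
    dP (fun y => form L (dM (dM f) y) (dM (dM f) y)) x = 0 := by
  have hd := differentiableAt_of_smooth (h.smooth_dd_dd hU (1, -1) (1, -1)) hU hx
  rw [dd_form hd hd, form_comm (dM (dM f) x), h.dP_MM hU hx]
  simp only [form_add_left, form_smul_left]
  rw [form_comm (f x), form_comm (dM f x), h.form_MM_M hU hx, h.form_MM_self hU hx]
  ring

theorem form_PP_M (hx : x ∈ U) : form L (dP (dP f) x) (dM f x) =
    2 * dP (fun y => form L (dU f y) (dU f y)) x := by
  have hP := differentiableAt_of_smooth (h.smooth_dd hU (1, 1)) hU hx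
  have hM := differentiableAt_of_smooth (h.smooth_dd hU (1, -1)) hU hx
  have hE := differentiableAt_of_smooth (h.smooth_E hU) hU hx
  have : dP (fun y => form L (dP f y) (dM f y)) x =
      2 * dP (fun y => form L (dU f y) (dU f y)) x := by
    rw [dd_congr_on hU (fun y hy => (h.isConformalAt hU hy).form_PM) hx, dd_const_mul _ hE]
  rw [dd_form hP hM, h.dP_dM hU hx, form_smul_right, form_smul_right] at this
  linear_combination this + 2 * form L (dU f x) (dU f x) * (h.isConformalAt hU hx).form_P_self

theorem form_MM_P (hx : x ∈ U) : form L (dM (dM f) x) (dP f x) =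
    2 * dM (fun y => form L (dU f y) (dU f y)) x := by
  have hP := differentiableAt_of_smooth (h.smooth_dd hU (1, 1)) hU hx
  have hM := differentiableAt_of_smooth (h.smooth_dd hU (1, -1)) hU hx
  have hE := differentiableAt_of_smooth (h.smooth_E hU) hU hx
  have : dM (fun y => form L (dM f y) (dP f y)) x =
      2 * dM (fun y => form L (dU f y) (dU f y)) x := by
    rw [dd_congr_on hU (fun y hy => (h.isConformalAt hU hy).form_MP) hx, dd_const_mul _ hE]
  rw [dd_form hM hP, h.dM_dP hU hx, form_smul_right, form_smul_right] at this
  linear_combination this + 2 * form L (dU f x) (dU f x) * (h.isConformalAt hU hx).form_M_self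

theorem normalPart_PP (hx : x ∈ U) : normalPart L f x (dP (dP f) x) = dP (dP f) x
    - (dP (fun y => form L (dU f y) (dU f y)) x / form L (dU f x) (dU f x)) • dP f x := by
  have hE := (h.isConformalAt hU hx).pos.ne'
  rw [(h.isConformalAt hU hx).normalPart_eq, h.form_PP_M hU hx, h.form_PP_P hU hx,
    h.form_PP_self hU hx]
  match_scalars <;> field_simp <;> ring

theorem normalPart_MM (hx : x ∈ U) : normalPart L f x (dM (dM f) x) = dM (dM f) x
    - (dM (fun y => form L (dU f y) (dU f y)) x / form L (dU f x) (dU f x)) • dM f x := by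
  have hE := (h.isConformalAt hU hx).pos.ne'
  rw [(h.isConformalAt hU hx).normalPart_eq, h.form_MM_M hU hx, h.form_MM_P hU hx,
    h.form_MM_self hU hx]
  match_scalars <;> field_simp <;> ring

theorem form_normalPart_PP_PP (hx : x ∈ U) :
    form L (normalPart L f x (dP (dP f) x)) (normalPart L f x (dP (dP f) x)) =
      form L (dP (dP f) x) (dP (dP f) x) := by
  have hc := h.isConformalAt hU hx
  rw [hc.form_normalPart_comm, hc.normalPart_idem, h.normalPart_PP hU hx, form_sub_right,
    form_smul_right, h.form_PP_P hU hx, mul_zero, sub_zero]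

theorem form_normalPart_MM_MM (hx : x ∈ U) :
    form L (normalPart L f x (dM (dM f) x)) (normalPart L f x (dM (dM f) x)) =
      form L (dM (dM f) x) (dM (dM f) x) := by
  have hc := h.isConformalAt hU hx
  rw [hc.form_normalPart_comm, hc.normalPart_idem, h.normalPart_MM hU hx, form_sub_right,
    form_smul_right, h.form_MM_M hU hx, mul_zero, sub_zero]

/-- The Gauss equation. -/
theorem gauss {lam : ℝ × ℝ → ℝ} (hlam : ContDiffOn ℝ ∞ lam U)
    (hc : IsConformalFactorOn L f lam U) (hx : x ∈ U) :
    form L (normalPart L f x (dP (dP f) x)) (normalPart L f x (dM (dM f) x)) =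
      4 * Real.exp (2 * lam x) * (dM (dP lam) x + L * Real.exp (2 * lam x)) := by
  have hE : ∀ y ∈ U, form L (dU f y) (dU f y) = Real.exp (2 * lam y) := fun y hy => (hc y hy).1
  have hl := differentiableAt_of_smooth hlam hU hx
  have hlP := differentiableAt_of_smooth (contDiffOn_dd (w := (1, 1)) hlam hU) hU hx
  have dE : ∀ w, ∀ y ∈ U, dd w (fun y => form L (dU f y) (dU f y)) y =
      2 * dd w lam y * Real.exp (2 * lam y) := by
    intro w y hy
    have hl := differentiableAt_of_smooth hlam hU hy
    rw [dd_congr_on hU hE hy, dd_exp (hl.const_mul _), dd_const_mul _ hl]; ring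
  have hPP := differentiableAt_of_smooth (h.smooth_dd_dd hU (1, 1) (1, 1)) hU hx
  have hM := differentiableAt_of_smooth (h.smooth_dd hU (1, -1)) hU hx
  have key : dM (fun y => form L (dP (dP f) y) (dM f y)) x =
      4 * (dM (dP lam) x * Real.exp (2 * lam x) +
        dP lam x * (Real.exp (2 * lam x) * (2 * dM lam x))) := by
    rw [dd_congr_on hU (g := fun y => 4 * (dP lam y * Real.exp (2 * lam y)))
      (fun y hy => by rw [h.form_PP_M hU hy, dE _ y hy]; ring) hx,
      dd_const_mul _ (hlP.fun_mul (hl.const_mul 2).exp), dd_mul hlP (hl.const_mul 2).exp,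
      dd_exp (hl.const_mul 2), dd_const_mul _ hl]
  rw [dd_form hPP hM, h.dM_PP hU hx, form_add_left] at key
  simp only [form_smul_left] at key
  have hcx := h.isConformalAt hU hx
  rw [hcx.form_PM, form_comm (f x)] at key
  rw [h.normalPart_PP hU hx, h.normalPart_MM hU hx]
  simp only [form_sub_left, form_sub_right, form_smul_left, form_smul_right]
  rw [hcx.form_PM, h.form_PP_M hU hx, form_comm (dP f x) (dM (dM f) x), h.form_MM_P hU hx,
    dE _ x hx, dE _ x hx, hE x hx]
  rw [dE _ x hx, hE x hx] at key
  have hpos := (Real.exp_pos (2 * lam x)).ne'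
  field_simp
  linear_combination key + 2 * (2 * dP lam x * Real.exp (2 * lam x)) * hcx.form_M_self

end IsZeroMeanOn

theorem IsNormalField.mono {ξ : ℝ × ℝ → Amb L} {W : Set (ℝ × ℝ)} (hξ : IsNormalField L f ξ U)
    (hW : W ⊆ U) : IsNormalField L f ξ W :=
  ⟨hξ.smooth.mono hW, fun x hx => hξ.tangent x (hW hx), fun x hx => hξ.normal x (hW hx)⟩

theorem IsNormalField.form_P {ξ : ℝ × ℝ → Amb L} (hξ : IsNormalField L f ξ U) (hx : x ∈ U) :
    form L (ξ x) (dP f x) = 0 := by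
  rw [dP_eq, form_add_right, (hξ.normal x hx).1, (hξ.normal x hx).2, add_zero]

theorem IsNormalField.form_M {ξ : ℝ × ℝ → Amb L} (hξ : IsNormalField L f ξ U) (hx : x ∈ U) :
    form L (ξ x) (dM f x) = 0 := by
  rw [dM_eq, form_sub_right, (hξ.normal x hx).1, (hξ.normal x hx).2, sub_zero]

theorem mul_form_of_mem_tangentN {y ξ : Amb L} (h : ξ ∈ tangentN L y) : L * form L ξ y = 0 := by
  by_cases hL : L = 0
  · simp only [hL, zero_mul]
  · rw [h hL, mul_zero]

namespace IsZeroMeanOn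

variable (h : IsZeroMeanOn L f U) (hU : IsOpen U)

include h hU

theorem form_dd_normal {ξ : ℝ × ℝ → Amb L} (hξ : ContDiffOn ℝ ∞ ξ U) {w w' : ℝ × ℝ}
    (h0 : ∀ y ∈ U, form L (ξ y) (dd w f y) = 0) (hx : x ∈ U) :
    form L (dd w' ξ x) (dd w f x) = -form L (ξ x) (dd w' (dd w f) x) := by
  have : dd w' (fun y => form L (ξ y) (dd w f y)) x = 0 := by
    rw [dd_congr_on hU (g := fun _ => 0) h0 hx, dd_const]
  rw [dd_form (differentiableAt_of_smooth hξ hU hx)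
    (differentiableAt_of_smooth (h.smooth_dd hU w) hU hx)] at this
  linarith

theorem mul_form_dd_normal {ξ : ℝ × ℝ → Amb L} (hξ : IsNormalField L f ξ U) {w : ℝ × ℝ}
    (hx : x ∈ U) : L * form L (dd w ξ x) (f x) = -(L * form L (ξ x) (dd w f x)) := by
  have hd := differentiableAt_of_smooth hξ.smooth hU hx
  have hf := differentiableAt_of_smooth h.smooth hU hx
  have : dd w (fun y => L * form L (ξ y) (f y)) x = 0 := by
    rw [dd_congr_on hU (g := fun _ => 0)
      (fun y hy => mul_form_of_mem_tangentN (hξ.tangent y hy)) hx, dd_const]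
  rw [dd_const_mul _ (differentiableAt_of_smooth (contDiffOn_form hξ.smooth h.smooth) hU hx),
    dd_form hd hf] at this
  linarith

/-- The normal derivative in the null direction `∂_+`. -/
theorem normalPart_dP_normal {ξ : ℝ × ℝ → Amb L} (hξ : IsNormalField L f ξ U) (hx : x ∈ U) :
    normalPart L f x (dP ξ x) = dP ξ x
      + (form L (ξ x) (dP (dP f) x) / (2 * form L (dU f x) (dU f x))) • dM f x := by
  have hc := h.isConformalAt hU hx
  rw [hc.normalPart_eq, h.form_dd_normal hU hξ.smooth (fun y hy => hξ.form_M hy) hx,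
    h.form_dd_normal hU hξ.smooth (fun y hy => hξ.form_P hy) hx, h.mul_form_dd_normal hU hξ hx,
    hξ.form_P hx, h.dP_dM hU hx]
  simp only [form_smul_right, mul_form_of_mem_tangentN (hξ.tangent x hx)]
  module

/-- The normal derivative in the null direction `∂_-`. -/
theorem normalPart_dM_normal {ξ : ℝ × ℝ → Amb L} (hξ : IsNormalField L f ξ U) (hx : x ∈ U) :
    normalPart L f x (dM ξ x) = dM ξ x
      + (form L (ξ x) (dM (dM f) x) / (2 * form L (dU f x) (dU f x))) • dP f x := by
  have hc := h.isConformalAt hU hx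
  rw [hc.normalPart_eq, h.form_dd_normal hU hξ.smooth (fun y hy => hξ.form_M hy) hx,
    h.form_dd_normal hU hξ.smooth (fun y hy => hξ.form_P hy) hx, h.mul_form_dd_normal hU hξ hx,
    hξ.form_M hx, h.dM_dP hU hx]
  simp only [form_smul_right, mul_form_of_mem_tangentN (hξ.tangent x hx)]
  module

/-- The Ricci equation. -/
theorem ricci {ξ : ℝ × ℝ → Amb L} (hξ : IsNormalField L f ξ U) (hx : x ∈ U) :
    normalCurvature L f ξ x = (1 / (4 * form L (dU f x) (dU f x))) •
      (form L (ξ x) (dP (dP f) x) • normalPart L f x (dM (dM f) x)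
        - form L (ξ x) (dM (dM f) x) • normalPart L f x (dP (dP f) x)) := by
  have hc := h.isConformalAt hU hx
  set E := fun y => form L (dU f y) (dU f y) with hEdef
  have hE : ContDiffOn ℝ ∞ E U := h.smooth_E hU
  have hE0 : ∀ y ∈ U, 2 * E y ≠ 0 := fun y hy => by
    have := (h.isConformalAt hU hy).pos; positivity
  set a := fun y => form L (ξ y) (dP (dP f) y) / (2 * E y) with ha
  set b := fun y => form L (ξ y) (dM (dM f) y) / (2 * E y) with hb
  have hsa : ContDiffOn ℝ ∞ a U :=
    (contDiffOn_form hξ.smooth (h.smooth_dd_dd hU _ _)).div (contDiffOn_const.mul hE) hE0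
  have hsb : ContDiffOn ℝ ∞ b U :=
    (contDiffOn_form hξ.smooth (h.smooth_dd_dd hU _ _)).div (contDiffOn_const.mul hE) hE0
  have eP : ∀ y ∈ U, normalPart L f y (dP ξ y) = dP ξ y + a y • dM f y :=
    fun y hy => h.normalPart_dP_normal hU hξ hy
  have eM : ∀ y ∈ U, normalPart L f y (dM ξ y) = dM ξ y + b y • dP f y :=
    fun y hy => h.normalPart_dM_normal hU hξ hy
  have e0 : ∀ y ∈ U, normalDeriv L f 0 ξ y =
      (1 / 2 : ℝ) • ((dP ξ y + a y • dM f y) + (dM ξ y + b y • dP f y)) := by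
    intro y hy
    have hcy := h.isConformalAt hU hy
    rw [normalDeriv, pd_zero, dU_eq_half, hcy.normalPart_smul, hcy.normalPart_add, eP y hy, eM y hy]
  have e1 : ∀ y ∈ U, normalDeriv L f 1 ξ y =
      (1 / 2 : ℝ) • ((dP ξ y + a y • dM f y) - (dM ξ y + b y • dP f y)) := by
    intro y hy
    have hcy := h.isConformalAt hU hy
    rw [normalDeriv, pd_one, dV_eq_half, hcy.normalPart_smul, hcy.normalPart_sub, eP y hy, eM y hy]
  have dξP := differentiableAt_of_smooth (contDiffOn_dd (w := (1, 1)) hξ.smooth hU) hU hx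
  have dξM := differentiableAt_of_smooth (contDiffOn_dd (w := (1, -1)) hξ.smooth hU) hU hx
  have dfP := differentiableAt_of_smooth (h.smooth_dd hU (1, 1)) hU hx
  have dfM := differentiableAt_of_smooth (h.smooth_dd hU (1, -1)) hU hx
  have da := differentiableAt_of_smooth hsa hU hx
  have db := differentiableAt_of_smooth hsb hU hx
  have k0 : ∀ w, dd w (normalDeriv L f 0 ξ) x = (1 / 2 : ℝ) •
      ((dd w (dP ξ) x + (dd w a x • dM f x + a x • dd w (dM f) x))
        + (dd w (dM ξ) x + (dd w b x • dP f x + b x • dd w (dP f) x))) := by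
    intro w
    rw [dd_congr_on hU e0 hx, dd_const_smul _ ((dξP.fun_add (da.fun_smul dfM)).fun_add
      (dξM.fun_add (db.fun_smul dfP))), dd_add (dξP.fun_add (da.fun_smul dfM))
      (dξM.fun_add (db.fun_smul dfP)), dd_add dξP (da.fun_smul dfM),
      dd_add dξM (db.fun_smul dfP), dd_smul da dfM, dd_smul db dfP]
  have k1 : ∀ w, dd w (normalDeriv L f 1 ξ) x = (1 / 2 : ℝ) •
      ((dd w (dP ξ) x + (dd w a x • dM f x + a x • dd w (dM f) x))
        - (dd w (dM ξ) x + (dd w b x • dP f x + b x • dd w (dP f) x))) := by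
    intro w
    rw [dd_congr_on hU e1 hx, dd_const_smul _ ((dξP.fun_add (da.fun_smul dfM)).fun_sub
      (dξM.fun_add (db.fun_smul dfP))), dd_sub (dξP.fun_add (da.fun_smul dfM))
      (dξM.fun_add (db.fun_smul dfP)), dd_add dξP (da.fun_smul dfM),
      dd_add dξM (db.fun_smul dfP), dd_smul da dfM, dd_smul db dfP]
  rw [normalCurvature, normalDeriv, pd_zero, normalDeriv, pd_one, dU_eq_half, dV_eq_half,
    k0, k0, k1, k1, dd_comm (w := (1, -1)) (w' := (1, 1)) hξ.smooth hU hx]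
  simp only [hc.normalPart_smul, hc.normalPart_add, hc.normalPart_sub, hc.normalPart_P,
    hc.normalPart_M, h.dM_dP hU hx, h.dP_dM hU hx, smul_zero,
    zero_add]
  have hE1 := hc.pos.ne'
  simp only [ha, hb, hEdef]
  match_scalars <;> field_simp <;> ring

end IsZeroMeanOn

end GaussRicci

/-! ### Invariance under paraholomorphic coordinate changes -/

section Invariance

variable {L : ℝ} {f : ℝ × ℝ → Amb L} {U : Set (ℝ × ℝ)} {x : ℝ × ℝ}

/-- The second fundamental form `σ(∂_+, ∂_+)`, where `∂_+ = ∂_u + ∂_v`. -/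
def sffP (L : ℝ) (f : ℝ × ℝ → Amb L) (x : ℝ × ℝ) : Amb L := normalPart L f x (dP (dP f) x)

/-- The second fundamental form `σ(∂_-, ∂_-)`, where `∂_- = ∂_u - ∂_v`. -/
def sffM (L : ℝ) (f : ℝ × ℝ → Amb L) (x : ℝ × ℝ) : Amb L := normalPart L f x (dM (dM f) x)

/-- The normal vectors `σ(∂_+, ∂_+)` and `σ(∂_-, ∂_-)` are proportional at `x`: the exterior
product of the two vectors vanishes. -/
def HasProportionalSff (L : ℝ) (f : ℝ × ℝ → Amb L) (x : ℝ × ℝ) : Prop :=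
  ∀ ξ : Amb L, form L ξ (sffP L f x) • sffM L f x = form L ξ (sffM L f x) • sffP L f x

namespace IsZeroMeanOn

theorem smooth_normalPart (h : IsZeroMeanOn L f U) (hU : IsOpen U) {w : ℝ × ℝ → Amb L}
    (hw : ContDiffOn ℝ ∞ w U) : ContDiffOn ℝ ∞ (fun y => normalPart L f y (w y)) U := by
  have hE : ContDiffOn ℝ ∞ (fun y => 2 * form L (dU f y) (dU f y)) U :=
    contDiffOn_const.mul (h.smooth_E hU)
  have hE0 : ∀ y ∈ U, 2 * form L (dU f y) (dU f y) ≠ 0 := fun y hy => by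
    have := (h.isConformalAt hU hy).pos; positivity
  have hP := h.smooth_dd hU (1, 1)
  have hM := h.smooth_dd hU (1, -1)
  refine ContDiffOn.congr ?_ (fun y hy => (h.isConformalAt hU hy).normalPart_eq (w y))
  exact ((hw.sub (((contDiffOn_form hw hM).div hE hE0).smul hP)).sub
    (((contDiffOn_form hw hP).div hE hE0).smul hM)).sub
    ((contDiffOn_const.mul (contDiffOn_form hw h.smooth)).smul h.smooth)

theorem isNormalField_normalPart (h : IsZeroMeanOn L f U) (hU : IsOpen U) {w : ℝ × ℝ → Amb L}
    (hw : ContDiffOn ℝ ∞ w U) : IsNormalField L f (fun y => normalPart L f y (w y)) U where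
  smooth := h.smooth_normalPart hU hw
  tangent := fun x hx hL =>
    (mul_eq_zero.1 ((h.isConformalAt hU hx).form_normalPart_self (w x))).resolve_left hL
  normal := fun x hx => by
    have hc := h.isConformalAt hU hx
    rw [dU_eq_half, dV_eq_half]
    simp only [form_smul_right, form_add_right, form_sub_right, hc.form_normalPart_P,
      hc.form_normalPart_M]
    norm_num

theorem normalPart_normal (h : IsZeroMeanOn L f U) (hU : IsOpen U) {ξ : ℝ × ℝ → Amb L}
    (hξ : IsNormalField L f ξ U) (hx : x ∈ U) : normalPart L f x (ξ x) = ξ x :=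
  (h.isConformalAt hU hx).normalPart_eq_self (hξ.form_P hx) (hξ.form_M hx)
    (mul_form_of_mem_tangentN (hξ.tangent x hx))

/-- By the Ricci equation, the normal connection is flat if and only if the two null components
of the second fundamental form are proportional at each point. -/
theorem flat_iff (h : IsZeroMeanOn L f U) (hU : IsOpen U) :
    HasFlatNormalConnectionOn L f U ↔ ∀ x ∈ U, HasProportionalSff L f x := by
  constructor
  · intro hflat x hx ξ
    have hc := h.isConformalAt hU hx
    have hn := h.isNormalField_normalPart hU (w := fun _ => ξ) contDiffOn_const
    have h0 := hflat U subset_rfl hU _ hn x hx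
    rw [h.ricci hU hn hx, smul_eq_zero] at h0
    have hE : 1 / (4 * form L (dU f x) (dU f x)) ≠ 0 := by
      have := hc.pos; positivity
    have h1 := sub_eq_zero.1 (h0.resolve_left hE)
    rw [hc.form_normalPart_comm, hc.form_normalPart_comm] at h1
    exact h1
  · intro hp W hWU hW ξ hξ x hx
    have hm := h.mono hWU
    have hc := hm.isConformalAt hW hx
    have h1 := hp x (hWU hx) (ξ x)
    unfold sffP sffM at h1
    rw [← hc.form_normalPart_comm, ← hc.form_normalPart_comm, hm.normalPart_normal hW hξ hx] at h1
    rw [hm.ricci hW hξ hx, h1, sub_self, smul_zero]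

end IsZeroMeanOn

/-- The factor `p` by which a paraholomorphic map stretches the null direction `∂_+`. -/
def stretchP (φ : ℝ × ℝ → ℝ × ℝ) (x : ℝ × ℝ) : ℝ := (dU φ x).1 + (dV φ x).1

/-- The factor `q` by which a paraholomorphic map stretches the null direction `∂_-`. -/
def stretchM (φ : ℝ × ℝ → ℝ × ℝ) (x : ℝ × ℝ) : ℝ := (dU φ x).1 - (dV φ x).1

section Para

variable {φ : ℝ × ℝ → ℝ × ℝ} {V : Set (ℝ × ℝ)}

theorem IsParaholomorphicOn.dP_eq (hφ : IsParaholomorphicOn φ V) (hx : x ∈ V) :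
    dP φ x = stretchP φ x • ((1, 1) : ℝ × ℝ) := by
  obtain ⟨h1, h2, -⟩ := hφ.2 x hx
  rw [NeutralSurface.dP_eq]
  ext
  · simp [stretchP]
  · simp [stretchP, h1, h2, add_comm]

theorem IsParaholomorphicOn.dM_eq (hφ : IsParaholomorphicOn φ V) (hx : x ∈ V) :
    dM φ x = stretchM φ x • ((1, -1) : ℝ × ℝ) := by
  obtain ⟨h1, h2, -⟩ := hφ.2 x hx
  rw [NeutralSurface.dM_eq]
  ext
  · simp [stretchM]
  · simp [stretchM, h1, h2]

theorem IsParaholomorphicOn.stretch_pos (hφ : IsParaholomorphicOn φ V) (hx : x ∈ V) :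
    0 < stretchP φ x * stretchM φ x := by
  have := (hφ.2 x hx).2.2
  unfold stretchP stretchM
  nlinarith

theorem smooth_fst_dd (hV : IsOpen V) (hφ : ContDiffOn ℝ ∞ φ V) (w : ℝ × ℝ) :
    ContDiffOn ℝ ∞ (fun y => (dd w φ y).1) V :=
  contDiff_fst.comp_contDiffOn (contDiffOn_dd hφ hV)

theorem smooth_stretchP (hV : IsOpen V) (hφ : ContDiffOn ℝ ∞ φ V) :
    ContDiffOn ℝ ∞ (stretchP φ) V :=
  (smooth_fst_dd hV hφ (1, 0)).add (smooth_fst_dd hV hφ (0, 1))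

theorem smooth_stretchM (hV : IsOpen V) (hφ : ContDiffOn ℝ ∞ φ V) :
    ContDiffOn ℝ ∞ (stretchM φ) V :=
  (smooth_fst_dd hV hφ (1, 0)).sub (smooth_fst_dd hV hφ (0, 1))

variable {f' : ℝ × ℝ → Amb L} (h : IsZeroMeanOn L f U) (hU : IsOpen U)
  (h' : IsZeroMeanOn L f' V) (hV : IsOpen V) (hφ : IsParaholomorphicOn φ V)
  (hmaps : Set.MapsTo φ V U) (heq : ∀ y ∈ V, f' y = f (φ y))

include h hU hV hφ hmaps heq

theorem dP_reparam (hx : x ∈ V) : dP f' x = stretchP φ x • dP f (φ x) := by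
  rw [dd_congr_on hV (g := f ∘ φ) heq hx, dd_comp (differentiableAt_of_smooth h.smooth hU (hmaps hx))
    (differentiableAt_of_smooth hφ.1 hV hx), hφ.dP_eq hx, dd_smul_dir]

theorem dM_reparam (hx : x ∈ V) : dM f' x = stretchM φ x • dM f (φ x) := by
  rw [dd_congr_on hV (g := f ∘ φ) heq hx, dd_comp (differentiableAt_of_smooth h.smooth hU (hmaps hx))
    (differentiableAt_of_smooth hφ.1 hV hx), hφ.dM_eq hx, dd_smul_dir]

theorem dP_dP_reparam (hx : x ∈ V) : dP (dP f') x =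
    dP (stretchP φ) x • dP f (φ x) + stretchP φ x ^ 2 • dP (dP f) (φ x) := by
  have hd := differentiableAt_of_smooth (h.smooth_dd hU (1, 1)) hU (hmaps hx)
  have hdφ := differentiableAt_of_smooth hφ.1 hV hx
  have hc : DifferentiableAt ℝ (fun y => dP f (φ y)) x := hd.comp x hdφ
  rw [dd_congr_on hV (fun y hy => dP_reparam h hU hV hφ hmaps heq hy) hx,
    dd_smul (differentiableAt_of_smooth (smooth_stretchP hV hφ.1) hV hx) hc]
  have : dP (fun y => dP f (φ y)) x = stretchP φ x • dP (dP f) (φ x) := by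
    rw [show (fun y => dP f (φ y)) = dP f ∘ φ from rfl, dd_comp hd hdφ, hφ.dP_eq hx, dd_smul_dir]
  rw [this, smul_smul, sq]

theorem dM_dM_reparam (hx : x ∈ V) : dM (dM f') x =
    dM (stretchM φ) x • dM f (φ x) + stretchM φ x ^ 2 • dM (dM f) (φ x) := by
  have hd := differentiableAt_of_smooth (h.smooth_dd hU (1, -1)) hU (hmaps hx)
  have hdφ := differentiableAt_of_smooth hφ.1 hV hx
  have hc : DifferentiableAt ℝ (fun y => dM f (φ y)) x := hd.comp x hdφ
  rw [dd_congr_on hV (fun y hy => dM_reparam h hU hV hφ hmaps heq hy) hx,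
    dd_smul (differentiableAt_of_smooth (smooth_stretchM hV hφ.1) hV hx) hc]
  have : dM (fun y => dM f (φ y)) x = stretchM φ x • dM (dM f) (φ x) := by
    rw [show (fun y => dM f (φ y)) = dM f ∘ φ from rfl, dd_comp hd hdφ, hφ.dM_eq hx, dd_smul_dir]
  rw [this, smul_smul, sq]

include h'

theorem normalPart_reparam (hx : x ∈ V) (w : Amb L) :
    normalPart L f' x w = normalPart L f (φ x) w := by
  have hc' := h'.isConformalAt hV hx
  have hc := h.isConformalAt hU (hmaps hx)
  have hp : stretchP φ x ≠ 0 := fun h0 => by simpa [h0] using hφ.stretch_pos hx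
  have hq : stretchM φ x ≠ 0 := fun h0 => by simpa [h0] using hφ.stretch_pos hx
  have hE := hc.pos.ne'
  have hE' : form L (dU f' x) (dU f' x) =
      stretchP φ x * stretchM φ x * form L (dU f (φ x)) (dU f (φ x)) := by
    have h1 := hc'.form_PM
    rw [dP_reparam h hU hV hφ hmaps heq hx, dM_reparam h hU hV hφ hmaps heq hx, form_smul_left,
      form_smul_right, hc.form_PM] at h1
    linarith
  rw [hc'.normalPart_eq, hc.normalPart_eq, hE', dP_reparam h hU hV hφ hmaps heq hx,
    dM_reparam h hU hV hφ hmaps heq hx, heq x hx]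
  simp only [form_smul_right]
  match_scalars <;> field_simp

theorem sffP_reparam (hx : x ∈ V) : sffP L f' x = stretchP φ x ^ 2 • sffP L f (φ x) := by
  have hc := h.isConformalAt hU (hmaps hx)
  rw [sffP, normalPart_reparam h hU h' hV hφ hmaps heq hx, dP_dP_reparam h hU hV hφ hmaps heq hx,
    hc.normalPart_add, hc.normalPart_smul, hc.normalPart_smul, hc.normalPart_P, smul_zero, zero_add]
  rfl

theorem sffM_reparam (hx : x ∈ V) : sffM L f' x = stretchM φ x ^ 2 • sffM L f (φ x) := by
  have hc := h.isConformalAt hU (hmaps hx)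
  rw [sffM, normalPart_reparam h hU h' hV hφ hmaps heq hx, dM_dM_reparam h hU hV hφ hmaps heq hx,
    hc.normalPart_add, hc.normalPart_smul, hc.normalPart_smul, hc.normalPart_M, smul_zero, zero_add]
  rfl

theorem form_sff_reparam (hx : x ∈ V) : form L (sffP L f' x) (sffM L f' x) =
    (stretchP φ x * stretchM φ x) ^ 2 * form L (sffP L f (φ x)) (sffM L f (φ x)) := by
  rw [sffP_reparam h hU h' hV hφ hmaps heq hx, sffM_reparam h hU h' hV hφ hmaps heq hx,
    form_smul_left, form_smul_right]
  ring

theorem HasProportionalSff.reparam (hx : x ∈ V) (hp : HasProportionalSff L f (φ x)) :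
    HasProportionalSff L f' x := by
  intro ξ
  have := hp ξ
  rw [sffP_reparam h hU h' hV hφ hmaps heq hx, sffM_reparam h hU h' hV hφ hmaps heq hx,
    form_smul_right, form_smul_right, mul_smul, mul_smul, smul_comm (form L ξ (sffP L f (φ x))),
    this, smul_comm (form L ξ (sffM L f (φ x))), smul_comm (stretchP φ x ^ 2)]

end Para

end Invariance

/-! ### The curvature of a conformal metric -/

section Curvature

variable {L : ℝ} {f : ℝ × ℝ → Amb L} {U : Set (ℝ × ℝ)} {x : ℝ × ℝ} {lam : ℝ × ℝ → ℝ}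

theorem IsConformalFactorOn.metric_eq (hc : IsConformalFactorOn L f lam U) (hx : x ∈ U) :
    metric L f x = !![Real.exp (2 * lam x), 0; 0, -Real.exp (2 * lam x)] := by
  obtain ⟨h1, h2, h3⟩ := hc x hx
  ext i j
  fin_cases i <;> fin_cases j
  · exact h1
  · exact h3
  · exact (form_comm _ _).trans h3
  · exact h2

theorem IsConformalFactorOn.metric_inv_eq (hc : IsConformalFactorOn L f lam U) (hx : x ∈ U) :
    (metric L f x)⁻¹ =
      !![1 / Real.exp (2 * lam x), 0; 0, -(1 / Real.exp (2 * lam x))] := by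
  rw [hc.metric_eq hx]
  apply Matrix.inv_eq_right_inv
  have := (Real.exp_pos (2 * lam x)).ne'
  ext i j
  fin_cases i <;> fin_cases j <;> simp [Matrix.mul_apply, this]

theorem pd_eq_dd {E : Type*} [NormedAddCommGroup E] [NormedSpace ℝ E] (i : Fin 2)
    (g : ℝ × ℝ → E) : pd i g = dd (![(1, 0), (0, 1)] i) g := by
  fin_cases i <;> rfl

variable (hlam : ContDiffOn ℝ ∞ lam U) (hU : IsOpen U) (hc : IsConformalFactorOn L f lam U)

include hlam hU hc

theorem pd_metric (i j k : Fin 2) (hx : x ∈ U) : pd i (fun y => metric L f y j k) x =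
    2 * Real.exp (2 * lam x) * pd i lam x * (!![1, 0; 0, -1] : Matrix (Fin 2) (Fin 2) ℝ) j k := by
  have hl := differentiableAt_of_smooth hlam hU hx
  rw [pd_eq_dd, pd_eq_dd, dd_congr_on hU (g := fun y =>
    (!![1, 0; 0, -1] : Matrix (Fin 2) (Fin 2) ℝ) j k * Real.exp (2 * lam y)) ?_ hx,
    dd_const_mul _ (hl.const_mul 2).exp, dd_exp (hl.const_mul 2), dd_const_mul _ hl]
  · ring
  · intro y hy
    rw [hc.metric_eq hy]
    fin_cases j <;> fin_cases k <;> simp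

/-- The Christoffel symbols of `e^{2λ} (du ^ 2 - dv ^ 2)`: the symbol `Γ^k_{ij}` is `λ_u` if
`k + i + j` is even and `λ_v` if it is odd. -/
theorem christoffel_conformal (k i j : Fin 2) (hx : x ∈ U) :
    christoffel (metric L f) k i j x = pd (k + i + j) lam x := by
  have hE := (Real.exp_pos (2 * lam x)).ne'
  unfold christoffel
  rw [Fin.sum_univ_two, hc.metric_inv_eq hx]
  simp only [pd_metric hlam hU hc _ _ _ hx]
  fin_cases k <;> fin_cases i <;> fin_cases j <;> simp <;> field_simp

/-- The curvature of `e^{2λ} (du ^ 2 - dv ^ 2)` is `-e^{-2λ} (λ_uu - λ_vv)`. -/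
theorem curvature_conformal (hx : x ∈ U) : curvature (metric L f) x =
    -((dU (dU lam) x - dV (dV lam) x) / Real.exp (2 * lam x)) := by
  have hE := (Real.exp_pos (2 * lam x)).ne'
  have hR : riemann (metric L f) 0 0 1 1 x = dU (dU lam) x - dV (dV lam) x := by
    unfold riemann
    have hdd : ∀ i k a b : Fin 2, pd i (christoffel (metric L f) k a b) x =
        pd i (pd (k + a + b) lam) x := fun i k a b => by
      rw [pd_eq_dd, pd_eq_dd]
      exact dd_congr_on hU (fun y hy => christoffel_conformal hlam hU hc k a b hy) hx
    rw [hdd, hdd]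
    simp only [christoffel_conformal hlam hU hc _ _ _ hx, Fin.sum_univ_two]
    simp [pd_zero, pd_one]
  unfold curvature
  rw [Fin.sum_univ_two, hR, hc.metric_eq hx, Matrix.det_fin_two]
  simp
  field_simp

end Curvature

/-! ### The conformal factor and the curvature of a zero mean curvature surface -/

section ConformalFactor

variable {L : ℝ} {f : ℝ × ℝ → Amb L} {U : Set (ℝ × ℝ)} {x : ℝ × ℝ} {lam : ℝ × ℝ → ℝ}

/-- The function `λ` with induced metric `e^{2λ} (du ^ 2 - dv ^ 2)`. -/
def confFactor (L : ℝ) (f : ℝ × ℝ → Amb L) (x : ℝ × ℝ) : ℝ :=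
  1 / 2 * Real.log (form L (dU f x) (dU f x))

namespace IsZeroMeanOn

theorem exp_confFactor (h : IsZeroMeanOn L f U) (hx : x ∈ U) :
    Real.exp (2 * confFactor L f x) = form L (dU f x) (dU f x) := by
  rw [confFactor, ← mul_assoc, show (2 : ℝ) * (1 / 2) = 1 by norm_num, one_mul,
    Real.exp_log (h.timelike x hx)]

theorem isConformalFactorOn (h : IsZeroMeanOn L f U) :
    IsConformalFactorOn L f (confFactor L f) U := fun x hx => by
  rw [h.exp_confFactor hx]
  exact ⟨rfl, h.conformal x hx⟩

theorem smooth_confFactor (h : IsZeroMeanOn L f U) (hU : IsOpen U) :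
    ContDiffOn ℝ ∞ (confFactor L f) U :=
  contDiffOn_const.mul ((h.smooth_E hU).log fun x hx => (h.timelike x hx).ne')

/-- By the Gauss equation, `K ≠ L` exactly where `⟨σ(∂_+, ∂_+), σ(∂_-, ∂_-)⟩ ≠ 0`. -/
theorem curvature_ne_iff (h : IsZeroMeanOn L f U) (hU : IsOpen U) (hx : x ∈ U) :
    curvature (metric L f) x ≠ L ↔ form L (sffP L f x) (sffM L f x) ≠ 0 := by
  have hl := h.smooth_confFactor hU
  have hE := (Real.exp_pos (2 * confFactor L f x)).ne'
  rw [curvature_conformal hl hU h.isConformalFactorOn hx, sffP, sffM,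
    h.gauss hU hl h.isConformalFactorOn hx, dM_dP_eq_sub hl hU hx]
  refine not_congr ⟨fun h0 => ?_, fun h0 => ?_⟩
  · field_simp at h0
    rw [mul_eq_zero]; right; linarith
  · have h1 := (mul_eq_zero.1 h0).resolve_left (by positivity)
    field_simp
    linarith

/-- If `λ` solves the equation, the Gauss equation says that
`⟨σ(∂_+, ∂_+), σ(∂_-, ∂_-)⟩ = 4 ε`. -/
theorem form_sff_of_solves (h : IsZeroMeanOn L f U) (hU : IsOpen U) {ε : ℝ}
    (hc : IsConformalFactorOn L f lam U) (hs : SolvesEquationOn L ε lam U) (hx : x ∈ U) :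
    form L (sffP L f x) (sffM L f x) = 4 * ε := by
  rw [sffP, sffM, h.gauss hU hs.1 hc hx, dM_dP_eq_sub hs.1 hU hx, hs.2 x hx,
    show -2 * lam x = -(2 * lam x) by ring, Real.exp_neg]
  have hE := (Real.exp_pos (2 * lam x)).ne'
  field_simp
  ring

end IsZeroMeanOn

end ConformalFactor

/-! ### Orthogonal frames of the ambient space -/

section Frames

/-- The vectors `a`, `b`, `c`, `d` of the ambient space are orthogonal with squares `E`, `-E`, `E`,
`-E`; in the curved case moreover `g` is orthogonal to them with square `1 / L`, which makes the
five vectors a basis. -/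
structure IsFrameAt (L E : ℝ) (a b c d g : Amb L) : Prop where
  pos : 0 < E
  aa : form L a a = E
  bb : form L b b = -E
  cc : form L c c = E
  dd : form L d d = -E
  ab : form L a b = 0
  ac : form L a c = 0
  ad : form L a d = 0
  bc : form L b c = 0
  bd : form L b d = 0
  cd : form L c d = 0
  ag : L * form L a g = 0
  bg : L * form L b g = 0
  cg : L * form L c g = 0
  dg : L * form L d g = 0
  gg : L * (L * form L g g) = L

namespace IsFrameAt

variable {L E : ℝ} {a b c d g : Amb L} (h : IsFrameAt L E a b c d g)

include h

/-- A vector orthogonal to a frame vanishes. -/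
theorem eq_zero {w : Amb L} (ha : form L w a = 0) (hb : form L w b = 0) (hc : form L w c = 0)
    (hd : form L w d = 0) (hg : L * form L w g = 0) : w = 0 := by
  have hE := h.pos.ne'
  have hba := h.ab
  have hca := h.ac
  have hda := h.ad
  have hcb := h.bc
  have hdb := h.bd
  have hdc := h.cd
  rw [form_comm] at hba hca hda hcb hdb hdc
  obtain rfl | hL := eq_or_ne L 0
  · let T : Amb 0 →ₗ[ℝ] (Fin 4 → ℝ) := LinearMap.pi
      ![((formL 0).flip a).toLinearMap, ((formL 0).flip b).toLinearMap,
        ((formL 0).flip c).toLinearMap, ((formL 0).flip d).toLinearMap]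
    have hsurj : Function.Surjective T := by
      intro y
      refine ⟨(y 0 / E) • a - (y 1 / E) • b + (y 2 / E) • c - (y 3 / E) • d, ?_⟩
      funext i
      fin_cases i <;>
        simp [T, formL_apply, h.aa, h.bb, h.cc, h.dd, h.ab, h.ac, h.ad, h.bc, h.bd, h.cd, hba, hca,
          hda, hcb, hdb, hdc, hE]
    have hdim : Module.finrank ℝ (Amb 0) = Module.finrank ℝ (Fin 4 → ℝ) := by
      simp [ambDim]
    have hinj := (LinearMap.injective_iff_surjective_of_finrank_eq_finrank hdim).2 hsurj
    apply hinj
    rw [map_zero]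
    funext i
    fin_cases i
    · exact ha
    · exact hb
    · exact hc
    · exact hd
  · have cancel : ∀ {r : ℝ}, L * r = 0 → r = 0 := fun h0 => (mul_eq_zero.1 h0).resolve_left hL
    have hag := cancel h.ag
    have hbg := cancel h.bg
    have hcg := cancel h.cg
    have hdg := cancel h.dg
    have hga := hag
    have hgb := hbg
    have hgc := hcg
    have hgd := hdg
    rw [form_comm] at hga hgb hgc hgd
    have hgg : form L g g = 1 / L := by
      have := h.gg
      field_simp
      exact mul_left_cancel₀ hL (by linarith)
    let T : Amb L →ₗ[ℝ] (Fin 5 → ℝ) := LinearMap.pi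
      ![((formL L).flip a).toLinearMap, ((formL L).flip b).toLinearMap,
        ((formL L).flip c).toLinearMap, ((formL L).flip d).toLinearMap,
        ((formL L).flip g).toLinearMap]
    have hsurj : Function.Surjective T := by
      intro y
      refine ⟨(y 0 / E) • a - (y 1 / E) • b + (y 2 / E) • c - (y 3 / E) • d + (L * y 4) • g, ?_⟩
      funext i
      fin_cases i <;>
        simp [T, formL_apply, h.aa, h.bb, h.cc, h.dd, h.ab, h.ac, h.ad, h.bc, h.bd, h.cd, hba, hca,
          hda, hcb, hdb, hdc, hag, hbg, hcg, hdg, hga, hgb, hgc, hgd, hgg, hE]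
      field_simp
    have hdim : Module.finrank ℝ (Amb L) = Module.finrank ℝ (Fin 5 → ℝ) := by
      simp [ambDim, hL]
    have hinj := (LinearMap.injective_iff_surjective_of_finrank_eq_finrank hdim).2 hsurj
    apply hinj
    rw [map_zero]
    funext i
    fin_cases i
    · exact ha
    · exact hb
    · exact hc
    · exact hd
    · exact cancel hg

theorem ext {w w' : Amb L} (ha : form L w a = form L w' a) (hb : form L w b = form L w' b)
    (hc : form L w c = form L w' c) (hd : form L w d = form L w' d)
    (hg : L * form L w g = L * form L w' g) : w = w' := by
  rw [← sub_eq_zero]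
  apply h.eq_zero <;> rw [form_sub_left]
  · rw [ha, sub_self]
  · rw [hb, sub_self]
  · rw [hc, sub_self]
  · rw [hd, sub_self]
  · rw [mul_sub, hg, sub_self]

theorem ba : form L b a = 0 := by rw [form_comm, h.ab]

theorem ca : form L c a = 0 := by rw [form_comm, h.ac]

theorem da : form L d a = 0 := by rw [form_comm, h.ad]

theorem cb : form L c b = 0 := by rw [form_comm, h.bc]

theorem db : form L d b = 0 := by rw [form_comm, h.bd]

theorem dc : form L d c = 0 := by rw [form_comm, h.cd]

theorem ga : L * form L g a = 0 := by rw [form_comm, h.ag]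

theorem gb : L * form L g b = 0 := by rw [form_comm, h.bg]

theorem gc : L * form L g c = 0 := by rw [form_comm, h.cg]

theorem gd : L * form L g d = 0 := by rw [form_comm, h.dg]

/-- The coordinates of a vector in a frame are read off from its products with the frame. The fifth
coordinate is a multiple of `L`, because in the flat case the position vector does not belong to the
frame and `g` is arbitrary. -/
theorem eq_combination {w : Amb L} {p q r s t : ℝ} (ha : form L w a = E * p)
    (hb : form L w b = -(E * q)) (hc : form L w c = E * r) (hd : form L w d = -(E * s))
    (hg : L * form L w g = L * t) :
    w = p • a + q • b + r • c + s • d + (L * t) • g := by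
  apply h.ext
  · simp only [form_add_left, form_smul_left, h.aa, h.ba, h.ca, h.da]
    linear_combination ha - t * h.ga
  · simp only [form_add_left, form_smul_left, h.ab, h.bb, h.cb, h.db]
    linear_combination hb - t * h.gb
  · simp only [form_add_left, form_smul_left, h.ac, h.bc, h.cc, h.dc]
    linear_combination hc - t * h.gc
  · simp only [form_add_left, form_smul_left, h.ad, h.bd, h.cd, h.dd]
    linear_combination hd - t * h.gd
  · simp only [form_add_left, form_smul_left]
    linear_combination hg - p * h.ag - q * h.bg - r * h.cg - s * h.dg - t * h.gg

/-- The expansion of a vector in a frame. -/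
theorem expand (w : Amb L) : w = (form L w a / E) • a + (-(form L w b / E)) • b
    + (form L w c / E) • c + (-(form L w d / E)) • d + (L * form L w g) • g := by
  have hE := h.pos.ne'
  apply h.eq_combination
  · field_simp
  · field_simp
  · field_simp
  · field_simp
  · rfl

end IsFrameAt

end Frames

/-! ### The coefficients with respect to a normal frame -/

section Coefficients

variable {L : ℝ} {f N₁ N₂ : ℝ × ℝ → Amb L} {U : Set (ℝ × ℝ)} {x : ℝ × ℝ} {lam : ℝ × ℝ → ℝ}
  {C : Coeffs}

/-- The moving frame equations, written out. -/
theorem hasCoeffsOn_iff : HasCoeffsOn L f lam N₁ N₂ C U ↔ ∀ x ∈ U,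
    (dU (dU f) x = dU lam x • dU f x + dV lam x • dV f x + C.α₁ x • N₁ x + C.β₁ x • N₂ x
        + (-L * Real.exp (2 * lam x)) • f x ∧
      dV (dU f) x = dV lam x • dU f x + dU lam x • dV f x + C.α₂ x • N₁ x + C.β₂ x • N₂ x) ∧
    (dU (dV f) x = dV lam x • dU f x + dU lam x • dV f x + C.α₂ x • N₁ x + C.β₂ x • N₂ x ∧
      dV (dV f) x = dU lam x • dU f x + dV lam x • dV f x + C.α₁ x • N₁ x + C.β₁ x • N₂ x
        + (L * Real.exp (2 * lam x)) • f x) ∧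
    (dU N₁ x = (-C.α₁ x) • dU f x + C.α₂ x • dV f x + dU lam x • N₁ x + C.μ₁ x • N₂ x ∧
      dV N₁ x = (-C.α₂ x) • dU f x + C.α₁ x • dV f x + dV lam x • N₁ x + C.μ₂ x • N₂ x) ∧
    (dU N₂ x = C.β₁ x • dU f x + (-C.β₂ x) • dV f x + C.μ₁ x • N₁ x + dU lam x • N₂ x ∧
      dV N₂ x = C.β₂ x • dU f x + (-C.β₁ x) • dV f x + C.μ₂ x • N₁ x + dV lam x • N₂ x) := by
  unfold HasCoeffsOn
  refine forall₂_congr fun x _ => ?_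
  rw [Fin.forall_fin_succ, Fin.forall_fin_succ, Fin.forall_fin_succ, Fin.forall_fin_succ,
    Fin.forall_fin_one]
  have e0 : frame L f N₁ N₂ 0 = dU f := rfl
  have e1 : frame L f N₁ N₂ 1 = dV f := rfl
  have e2 : frame L f N₁ N₂ 2 = N₁ := rfl
  have e3 : frame L f N₁ N₂ 3 = N₂ := rfl
  have e4 : frame L f N₁ N₂ 4 = f := rfl
  have s1 : (Fin.succ 0 : Fin 5) = 1 := rfl
  have s2 : (Fin.succ (Fin.succ 0) : Fin 5) = 2 := rfl
  have s3 : (Fin.succ (Fin.succ (Fin.succ 0)) : Fin 5) = 3 := rfl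
  have s4 : (Fin.succ (Fin.succ (Fin.succ (Fin.succ 0))) : Fin 5) = 4 := rfl
  simp only [s1, s2, s3, s4, Fin.sum_univ_five, e0, e1, e2, e3, e4, matS, matT]
  simp

theorem IsNormalFrameOn.isFrameAt (hN : IsNormalFrameOn L f lam N₁ N₂ U)
    (h : IsZeroMeanOn L f U) (hU : IsOpen U) (hc : IsConformalFactorOn L f lam U) (hx : x ∈ U) :
    IsFrameAt L (Real.exp (2 * lam x)) (dU f x) (dV f x) (N₁ x) (N₂ x) (f x) where
  pos := Real.exp_pos _
  aa := (hc x hx).1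
  bb := (hc x hx).2.1
  cc := (hN.gram x hx).1
  dd := (hN.gram x hx).2.1
  ab := (hc x hx).2.2
  ac := by rw [form_comm, (hN.normal₁.normal x hx).1]
  ad := by rw [form_comm, (hN.normal₂.normal x hx).1]
  bc := by rw [form_comm, (hN.normal₁.normal x hx).2]
  bd := by rw [form_comm, (hN.normal₂.normal x hx).2]
  cd := (hN.gram x hx).2.2
  ag := (h.isConformalAt hU hx).form_U_self
  bg := (h.isConformalAt hU hx).form_V_self
  cg := mul_form_of_mem_tangentN (hN.normal₁.tangent x hx)
  dg := mul_form_of_mem_tangentN (hN.normal₂.tangent x hx)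
  gg := (h.isConformalAt hU hx).pos_sq

/-- The coefficients of `f` with respect to the normal frame `N₁`, `N₂`, as products of derivatives
with the frame. The signs of those taken with `N₂` come from `⟨N₂, N₂⟩ = -e^{2λ}`. -/
def frameCoeffs (L : ℝ) (f : ℝ × ℝ → Amb L) (lam : ℝ × ℝ → ℝ) (N₁ N₂ : ℝ × ℝ → Amb L) :
    Coeffs where
  α₁ x := form L (dU (dU f) x) (N₁ x) / Real.exp (2 * lam x)
  α₂ x := form L (dU (dV f) x) (N₁ x) / Real.exp (2 * lam x)
  β₁ x := -(form L (dU (dU f) x) (N₂ x) / Real.exp (2 * lam x))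
  β₂ x := -(form L (dU (dV f) x) (N₂ x) / Real.exp (2 * lam x))
  μ₁ x := -(form L (dU N₁ x) (N₂ x) / Real.exp (2 * lam x))
  μ₂ x := -(form L (dV N₁ x) (N₂ x) / Real.exp (2 * lam x))

theorem form_dd_of_const {a b : ℝ × ℝ → Amb L} {k : ℝ × ℝ → ℝ} (w : ℝ × ℝ) (hU : IsOpen U)
    (ha : ContDiffOn ℝ ∞ a U) (hb : ContDiffOn ℝ ∞ b U) (hk : ∀ y ∈ U, form L (a y) (b y) = k y)
    (hx : x ∈ U) : form L (dd w a x) (b x) = dd w k x - form L (dd w b x) (a x) := by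
  have h1 := dd_congr_on (w := w) hU hk hx
  rw [dd_form (differentiableAt_of_smooth ha hU hx) (differentiableAt_of_smooth hb hU hx),
    form_comm (a x)] at h1
  linarith

theorem dd_exp_two_mul (w : ℝ × ℝ) (hU : IsOpen U) (hlam : ContDiffOn ℝ ∞ lam U) (hx : x ∈ U) :
    dd w (fun y => Real.exp (2 * lam y)) x = 2 * (Real.exp (2 * lam x) * dd w lam x) := by
  have hl := differentiableAt_of_smooth hlam hU hx
  rw [dd_exp (hl.const_mul _), dd_const_mul _ hl]; ring

theorem dd_neg_exp_two_mul (w : ℝ × ℝ) (hU : IsOpen U) (hlam : ContDiffOn ℝ ∞ lam U)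
    (hx : x ∈ U) :
    dd w (fun y => -Real.exp (2 * lam y)) x = -(2 * (Real.exp (2 * lam x) * dd w lam x)) := by
  have hl := differentiableAt_of_smooth hlam hU hx
  rw [show (fun y => -Real.exp (2 * lam y)) = fun y => (-1) * Real.exp (2 * lam y) by
    funext y; ring, dd_const_mul _ (hl.const_mul 2).exp, dd_exp_two_mul w hU hlam hx]; ring

/-- The moving frame equations hold for every normal frame. -/
theorem hasCoeffsOn_frameCoeffs (h : IsZeroMeanOn L f U) (hU : IsOpen U)
    (hlam : ContDiffOn ℝ ∞ lam U) (hc : IsConformalFactorOn L f lam U)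
    (hN : IsNormalFrameOn L f lam N₁ N₂ U) :
    HasCoeffsOn L f lam N₁ N₂ (frameCoeffs L f lam N₁ N₂) U := by
  rw [hasCoeffsOn_iff]
  intro x hx
  have hF := hN.isFrameAt h hU hc hx
  have hcx := h.isConformalAt hU hx
  have hE := hF.pos.ne'
  have sU := h.smooth_dd hU (1, 0)
  have sV := h.smooth_dd hU (0, 1)
  have s1 := hN.normal₁.smooth
  have s2 := hN.normal₂.smooth
  have dE := fun w => dd_exp_two_mul w hU hlam hx
  have dnE := fun w => dd_neg_exp_two_mul w hU hlam hx
  have hsymm : dV (dU f) x = dU (dV f) x := dd_comm h.smooth hU hx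
  -- products of the second derivatives of `f` with the tangent vectors
  have uu : ∀ w, form L (dd w (dU f) x) (dU f x) = Real.exp (2 * lam x) * dd w lam x := fun w => by
    have := form_dd_of_const w hU sU sU (fun y hy => (hc y hy).1) hx
    rw [dE w] at this; rw [dU_eq_dd]; linarith
  have vv : ∀ w, form L (dd w (dV f) x) (dV f x) = -(Real.exp (2 * lam x) * dd w lam x) :=
    fun w => by
      have := form_dd_of_const w hU sV sV (fun y hy => (hc y hy).2.1) hx
      rw [dnE w] at this; rw [dV_eq_dd]; linarith
  have uv : ∀ w, form L (dd w (dU f) x) (dV f x) = -form L (dd w (dV f) x) (dU f x) := fun w => by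
    have := form_dd_of_const w hU sU sV (fun y hy => (hc y hy).2.2) hx
    rw [dd_const] at this; rw [dU_eq_dd, dV_eq_dd]; linarith
  have uv0 : form L (dU (dV f) x) (dU f x) = Real.exp (2 * lam x) * dV lam x := by
    rw [← hsymm]; exact uu (0, 1)
  have vu0 : form L (dV (dU f) x) (dV f x) = -(Real.exp (2 * lam x) * dU lam x) := by
    rw [hsymm]; exact vv (1, 0)
  have uu_v : form L (dU (dU f) x) (dV f x) = -(Real.exp (2 * lam x) * dV lam x) := by
    rw [← uv0]; exact uv (1, 0)
  have vv_u : form L (dV (dV f) x) (dU f x) = Real.exp (2 * lam x) * dU lam x := by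
    have := uv (0, 1)
    rw [show dd (0, 1) (dU f) x = dV (dU f) x from rfl, vu0] at this
    rw [dV_eq_dd (dV f)]; linarith
  -- products with the position vector
  have self : ∀ w w' : ℝ × ℝ, L * form L (dd w (dd w' f) x) (f x) =
      -(L * form L (dd w' f x) (dd w f x)) := fun w w' => by
    have := dd_congr_on (w := w) hU (g := fun _ => (0 : ℝ))
      (fun y hy => mul_form_dd_self hU h.smooth h.mapsTo w' hy) hx
    rw [dd_const, dd_const_mul _ (differentiableAt_of_smooth
      (contDiffOn_form (h.smooth_dd hU w') h.smooth) hU hx),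
      dd_form (differentiableAt_of_smooth (h.smooth_dd hU w') hU hx)
      (differentiableAt_of_smooth h.smooth hU hx)] at this
    linarith
  have self_uu : L * form L (dU (dU f) x) (f x) = L * -Real.exp (2 * lam x) := by
    have := self (1, 0) (1, 0)
    simp only [← dU_eq_dd, hF.aa] at this
    linarith
  have self_uv : L * form L (dU (dV f) x) (f x) = L * 0 := by
    have := self (1, 0) (0, 1)
    simp only [← dU_eq_dd, ← dV_eq_dd, hF.ba] at this
    linarith
  have self_vv : L * form L (dV (dV f) x) (f x) = L * Real.exp (2 * lam x) := by
    have := self (0, 1) (0, 1)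
    simp only [← dV_eq_dd, hF.bb] at this
    linarith
  -- the mean curvature vector vanishes
  have nvv : ∀ n, normalPart L f x n = n → form L (dV (dV f) x) n = form L (dU (dU f) x) n :=
    fun n hn => by
      rw [← hn, ← hcx.form_normalPart_comm, ← hcx.form_normalPart_comm, h.normalPart_dUU hU hx]
  have vv1 := nvv _ (h.normalPart_normal hU hN.normal₁ hx)
  have vv2 := nvv _ (h.normalPart_normal hU hN.normal₂ hx)
  -- products of the derivatives of the normal frame
  have nU : ∀ {N : ℝ × ℝ → Amb L} (w : ℝ × ℝ), IsNormalField L f N U →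
      form L (dd w N x) (dU f x) = -form L (dd w (dU f) x) (N x) := fun w hNf => by
    rw [form_comm (dd w (dU f) x)]
    exact h.form_dd_normal hU hNf.smooth (fun y hy => (hNf.normal y hy).1) hx
  have nV : ∀ {N : ℝ × ℝ → Amb L} (w : ℝ × ℝ), IsNormalField L f N U →
      form L (dd w N x) (dV f x) = -form L (dd w (dV f) x) (N x) := fun w hNf => by
    rw [form_comm (dd w (dV f) x)]
    exact h.form_dd_normal hU hNf.smooth (fun y hy => (hNf.normal y hy).2) hx
  have n11 : ∀ w, form L (dd w N₁ x) (N₁ x) = Real.exp (2 * lam x) * dd w lam x := fun w => by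
    have := form_dd_of_const w hU s1 s1 (fun y hy => (hN.gram y hy).1) hx
    rw [dE w] at this; linarith
  have n22 : ∀ w, form L (dd w N₂ x) (N₂ x) = -(Real.exp (2 * lam x) * dd w lam x) := fun w => by
    have := form_dd_of_const w hU s2 s2 (fun y hy => (hN.gram y hy).2.1) hx
    rw [dnE w] at this; linarith
  have n21 : ∀ w, form L (dd w N₂ x) (N₁ x) = -form L (dd w N₁ x) (N₂ x) := fun w => by
    have := form_dd_of_const w hU s1 s2 (fun y hy => (hN.gram y hy).2.2) hx
    rw [dd_const] at this; linarith
  have nself : ∀ {N : ℝ × ℝ → Amb L} (w : ℝ × ℝ), IsNormalField L f N U →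
      form L (N x) (dd w f x) = 0 → L * form L (dd w N x) (f x) = L * 0 := fun w hNf h0 => by
    rw [h.mul_form_dd_normal hU hNf hx, h0]; ring
  have n1x := hN.normal₁.normal x hx
  have n2x := hN.normal₂.normal x hx
  have e_uv : dU (dV f) x = dV lam x • dU f x + dU lam x • dV f x
      + (frameCoeffs L f lam N₁ N₂).α₂ x • N₁ x + (frameCoeffs L f lam N₁ N₂).β₂ x • N₂ x := by
    rw [hF.eq_combination uv0 (vv (1, 0)) (r := (frameCoeffs L f lam N₁ N₂).α₂ x)
      (s := (frameCoeffs L f lam N₁ N₂).β₂ x) (by simp only [frameCoeffs]; field_simp)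
      (by simp only [frameCoeffs]; field_simp) self_uv, mul_zero, zero_smul, add_zero]
    rfl
  refine ⟨⟨?_, ?_⟩, ⟨?_, ?_⟩, ⟨?_, ?_⟩, ⟨?_, ?_⟩⟩
  · rw [hF.eq_combination (w := dU (dU f) x) (uu (1, 0)) uu_v (r := (frameCoeffs L f lam N₁ N₂).α₁ x)
      (s := (frameCoeffs L f lam N₁ N₂).β₁ x) (by simp only [frameCoeffs]; field_simp)
      (by simp only [frameCoeffs]; field_simp) self_uu, mul_neg, neg_mul]
    rfl
  · rw [hsymm]; exact e_uv
  · exact e_uv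
  · exact hF.eq_combination vv_u (vv (0, 1)) (r := (frameCoeffs L f lam N₁ N₂).α₁ x)
      (s := (frameCoeffs L f lam N₁ N₂).β₁ x)
      (by rw [vv1]; simp only [frameCoeffs]; field_simp)
      (by rw [vv2]; simp only [frameCoeffs]; field_simp) self_vv
  · refine (hF.eq_combination (p := -(frameCoeffs L f lam N₁ N₂).α₁ x)
      (q := (frameCoeffs L f lam N₁ N₂).α₂ x) (r := dU lam x)
      (s := (frameCoeffs L f lam N₁ N₂).μ₁ x) (t := 0) ?_ ?_ (n11 (1, 0)) ?_
      (nself (1, 0) hN.normal₁ n1x.1)).trans (by rw [mul_zero, zero_smul, add_zero])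
    · rw [nU _ hN.normal₁]; simp only [frameCoeffs]; field_simp; rfl
    · rw [nV _ hN.normal₁]; simp only [frameCoeffs]; field_simp; rfl
    · simp only [frameCoeffs]; field_simp; rfl
  · refine (hF.eq_combination (p := -(frameCoeffs L f lam N₁ N₂).α₂ x)
      (q := (frameCoeffs L f lam N₁ N₂).α₁ x) (r := dV lam x)
      (s := (frameCoeffs L f lam N₁ N₂).μ₂ x) (t := 0) ?_ ?_ (n11 (0, 1)) ?_
      (nself (0, 1) hN.normal₁ n1x.2)).trans (by rw [mul_zero, zero_smul, add_zero])
    · rw [nU _ hN.normal₁, ← dV_eq_dd, hsymm]; simp only [frameCoeffs]; field_simp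
    · rw [nV _ hN.normal₁, ← dV_eq_dd, vv1]; simp only [frameCoeffs]; field_simp
    · simp only [frameCoeffs]; field_simp; rfl
  · refine (hF.eq_combination (p := (frameCoeffs L f lam N₁ N₂).β₁ x)
      (q := -(frameCoeffs L f lam N₁ N₂).β₂ x) (r := (frameCoeffs L f lam N₁ N₂).μ₁ x)
      (s := dU lam x) (t := 0) ?_ ?_ ?_ (n22 (1, 0))
      (nself (1, 0) hN.normal₂ n2x.1)).trans (by rw [mul_zero, zero_smul, add_zero])
    · rw [nU _ hN.normal₂]; simp only [frameCoeffs]; field_simp; rfl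
    · rw [nV _ hN.normal₂]; simp only [frameCoeffs]; field_simp; rfl
    · rw [n21]; simp only [frameCoeffs]; field_simp; rfl
  · refine (hF.eq_combination (p := (frameCoeffs L f lam N₁ N₂).β₂ x)
      (q := -(frameCoeffs L f lam N₁ N₂).β₁ x) (r := (frameCoeffs L f lam N₁ N₂).μ₂ x)
      (s := dV lam x) (t := 0) ?_ ?_ ?_ (n22 (0, 1))
      (nself (0, 1) hN.normal₂ n2x.2)).trans (by rw [mul_zero, zero_smul, add_zero])
    · rw [nU _ hN.normal₂, ← dV_eq_dd, hsymm]; simp only [frameCoeffs]; field_simp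
    · rw [nV _ hN.normal₂, ← dV_eq_dd, vv2]; simp only [frameCoeffs]; field_simp
    · rw [n21]; simp only [frameCoeffs]; field_simp; rfl

/-- The second fundamental form in null directions, in terms of the coefficients. -/
theorem HasCoeffsOn.sffP_eq (hC : HasCoeffsOn L f lam N₁ N₂ C U) (h : IsZeroMeanOn L f U)
    (hU : IsOpen U) (hN : IsNormalFrameOn L f lam N₁ N₂ U) (hx : x ∈ U) :
    sffP L f x = (2 * (C.α₁ x + C.α₂ x)) • N₁ x + (2 * (C.β₁ x + C.β₂ x)) • N₂ x := by
  have hc := h.isConformalAt hU hx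
  obtain ⟨⟨h1, -⟩, ⟨h2, h3⟩, -⟩ := hasCoeffsOn_iff.1 hC x hx
  have e : dP (dP f) x = (2 * (dU lam x + dV lam x)) • dP f x
      + ((2 * (C.α₁ x + C.α₂ x)) • N₁ x + (2 * (C.β₁ x + C.β₂ x)) • N₂ x) := by
    rw [dP_dP_eq h.smooth hU hx, h1, h2, h3, dP_eq]; module
  rw [sffP, e, hc.normalPart_add, hc.normalPart_smul, hc.normalPart_P, hc.normalPart_add,
    hc.normalPart_smul, hc.normalPart_smul, h.normalPart_normal hU hN.normal₁ hx,
    h.normalPart_normal hU hN.normal₂ hx, smul_zero, zero_add]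

theorem HasCoeffsOn.sffM_eq (hC : HasCoeffsOn L f lam N₁ N₂ C U) (h : IsZeroMeanOn L f U)
    (hU : IsOpen U) (hN : IsNormalFrameOn L f lam N₁ N₂ U) (hx : x ∈ U) :
    sffM L f x = (2 * (C.α₁ x - C.α₂ x)) • N₁ x + (2 * (C.β₁ x - C.β₂ x)) • N₂ x := by
  have hc := h.isConformalAt hU hx
  obtain ⟨⟨h1, -⟩, ⟨h2, h3⟩, -⟩ := hasCoeffsOn_iff.1 hC x hx
  have e : dM (dM f) x = (2 * (dU lam x - dV lam x)) • dM f x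
      + ((2 * (C.α₁ x - C.α₂ x)) • N₁ x + (2 * (C.β₁ x - C.β₂ x)) • N₂ x) := by
    rw [dM_dM_eq h.smooth hU hx, h1, h2, h3, dM_eq]; module
  rw [sffM, e, hc.normalPart_add, hc.normalPart_smul, hc.normalPart_M, hc.normalPart_add,
    hc.normalPart_smul, hc.normalPart_smul, h.normalPart_normal hU hN.normal₁ hx,
    h.normalPart_normal hU hN.normal₂ hx, smul_zero, zero_add]

/-- The two null components of the second fundamental form are proportional if and only if
`α₁ β₂ = α₂ β₁`. -/
theorem HasCoeffsOn.hasProportionalSff_iff (hC : HasCoeffsOn L f lam N₁ N₂ C U)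
    (h : IsZeroMeanOn L f U) (hU : IsOpen U) (hN : IsNormalFrameOn L f lam N₁ N₂ U) (hx : x ∈ U) :
    HasProportionalSff L f x ↔ C.α₁ x * C.β₂ x = C.α₂ x * C.β₁ x := by
  obtain ⟨g1, g2, g3⟩ := hN.gram x hx
  have hE := (Real.exp_pos (2 * lam x)).ne'
  unfold HasProportionalSff
  rw [hC.sffP_eq h hU hN hx, hC.sffM_eq h hU hN hx]
  constructor
  · intro hp
    have h1 := congrArg (form L (N₂ x)) (hp (N₁ x))
    simp only [form_add_right, form_smul_right, g1, g2, g3, form_comm (N₂ x) (N₁ x)] at h1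
    have h2 : (Real.exp (2 * lam x) * Real.exp (2 * lam x)) *
        (C.α₁ x * C.β₂ x - C.α₂ x * C.β₁ x) = 0 := by linear_combination h1 / 8
    have := (mul_eq_zero.1 h2).resolve_left (by positivity)
    linarith
  · intro h0 ξ
    simp only [form_add_right, form_smul_right]
    match_scalars
    · linear_combination (8 * form L ξ (N₂ x)) * h0
    · linear_combination (-8 * form L ξ (N₁ x)) * h0

end Coefficients

/-! ### Existence of normal frames -/

section FrameExistence

variable {L : ℝ} {f : ℝ × ℝ → Amb L} {U : Set (ℝ × ℝ)} {x : ℝ × ℝ} {lam : ℝ × ℝ → ℝ}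

/-- A coordinate subspace of dimension greater than `k` contains a nonzero vector that satisfies
`k` given linear equations. -/
theorem exists_ne_zero_supported (P : ℕ → Prop) [DecidablePred P] {k : ℕ}
    (hk : k < Fintype.card {i : Fin (ambDim L) // P i}) (T : Amb L →ₗ[ℝ] (Fin k → ℝ)) :
    ∃ p : Amb L, p ≠ 0 ∧ (∀ i : Fin (ambDim L), ¬ P i → p i = 0) ∧ T p = 0 := by
  let J : ({i : Fin (ambDim L) // P i} → ℝ) →ₗ[ℝ] Amb L :=
    Function.ExtendByZero.linearMap ℝ Subtype.val
  have hJ : ∀ y i, J y (Subtype.val i) = y i := fun y i =>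
    Subtype.val_injective.extend_apply y (0 : Fin (ambDim L) → ℝ) i
  have hker : LinearMap.ker (T ∘ₗ J) ≠ ⊥ := by
    apply LinearMap.ker_ne_bot_of_finrank_lt
    simpa using hk
  obtain ⟨y, hy, hy0⟩ := (Submodule.ne_bot_iff _).1 hker
  refine ⟨J y, fun h0 => hy0 ?_, fun i hi => ?_, hy⟩
  · funext i
    rw [← hJ y i, h0]; rfl
  · exact Function.extend_apply' y (0 : Fin (ambDim L) → ℝ) i (fun ⟨j, hj⟩ => hi (hj ▸ j.2))

theorem form_self_pos_of_support {p : Amb L} (h0 : p ≠ 0)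
    (hs : ∀ i, p i ≠ 0 → ambSign L i = 1) : 0 < form L p p := by
  obtain ⟨j, hj⟩ := Function.ne_iff.1 h0
  refine Finset.sum_pos' (fun i _ => ?_) ⟨j, Finset.mem_univ _, ?_⟩
  · by_cases hi : p i = 0
    · simp [hi]
    · rw [hs i hi, one_mul]; exact mul_self_nonneg _
  · rw [hs j hj, one_mul]; exact mul_self_pos.2 hj

theorem form_self_neg_of_support {p : Amb L} (h0 : p ≠ 0)
    (hs : ∀ i, p i ≠ 0 → ambSign L i = -1) : form L p p < 0 := by
  obtain ⟨j, hj⟩ := Function.ne_iff.1 h0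
  refine Finset.sum_neg' (fun i _ => ?_) ⟨j, Finset.mem_univ _, ?_⟩
  · by_cases hi : p i = 0
    · simp [hi]
    · rw [hs i hi]; nlinarith [mul_self_nonneg (p i)]
  · rw [hs j hj]; nlinarith [mul_self_pos.2 hj]

namespace IsConformalAt

variable {E : ℝ}

theorem form_normalPart_self_eq (h : IsConformalAt L f E x) (w : Amb L) :
    form L (normalPart L f x w) (normalPart L f x w) =
      form L w w - form L w (dU f x) ^ 2 / E + form L w (dV f x) ^ 2 / E
        - L * form L w (f x) ^ 2 := by
  rw [h.form_normalPart_comm, h.normalPart_idem, h.normalPart_eq_UV]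
  simp only [form_sub_right, form_add_right, form_smul_right]
  ring

/-- The normal space contains a vector with positive square: project a vector with positive
square that is orthogonal to `∂f/∂u` and, if `L > 0`, to the position vector. -/
theorem exists_normalPart_pos (h : IsConformalAt L f E x) :
    ∃ p : Amb L, 0 < form L (normalPart L f x p) (normalPart L f x p) := by
  have hE := h.pos
  rcases le_or_gt L 0 with hL | hL
  · obtain ⟨p, hp0, hps, hpT⟩ := exists_ne_zero_supported (L := L) (fun i => i < 2) (k := 1)
      (by
        have key : ∀ n, n = 4 ∨ n = 5 → 1 < Fintype.card {i : Fin n // (i : ℕ) < 2} := by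
          rintro n (rfl | rfl) <;> decide
        exact key _ (by unfold ambDim; split_ifs <;> simp))
      (LinearMap.pi ![((formL L).flip (dU f x)).toLinearMap])
    have h1 : form L p (dU f x) = 0 := congrFun hpT 0
    have hpos := form_self_pos_of_support hp0 fun i hi => by
      have : (i : ℕ) < 2 := by by_contra hc; exact hi (hps i hc)
      simp [ambSign, this]
    refine ⟨p, ?_⟩
    rw [h.form_normalPart_self_eq, h1, zero_pow two_ne_zero, zero_div]
    have h2 : 0 ≤ form L p (dV f x) ^ 2 / E := by positivity
    linarith [mul_nonneg_of_nonpos_of_nonpos hL (neg_nonpos.2 (sq_nonneg (form L p (f x))))]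
  · obtain ⟨p, hp0, hps, hpT⟩ := exists_ne_zero_supported (L := L) (fun i => i < 2 ∨ 4 ≤ i)
      (k := 2)
      (by
        have key : ∀ n, n = 5 → 2 < Fintype.card {i : Fin n // (i : ℕ) < 2 ∨ 4 ≤ (i : ℕ)} := by
          rintro n rfl; decide
        exact key _ (by simp [ambDim, hL.ne']))
      (LinearMap.pi ![((formL L).flip (dU f x)).toLinearMap, ((formL L).flip (f x)).toLinearMap])
    have h1 : form L p (dU f x) = 0 := congrFun hpT 0
    have h3 : form L p (f x) = 0 := congrFun hpT 1
    have hpos := form_self_pos_of_support hp0 fun i hi => by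
      have : (i : ℕ) < 2 ∨ 4 ≤ (i : ℕ) := by by_contra hc; exact hi (hps i hc)
      rcases this with h | h
      · simp [ambSign, h]
      · simp [ambSign, hL, show ¬ (i : ℕ) < 4 by omega]
    refine ⟨p, ?_⟩
    rw [h.form_normalPart_self_eq, h1, h3, zero_pow two_ne_zero, zero_div, mul_zero]
    have h2 : 0 ≤ form L p (dV f x) ^ 2 / E := by positivity
    linarith

/-- The normal space contains a vector with negative square. -/
theorem exists_normalPart_neg (h : IsConformalAt L f E x) :
    ∃ p : Amb L, form L (normalPart L f x p) (normalPart L f x p) < 0 := by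
  have hE := h.pos
  rcases le_or_gt 0 L with hL | hL
  · obtain ⟨p, hp0, hps, hpT⟩ := exists_ne_zero_supported (L := L) (fun i => 2 ≤ i ∧ i < 4)
      (k := 1)
      (by
        have key : ∀ n, n = 4 ∨ n = 5 →
            1 < Fintype.card {i : Fin n // 2 ≤ (i : ℕ) ∧ (i : ℕ) < 4} := by
          rintro n (rfl | rfl) <;> decide
        exact key _ (by unfold ambDim; split_ifs <;> simp))
      (LinearMap.pi ![((formL L).flip (dV f x)).toLinearMap])
    have h1 : form L p (dV f x) = 0 := congrFun hpT 0
    have hpos := form_self_neg_of_support hp0 fun i hi => by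
      have : 2 ≤ (i : ℕ) ∧ (i : ℕ) < 4 := by by_contra hc; exact hi (hps i hc)
      simp [ambSign, this.2, show ¬ (i : ℕ) < 2 by omega]
    refine ⟨p, ?_⟩
    rw [h.form_normalPart_self_eq, h1, zero_pow two_ne_zero, zero_div]
    have h2 : 0 ≤ form L p (dU f x) ^ 2 / E := by positivity
    linarith [mul_nonneg hL (sq_nonneg (form L p (f x)))]
  · obtain ⟨p, hp0, hps, hpT⟩ := exists_ne_zero_supported (L := L) (fun i => 2 ≤ i)
      (k := 2)
      (by
        have key : ∀ n, n = 5 → 2 < Fintype.card {i : Fin n // 2 ≤ (i : ℕ)} := by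
          rintro n rfl; decide
        exact key _ (by simp [ambDim, hL.ne]))
      (LinearMap.pi ![((formL L).flip (dV f x)).toLinearMap, ((formL L).flip (f x)).toLinearMap])
    have h1 : form L p (dV f x) = 0 := congrFun hpT 0
    have h3 : form L p (f x) = 0 := congrFun hpT 1
    have hpos := form_self_neg_of_support hp0 fun i hi => by
      have : 2 ≤ (i : ℕ) := by by_contra hc; exact hi (hps i hc)
      simp [ambSign, show ¬ (i : ℕ) < 2 by omega, hL.le]
    refine ⟨p, ?_⟩
    rw [h.form_normalPart_self_eq, h1, h3, zero_pow two_ne_zero, zero_div, mul_zero]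
    have h2 : 0 ≤ form L p (dU f x) ^ 2 / E := by positivity
    linarith

end IsConformalAt

/-- Normal frames exist near each point. -/
theorem IsZeroMeanOn.exists_normalFrame (h : IsZeroMeanOn L f U) (hU : IsOpen U)
    (hlam : ContDiffOn ℝ ∞ lam U) (hx : x ∈ U) :
    ∃ V ⊆ U, IsOpen V ∧ x ∈ V ∧ ∃ N₁ N₂, IsNormalFrameOn L f lam N₁ N₂ V := by
  obtain ⟨p, hp⟩ := (h.isConformalAt hU hx).exists_normalPart_pos
  obtain ⟨q, hq⟩ := (h.isConformalAt hU hx).exists_normalPart_neg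
  have sp := h.smooth_normalPart hU (w := fun _ => p) contDiffOn_const
  have sq' := h.smooth_normalPart hU (w := fun _ => q) contDiffOn_const
  set a := fun y => form L (normalPart L f y p) (normalPart L f y p) with ha
  set b := fun y => form L (normalPart L f y q) (normalPart L f y q) with hb
  set c := fun y => form L (normalPart L f y p) (normalPart L f y q) with hc
  have sa : ContDiffOn ℝ ∞ a U := contDiffOn_form sp sp
  have sb : ContDiffOn ℝ ∞ b U := contDiffOn_form sq' sq'
  have sc : ContDiffOn ℝ ∞ c U := contDiffOn_form sp sq'
  set V := (U ∩ a ⁻¹' Set.Ioi 0) ∩ (U ∩ b ⁻¹' Set.Iio 0) with hV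
  have hVU : V ⊆ U := fun y hy => hy.1.1
  have hVo : IsOpen V := (sa.continuousOn.isOpen_inter_preimage hU isOpen_Ioi).inter
    (sb.continuousOn.isOpen_inter_preimage hU isOpen_Iio)
  have pa : ∀ y ∈ V, 0 < a y := fun y hy => hy.1.2
  have pb : ∀ y ∈ V, b y < 0 := fun y hy => hy.2.2
  -- Gram-Schmidt: `m = n₋ - (c / a) n₊` has square `b - c ^ 2 / a < 0`
  have pm : ∀ y ∈ V, 0 < c y ^ 2 / a y - b y := fun y hy => by
    have h1 : 0 ≤ c y ^ 2 / a y := div_nonneg (sq_nonneg _) (pa y hy).le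
    linarith [pb y hy]
  have sa' := sa.mono hVU
  have sb' := sb.mono hVU
  have sc' := sc.mono hVU
  have sl : ContDiffOn ℝ ∞ (fun y => Real.exp (lam y)) V := (hlam.mono hVU).exp
  have s1 : ContDiffOn ℝ ∞ (fun y => Real.exp (lam y) / Real.sqrt (a y)) V :=
    sl.div (sa'.sqrt fun y hy => (pa y hy).ne') fun y hy => (Real.sqrt_pos.2 (pa y hy)).ne'
  have sm : ContDiffOn ℝ ∞ (fun y => c y ^ 2 / a y - b y) V :=
    ((sc'.pow 2).div sa' fun y hy => (pa y hy).ne').sub sb'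
  have s2 : ContDiffOn ℝ ∞ (fun y => Real.exp (lam y) / Real.sqrt (c y ^ 2 / a y - b y)) V :=
    sl.div (sm.sqrt fun y hy => (pm y hy).ne') fun y hy => (Real.sqrt_pos.2 (pm y hy)).ne'
  have s3 : ContDiffOn ℝ ∞ (fun y => c y / a y) V := sc'.div sa' fun y hy => (pa y hy).ne'
  have hm := h.mono hVU
  have n1 := hm.isNormalField_normalPart hVo
    (w := fun y => (Real.exp (lam y) / Real.sqrt (a y)) • p) (s1.smul (contDiffOn_const (c := p)))
  have n2 := hm.isNormalField_normalPart hVo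
    (w := fun y => (Real.exp (lam y) / Real.sqrt (c y ^ 2 / a y - b y)) • (q - (c y / a y) • p))
    (s2.smul ((contDiffOn_const (c := q)).sub (s3.smul (contDiffOn_const (c := p)))))
  refine ⟨V, hVU, hVo, ⟨⟨hx, hp⟩, hx, hq⟩, _, _, n1, n2, fun y hy => ?_⟩
  have hcy := hm.isConformalAt hVo hy
  have e1 : (Real.exp (lam y) / Real.sqrt (a y)) ^ 2 = Real.exp (2 * lam y) / a y := by
    rw [div_pow, Real.sq_sqrt (pa y hy).le, ← Real.exp_nat_mul]; norm_cast
  have e2 : (Real.exp (lam y) / Real.sqrt (c y ^ 2 / a y - b y)) ^ 2 =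
      Real.exp (2 * lam y) / (c y ^ 2 / a y - b y) := by
    rw [div_pow, Real.sq_sqrt (pm y hy).le, ← Real.exp_nat_mul]; norm_cast
  have haa : form L (normalPart L f y p) (normalPart L f y p) = a y := rfl
  have hbb : form L (normalPart L f y q) (normalPart L f y q) = b y := rfl
  have hpq : form L (normalPart L f y p) (normalPart L f y q) = c y := rfl
  have hqp : form L (normalPart L f y q) (normalPart L f y p) = c y := form_comm _ _
  have ha0 := (pa y hy).ne'
  have hm0 := (pm y hy).ne'
  simp only [hcy.normalPart_smul, hcy.normalPart_sub, form_smul_left, form_smul_right,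
    form_sub_left, form_sub_right, haa, hbb, hpq, hqp]
  refine ⟨?_, ?_, ?_⟩
  · rw [← mul_assoc, ← sq, e1]; field_simp
  · generalize Real.exp (lam y) / Real.sqrt (c y ^ 2 / a y - b y) = k at e2
    rw [eq_div_iff hm0] at e2
    rw [← e2]
    field_simp; ring
  · field_simp; ring

end FrameExistence

/-! ### The explicit formulas for the coefficients -/

section Explicit

variable {L : ℝ} {f N₁ N₂ : ℝ × ℝ → Amb L} {U : Set (ℝ × ℝ)} {x : ℝ × ℝ} {lam : ℝ × ℝ → ℝ}
  {C : Coeffs}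

/-- A continuous nowhere vanishing function on a preconnected set has a constant sign. -/
theorem exists_sign_eq {X : Type*} [TopologicalSpace X] {s : Set X} (hs : IsPreconnected s)
    {g : X → ℝ} (hg : ContinuousOn g s) (h0 : ∀ y ∈ s, g y ≠ 0) :
    ∃ ε : ℝ, (ε = 1 ∨ ε = -1) ∧ ∀ y ∈ s, g y = ε * |g y| := by
  by_cases hpos : ∃ y ∈ s, 0 < g y
  · obtain ⟨y, hy, hgy⟩ := hpos
    refine ⟨1, Or.inl rfl, fun z hz => ?_⟩
    have : 0 < g z := by
      by_contra hc
      obtain ⟨t, ht, ht0⟩ := hs.intermediate_value hz hy hg ⟨not_lt.1 hc, hgy.le⟩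
      exact h0 t ht ht0
    rw [abs_of_pos this, one_mul]
  · push Not at hpos
    refine ⟨-1, Or.inr rfl, fun z hz => ?_⟩
    rw [abs_of_nonpos (hpos z hz)]; ring

/-- A function both of whose null derivatives vanish on a preconnected open set is constant. -/
theorem exists_const_of_null_derivs (hU : IsOpen U) (hc : IsPreconnected U) {g : ℝ × ℝ → ℝ}
    (hg : ContDiffOn ℝ ∞ g U) (hP : ∀ y ∈ U, dP g y = 0) (hM : ∀ y ∈ U, dM g y = 0) :
    ∃ c, ∀ y ∈ U, g y = c := by
  refine hU.exists_is_const_of_fderiv_eq_zero hc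
    (fun y hy => (differentiableAt_of_smooth hg hU hy).differentiableWithinAt) fun y hy => ?_
  ext
  · have := dU_eq_half g y
    rw [hP y hy, hM y hy] at this
    simpa [dU] using this
  · have := dV_eq_half g y
    rw [hP y hy, hM y hy] at this
    simpa [dV] using this

/-- The Codazzi equation for the product of `∇_{∂_+} ∂_u f` with the null normal field
`N₁ + σ N₂`, `σ = ± 1`. -/
theorem HasCoeffsOn.dM_form_dP_dU (hC : HasCoeffsOn L f lam N₁ N₂ C U) (h : IsZeroMeanOn L f U)
    (hU : IsOpen U) (hN : IsNormalFrameOn L f lam N₁ N₂ U) {σ : ℝ} (hσ : σ ^ 2 = 1) (hx : x ∈ U) :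
    dM (fun y => form L (dP (dU f) y) (N₁ y + σ • N₂ y)) x =
      (dM lam x + σ * (C.μ₁ x - C.μ₂ x)) * form L (dP (dU f) x) (N₁ x + σ • N₂ x) := by
  have d1 : DifferentiableAt ℝ (dP (dU f)) x :=
    differentiableAt_of_smooth (h.smooth_dd_dd hU (1, 1) (1, 0)) hU hx
  have dN1 := differentiableAt_of_smooth hN.normal₁.smooth hU hx
  have dN2 := differentiableAt_of_smooth hN.normal₂.smooth hU hx
  have hcx := h.isConformalAt hU hx
  have n1 := hN.normal₁.normal x hx
  have n2 := hN.normal₂.normal x hx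
  have t1 := mul_form_of_mem_tangentN (hN.normal₁.tangent x hx)
  have t2 := mul_form_of_mem_tangentN (hN.normal₂.tangent x hx)
  have hsw : dM (dP (dU f)) x = dU (dM (dP f)) x := by
    change dM (dP (dd (1, 0) f)) x = dd (1, 0) (dM (dP f)) x
    rw [dd_congr_on hU (fun y hy => dd_comm h.smooth hU hy) hx,
      dd_comm (h.smooth_dd hU (1, 1)) hU hx]
  have hfirst : form L (dM (dP (dU f)) x) (N₁ x + σ • N₂ x) = 0 := by
    rw [hsw, dU_eq_dd (dM (dP f)), h.dd_dM_dP hU (1, 0) hx, ← dU_eq_dd f, form_comm]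
    simp only [form_add_left, form_add_right, form_smul_left, form_smul_right, n1.1, n2.1]
    linear_combination (-2 * dd (1, 0) (fun y => form L (dU f y) (dU f y)) x) * (t1 + σ * t2)
  obtain ⟨⟨h1, h2⟩, -, ⟨h3, h4⟩, ⟨h5, h6⟩⟩ := hasCoeffsOn_iff.1 hC x hx
  have e0 : dP (dU f) x = (dU lam x + dV lam x) • dP f x
      + ((C.α₁ x + C.α₂ x) • N₁ x + (C.β₁ x + C.β₂ x) • N₂ x)
      + (-Real.exp (2 * lam x)) • (L • f x) := by
    rw [dP_eq, h1, h2, dP_eq]; module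
  have eν : dM (fun y => N₁ y + σ • N₂ y) x =
      (-(C.α₁ x - C.α₂ x) + σ * (C.β₁ x - C.β₂ x)) • dP f x
        + (dM lam x + σ * (C.μ₁ x - C.μ₂ x)) • (N₁ x + σ • N₂ x) := by
    have hdM : dM lam x = dU lam x - dV lam x := dM_eq _ _
    rw [dd_add dN1 (dN2.fun_const_smul σ), dd_const_smul σ dN2, dM_eq, dM_eq, h3, h4, h5, h6,
      dP_eq, hdM]
    match_scalars
    · ring
    · ring
    · ring
    · linear_combination (-(C.μ₁ x - C.μ₂ x)) * hσ
  have hlast : form L (dP (dU f) x) (dP f x) = 0 := by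
    rw [e0]
    simp only [form_add_left, form_smul_left, hcx.form_PP, hN.normal₁.form_P hx,
      hN.normal₂.form_P hx]
    rw [form_comm, hcx.form_P_self]; ring
  rw [dd_form d1 (dN1.fun_add (dN2.fun_const_smul σ)), hfirst, eν, zero_add, form_add_right,
    form_smul_right, form_smul_right, hlast, mul_zero, zero_add]

/-- The Codazzi equation for the product of `∇_{∂_-} ∂_u f` with the null normal field
`N₁ + σ N₂`, `σ = ± 1`. -/
theorem HasCoeffsOn.dP_form_dM_dU (hC : HasCoeffsOn L f lam N₁ N₂ C U) (h : IsZeroMeanOn L f U)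
    (hU : IsOpen U) (hN : IsNormalFrameOn L f lam N₁ N₂ U) {σ : ℝ} (hσ : σ ^ 2 = 1) (hx : x ∈ U) :
    dP (fun y => form L (dM (dU f) y) (N₁ y + σ • N₂ y)) x =
      (dP lam x + σ * (C.μ₁ x + C.μ₂ x)) * form L (dM (dU f) x) (N₁ x + σ • N₂ x) := by
  have d1 : DifferentiableAt ℝ (dM (dU f)) x :=
    differentiableAt_of_smooth (h.smooth_dd_dd hU (1, -1) (1, 0)) hU hx
  have dN1 := differentiableAt_of_smooth hN.normal₁.smooth hU hx
  have dN2 := differentiableAt_of_smooth hN.normal₂.smooth hU hx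
  have hcx := h.isConformalAt hU hx
  have n1 := hN.normal₁.normal x hx
  have n2 := hN.normal₂.normal x hx
  have t1 := mul_form_of_mem_tangentN (hN.normal₁.tangent x hx)
  have t2 := mul_form_of_mem_tangentN (hN.normal₂.tangent x hx)
  have hsw : dP (dM (dU f)) x = dU (dM (dP f)) x := by
    change dP (dM (dd (1, 0) f)) x = dd (1, 0) (dM (dP f)) x
    rw [dd_comm (h.smooth_dd hU (1, 0)) hU hx,
      dd_congr_on hU (fun y hy => dd_comm h.smooth hU hy) hx,
      dd_comm (h.smooth_dd hU (1, 1)) hU hx]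
  have hfirst : form L (dP (dM (dU f)) x) (N₁ x + σ • N₂ x) = 0 := by
    rw [hsw, dU_eq_dd (dM (dP f)), h.dd_dM_dP hU (1, 0) hx, ← dU_eq_dd f, form_comm]
    simp only [form_add_left, form_add_right, form_smul_left, form_smul_right, n1.1, n2.1]
    linear_combination (-2 * dd (1, 0) (fun y => form L (dU f y) (dU f y)) x) * (t1 + σ * t2)
  obtain ⟨⟨h1, h2⟩, -, ⟨h3, h4⟩, ⟨h5, h6⟩⟩ := hasCoeffsOn_iff.1 hC x hx
  have e0 : dM (dU f) x = (dU lam x - dV lam x) • dM f x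
      + ((C.α₁ x - C.α₂ x) • N₁ x + (C.β₁ x - C.β₂ x) • N₂ x)
      + (-Real.exp (2 * lam x)) • (L • f x) := by
    rw [dM_eq, h1, h2, dM_eq]; module
  have eν : dP (fun y => N₁ y + σ • N₂ y) x =
      (-(C.α₁ x + C.α₂ x) + σ * (C.β₁ x + C.β₂ x)) • dM f x
        + (dP lam x + σ * (C.μ₁ x + C.μ₂ x)) • (N₁ x + σ • N₂ x) := by
    have hdP : dP lam x = dU lam x + dV lam x := dP_eq _ _
    rw [dd_add dN1 (dN2.fun_const_smul σ), dd_const_smul σ dN2, dP_eq, dP_eq, h3, h4, h5, h6,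
      dM_eq, hdP]
    match_scalars
    · ring
    · ring
    · ring
    · linear_combination (-(C.μ₁ x + C.μ₂ x)) * hσ
  have hlast : form L (dM (dU f) x) (dM f x) = 0 := by
    rw [e0]
    simp only [form_add_left, form_smul_left, hcx.form_MM, hN.normal₁.form_M hx,
      hN.normal₂.form_M hx]
    rw [form_comm, hcx.form_M_self]; ring
  rw [dd_form d1 (dN1.fun_add (dN2.fun_const_smul σ)), hfirst, eν, zero_add, form_add_right,
    form_smul_right, form_smul_right, hlast, mul_zero, zero_add]

/-- In a coordinate with `⟨σ(∂_+, ∂_+), σ(∂_-, ∂_-)⟩ = 4 ε` on a connected domain, the coefficients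
of a surface with proportional null components of the second fundamental form are given by the
explicit formulas, for every normal frame: `P_±` and `Q_±` are the logarithms of the absolute values
of `X_± + Y_±` and `X_± - Y_±`. -/
theorem HasCoeffsOn.areExplicitOn (hC : HasCoeffsOn L f lam N₁ N₂ C U) (h : IsZeroMeanOn L f U)
    (hU : IsOpen U) (hconn : IsPreconnected U) (hlam : ContDiffOn ℝ ∞ lam U)
    (hc : IsConformalFactorOn L f lam U)
    (hN : IsNormalFrameOn L f lam N₁ N₂ U) {ε : ℝ} (hε : ε = 1 ∨ ε = -1)
    (hp : ∀ y ∈ U, HasProportionalSff L f y)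
    (hs : ∀ y ∈ U, form L (sffP L f y) (sffM L f y) = 4 * ε) :
    AreExplicitOn ε lam C U := by
  have hε0 : ε ≠ 0 := by rcases hε with rfl | rfl <;> norm_num
  have hεε : ε * ε = 1 := by rcases hε with rfl | rfl <;> norm_num
  have hE : ∀ y, Real.exp (2 * lam y) ≠ 0 := fun y => (Real.exp_pos _).ne'
  set Z : ℝ → ℝ × ℝ → ℝ := fun σ y => (C.α₁ y + C.α₂ y) - σ * (C.β₁ y + C.β₂ y) with hZ
  set W : ℝ → ℝ × ℝ → ℝ := fun σ y => (C.α₁ y - C.α₂ y) - σ * (C.β₁ y - C.β₂ y) with hW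
  -- `Z_{-σ}` is `X_± + Y_±` and `W_σ` is `X_± - Y_±`, where `±` is the sign of `σ`;
  -- both families are products of second derivatives with null normal fields
  have eZ : ∀ σ, ∀ y ∈ U, Z σ y =
      form L (dP (dU f) y) (N₁ y + σ • N₂ y) / Real.exp (2 * lam y) := fun σ y hy => by
    have hF := hN.isFrameAt h hU hc hy
    obtain ⟨⟨h1, h2⟩, -⟩ := hasCoeffsOn_iff.1 hC y hy
    rw [eq_div_iff (hE y), dP_eq, h1, h2]
    simp only [form_add_left, form_add_right, form_smul_left, form_smul_right, hF.ac, hF.ad, hF.bc,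
      hF.bd, hF.cc, hF.cd, hF.dc, hF.dd, hZ]
    linear_combination Real.exp (2 * lam y) * (hF.gc + σ * hF.gd)
  have eW : ∀ σ, ∀ y ∈ U, W σ y =
      form L (dM (dU f) y) (N₁ y + σ • N₂ y) / Real.exp (2 * lam y) := fun σ y hy => by
    have hF := hN.isFrameAt h hU hc hy
    obtain ⟨⟨h1, h2⟩, -⟩ := hasCoeffsOn_iff.1 hC y hy
    rw [eq_div_iff (hE y), dM_eq, h1, h2]
    simp only [form_add_left, form_add_right, form_sub_left, form_smul_left, form_smul_right,
      hF.ac, hF.ad, hF.bc, hF.bd, hF.cc, hF.cd, hF.dc, hF.dd, hW]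
    linear_combination Real.exp (2 * lam y) * (hF.gc + σ * hF.gd)
  have sE : ContDiffOn ℝ ∞ (fun y => Real.exp (2 * lam y)) U := (contDiffOn_const.mul hlam).exp
  have sν : ∀ σ : ℝ, ContDiffOn ℝ ∞ (fun y => N₁ y + σ • N₂ y) U := fun σ =>
    hN.normal₁.smooth.add (hN.normal₂.smooth.const_smul σ)
  have sz : ∀ σ : ℝ, ContDiffOn ℝ ∞ (fun y => form L (dP (dU f) y) (N₁ y + σ • N₂ y)) U :=
    fun σ => contDiffOn_form (h.smooth_dd_dd hU (1, 1) (1, 0)) (sν σ)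
  have sw : ∀ σ : ℝ, ContDiffOn ℝ ∞ (fun y => form L (dM (dU f) y) (N₁ y + σ • N₂ y)) U :=
    fun σ => contDiffOn_form (h.smooth_dd_dd hU (1, -1) (1, 0)) (sν σ)
  have sZ : ∀ σ : ℝ, ContDiffOn ℝ ∞ (Z σ) U := fun σ =>
    ((sz σ).div sE fun y _ => hE y).congr (eZ σ)
  have sW : ∀ σ : ℝ, ContDiffOn ℝ ∞ (W σ) U := fun σ =>
    ((sw σ).div sE fun y _ => hE y).congr (eW σ)
  -- proportionality removes the mixed terms from `Z_{-σ} W_σ`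
  have hprod : ∀ σ, σ ^ 2 = 1 → ∀ y ∈ U, Z (-σ) y * W σ y = ε / Real.exp (2 * lam y) := by
    intro σ hσ y hy
    have h1 := (hC.hasProportionalSff_iff h hU hN hy).1 (hp y hy)
    have h2 := hs y hy
    have hF := hN.isFrameAt h hU hc hy
    rw [hC.sffP_eq h hU hN hy, hC.sffM_eq h hU hN hy] at h2
    simp only [form_add_left, form_add_right, form_smul_left, form_smul_right,
      hF.cc, hF.cd, hF.dc, hF.dd] at h2
    rw [eq_div_iff (hE y)]
    simp only [hZ, hW]
    linear_combination h2 / 4 + 2 * σ * Real.exp (2 * lam y) * h1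
      - Real.exp (2 * lam y) * (C.β₁ y + C.β₂ y) * (C.β₁ y - C.β₂ y) * hσ
  have hne : ∀ σ, σ ^ 2 = 1 → ∀ y ∈ U, Z (-σ) y ≠ 0 ∧ W σ y ≠ 0 := by
    intro σ hσ y hy
    refine mul_ne_zero_iff.1 ?_
    rw [hprod σ hσ y hy]
    exact div_ne_zero hε0 (hE y)
  have sq1 : (1 : ℝ) ^ 2 = 1 := one_pow 2
  have sq2 : (-1 : ℝ) ^ 2 = 1 := by norm_num
  -- `Real.log` is the logarithm of the absolute value, so the signs need no attention here
  set P : ℝ → ℝ × ℝ → ℝ := fun σ y => Real.log (Z (-σ) y) with hPdef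
  set Q : ℝ → ℝ × ℝ → ℝ := fun σ y => Real.log (W σ y) with hQdef
  have sP : ∀ σ, σ ^ 2 = 1 → ContDiffOn ℝ ∞ (P σ) U := fun σ hσ =>
    (sZ (-σ)).log fun y hy => (hne σ hσ y hy).1
  have sQ : ∀ σ, σ ^ 2 = 1 → ContDiffOn ℝ ∞ (Q σ) U := fun σ hσ =>
    (sW σ).log fun y hy => (hne σ hσ y hy).2
  have hsum : ∀ σ, σ ^ 2 = 1 → ∀ y ∈ U, -2 * lam y = P σ y + Q σ y := by
    intro σ hσ y hy
    simp only [hPdef, hQdef]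
    rw [← Real.log_mul (hne σ hσ y hy).1 (hne σ hσ y hy).2, hprod σ hσ y hy,
      Real.log_div hε0 (hE y), Real.log_exp]
    have : Real.log ε = 0 := by rcases hε with rfl | rfl <;> simp
    rw [this]; ring
  -- the Codazzi equations for the logarithms
  have dlogE : ∀ w, ∀ y ∈ U, dd w (fun y => 2 * lam y) y = 2 * dd w lam y := fun w y hy =>
    dd_const_mul _ (differentiableAt_of_smooth hlam hU hy)
  have dP_P : ∀ σ, σ ^ 2 = 1 → ∀ y ∈ U,
      dM (P σ) y = -dM lam y - σ * (C.μ₁ y - C.μ₂ y) := by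
    intro σ hσ y hy
    have hz : form L (dP (dU f) y) (N₁ y + (-σ) • N₂ y) ≠ 0 := fun h0 =>
      (hne σ hσ y hy).1 (by rw [eZ _ y hy, h0, zero_div])
    have dz := differentiableAt_of_smooth (sz (-σ)) hU hy
    have e : ∀ y ∈ U, P σ y =
        Real.log (form L (dP (dU f) y) (N₁ y + (-σ) • N₂ y)) - 2 * lam y := fun y hy => by
      have hz : form L (dP (dU f) y) (N₁ y + (-σ) • N₂ y) ≠ 0 := fun h0 =>
        (hne σ hσ y hy).1 (by rw [eZ _ y hy, h0, zero_div])
      simp only [hPdef]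
      rw [eZ _ y hy, Real.log_div hz (hE y), Real.log_exp]
    rw [dd_congr_on hU e hy, dd_sub (dz.log hz)
      ((differentiableAt_of_smooth hlam hU hy).const_mul 2), dd_log dz hz, dlogE _ y hy,
      hC.dM_form_dP_dU h hU hN (by rw [neg_sq, hσ]) hy]
    field_simp
    ring
  have dP_Q : ∀ σ, σ ^ 2 = 1 → ∀ y ∈ U,
      dP (Q σ) y = -dP lam y + σ * (C.μ₁ y + C.μ₂ y) := by
    intro σ hσ y hy
    have hz : form L (dM (dU f) y) (N₁ y + σ • N₂ y) ≠ 0 := fun h0 =>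
      (hne σ hσ y hy).2 (by rw [eW _ y hy, h0, zero_div])
    have dz := differentiableAt_of_smooth (sw σ) hU hy
    have e : ∀ y ∈ U, Q σ y =
        Real.log (form L (dM (dU f) y) (N₁ y + σ • N₂ y)) - 2 * lam y := fun y hy => by
      have hz : form L (dM (dU f) y) (N₁ y + σ • N₂ y) ≠ 0 := fun h0 =>
        (hne σ hσ y hy).2 (by rw [eW _ y hy, h0, zero_div])
      simp only [hQdef]
      rw [eW _ y hy, Real.log_div hz (hE y), Real.log_exp]
    rw [dd_congr_on hU e hy, dd_sub (dz.log hz)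
      ((differentiableAt_of_smooth hlam hU hy).const_mul 2), dd_log dz hz, dlogE _ y hy,
      hC.dP_form_dM_dU h hU hN hσ hy]
    field_simp
    ring
  -- `Q_- - P_+` is constant: replace `P_+` by `-2 λ - Q_+` to differentiate along `∂_+`, and
  -- `Q_-` by `-2 λ - P_-` to differentiate along `∂_-`
  obtain ⟨c, hcc⟩ := exists_const_of_null_derivs hU hconn (g := fun y => Q (-1) y - P 1 y)
    ((sQ _ sq2).sub (sP _ sq1))
    (by
      intro y hy
      have dl := (differentiableAt_of_smooth hlam hU hy).const_mul 2
      have d1 := differentiableAt_of_smooth (sQ _ sq1) hU hy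
      have d2 := differentiableAt_of_smooth (sQ _ sq2) hU hy
      rw [dd_congr_on hU (g := fun y => Q (-1) y + (2 * lam y + Q 1 y))
        (fun y hy => by linarith [hsum 1 sq1 y hy]) hy, dd_add d2 (dl.fun_add d1), dd_add dl d1,
        dlogE _ y hy, dP_Q _ sq1 y hy, dP_Q _ sq2 y hy]
      ring)
    (by
      intro y hy
      have dl := (differentiableAt_of_smooth hlam hU hy).const_mul (-2)
      have d1 := differentiableAt_of_smooth (sP _ sq1) hU hy
      have d2 := differentiableAt_of_smooth (sP _ sq2) hU hy
      rw [dd_congr_on hU (g := fun y => -2 * lam y - (P (-1) y + P 1 y))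
        (fun y hy => by linarith [hsum (-1) sq2 y hy]) hy, dd_sub dl (d2.fun_add d1),
        dd_add d2 d1, dd_const_mul _ (differentiableAt_of_smooth hlam hU hy),
        dP_P _ sq1 y hy, dP_P _ sq2 y hy]
      ring)
  -- `Z_{-σ}` has a constant sign, and that of `W_σ` differs from it by the factor `ε`
  have hsign : ∀ σ, σ ^ 2 = 1 → ∃ ε' : ℝ, (ε' = 1 ∨ ε' = -1) ∧
      ∀ y ∈ U, Z (-σ) y = ε' * Real.exp (P σ y) ∧ W σ y = ε' * (ε * Real.exp (Q σ y)) := by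
    intro σ hσ
    obtain ⟨ε', h1, h2⟩ := exists_sign_eq hconn (sZ (-σ)).continuousOn
      fun y hy => (hne σ hσ y hy).1
    have hε' : ε' * ε' = 1 := by rcases h1 with rfl | rfl <;> norm_num
    refine ⟨ε', h1, fun y hy => ?_⟩
    have hz := (hne σ hσ y hy).1
    have hP : Real.exp (P σ y) = |Z (-σ) y| := Real.exp_log_eq_abs hz
    have hZ' : Z (-σ) y = ε' * Real.exp (P σ y) := by rw [hP]; exact h2 y hy
    refine ⟨hZ', ?_⟩
    have hPQ : Real.exp (P σ y) * Real.exp (Q σ y) * Real.exp (2 * lam y) = 1 := by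
      rw [← Real.exp_add, ← Real.exp_add, ← hsum σ hσ y hy]; simp
    have h3 := hprod σ hσ y hy
    rw [eq_div_iff (hE y)] at h3
    apply mul_left_cancel₀ hz
    apply mul_right_cancel₀ (hE y)
    rw [h3, hZ']
    linear_combination (-ε * ε' * ε') * hPQ - ε * hε'
  obtain ⟨εp, hεp, hp1⟩ := hsign 1 sq1
  obtain ⟨εm, hεm, hm1⟩ := hsign (-1) sq2
  refine ⟨P 1, P (-1), Q 1, Q (-1), c, εp, εm,
    ⟨sP _ sq1, sP _ sq2, sQ _ sq1, sQ _ sq2⟩, hεp, hεm, ?_, ?_, ?_⟩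
  · intro y hy
    have h1 := hsum 1 sq1 y hy
    have h2 := hsum (-1) sq2 y hy
    have h3 := hcc y hy
    exact ⟨h1, h2, by linarith, by linarith⟩
  · intro y hy
    have d1 := differentiableAt_of_smooth (sP _ sq1) hU hy
    have d2 := differentiableAt_of_smooth (sP _ sq2) hU hy
    have d3 := differentiableAt_of_smooth (sQ _ sq1) hU hy
    have d4 := differentiableAt_of_smooth (sQ _ sq2) hU hy
    have hS : dS (fun y => Q 1 y - Q (-1) y) y = 2 * (C.μ₁ y + C.μ₂ y) / Real.sqrt 2 := by
      rw [dS, ← dP_eq, dd_sub d3 d4, dP_Q _ sq1 y hy, dP_Q _ sq2 y hy]; ring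
    have hT : dT (fun y => P 1 y - P (-1) y) y = -2 * (C.μ₁ y - C.μ₂ y) / Real.sqrt 2 := by
      rw [dT, ← dM_eq, dd_sub d1 d2, dP_P _ sq1 y hy, dP_P _ sq2 y hy]; ring
    have h2 : Real.sqrt 2 ≠ 0 := by positivity
    have h22 : Real.sqrt 2 ^ 2 = 2 := Real.sq_sqrt (by norm_num)
    rw [hS, hT]
    constructor
    · field_simp; rw [h22]; ring
    · field_simp; rw [h22]; ring
  · intro y hy
    refine ⟨_, _, _, _, rfl, rfl, rfl, rfl, ?_⟩
    obtain ⟨z1, w1⟩ := hp1 y hy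
    obtain ⟨z2, w2⟩ := hm1 y hy
    simp only [hZ, hW] at z1 w1 z2 w2
    refine ⟨?_, ?_, ?_, ?_⟩ <;> linarith

/-- The explicit formulas imply `α₁ β₂ = α₂ β₁`. -/
theorem AreExplicitOn.mul_eq_mul {ε : ℝ} (hA : AreExplicitOn ε lam C U) (hx : x ∈ U) :
    C.α₁ x * C.β₂ x = C.α₂ x * C.β₁ x := by
  obtain ⟨Pp, Pm, Qp, Qm, c, εp, εm, -, hεp, hεm, hPQ, -, hX⟩ := hA
  obtain ⟨h1, h2, -⟩ := hPQ x hx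
  obtain ⟨Xp, Xm, Yp, Ym, rfl, rfl, rfl, rfl, a1, a2, b1, b2⟩ := hX x hx
  have e1 : Real.exp (Pp x) * Real.exp (Qp x) = Real.exp (Pm x) * Real.exp (Qm x) := by
    rw [← Real.exp_add, ← Real.exp_add, ← h1, ← h2]
  have e2 : εp ^ 2 = 1 := by rcases hεp with rfl | rfl <;> norm_num
  have e3 : εm ^ 2 = 1 := by rcases hεm with rfl | rfl <;> norm_num
  rw [a1, a2, b1, b2]
  linear_combination (ε / 4) * e1 + (ε * Real.exp (Pp x) * Real.exp (Qp x) / 4) * e2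
    - (ε * Real.exp (Pm x) * Real.exp (Qm x) / 4) * e3

end Explicit

-- deep instance searches for spaces of continuous linear maps
set_option maxSynthPendingDepth 3

/-! ### Flat linear systems: the Frobenius theorem -/

section Frobenius

variable {E V : Type*} [NormedAddCommGroup E] [NormedSpace ℝ E] [NormedAddCommGroup V]
  [NormedSpace ℝ V]

theorem exp_half_le_two : Real.exp (1 / 2) ≤ 2 := by
  have h1 : Real.exp (1 / 2) ^ 2 = Real.exp 1 := by rw [← Real.exp_nat_mul]; norm_num
  have h2 := Real.exp_one_lt_d9
  nlinarith [Real.exp_pos (1 / 2 : ℝ)]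

/-- A linear differential equation with coefficients of norm at most `1 / 2` is solvable on the
unit interval. -/
theorem exists_linear_ode_solution [CompleteSpace V] {M : ℝ → V →L[ℝ] V}
    (hM : ContinuousOn M (Set.Icc 0 1)) (hb : ∀ τ ∈ Set.Icc (0 : ℝ) 1, ‖M τ‖ ≤ 1 / 2) (w : V) :
    ∃ y : ℝ → V, y 0 = w ∧
      (∀ τ ∈ Set.Icc (0 : ℝ) 1, HasDerivWithinAt y (M τ (y τ)) (Set.Icc 0 1) τ) ∧
      ∀ τ ∈ Set.Icc (0 : ℝ) 1, ‖y τ‖ ≤ 2 * ‖w‖ := by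
  have hPL : IsPicardLindelof (fun τ v => M τ v) (⟨0, by norm_num, by norm_num⟩ : Set.Icc (0 : ℝ) 1)
      w (‖w‖₊ + 1) 0 (‖w‖₊ + 1) 1 := by
    refine ⟨fun τ hτ => ?_, fun v _ => hM.clm_apply continuousOn_const, fun τ hτ v hv => ?_, ?_⟩
    · refine ((M τ).lipschitz.weaken ?_).lipschitzOnWith
      have := hb τ hτ
      exact_mod_cast this.trans (by norm_num)
    · have h1 : ‖v‖ ≤ ‖w‖ + (‖w‖ + 1) := by
        have h2 := norm_le_norm_add_norm_sub w v
        rw [mem_closedBall_iff_norm'] at hv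
        simp only [NNReal.coe_add, coe_nnnorm, NNReal.coe_one] at hv
        linarith
      calc ‖M τ v‖ ≤ ‖M τ‖ * ‖v‖ := (M τ).le_opNorm v
        _ ≤ 1 / 2 * (‖w‖ + (‖w‖ + 1)) := by gcongr; exact hb τ hτ
        _ ≤ _ := by simp only [NNReal.coe_add, coe_nnnorm, NNReal.coe_one]; linarith
    · simp
  obtain ⟨y, hy0, hy⟩ := hPL.exists_eq_forall_mem_Icc_hasDerivWithinAt₀
  refine ⟨y, hy0, hy, fun τ hτ => ?_⟩
  have hc : ContinuousOn y (Set.Icc 0 1) := fun τ hτ => (hy τ hτ).continuousWithinAt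
  have h1 := norm_le_gronwallBound_of_norm_deriv_right_le (δ := ‖w‖) (K := 1 / 2) (ε := 0) hc
    (fun τ hτ => (hy τ (Set.Ico_subset_Icc_self hτ)).mono_of_mem_nhdsWithin
      (Icc_mem_nhdsGE_of_mem hτ)) (by rw [hy0])
    (fun τ hτ => by
      rw [add_zero]
      exact (M τ).le_of_opNorm_le (hb τ (Set.Ico_subset_Icc_self hτ)) _) τ hτ
  rw [gronwallBound_ε0, sub_zero] at h1
  have h2 : Real.exp (1 / 2 * τ) ≤ 2 :=
    (Real.exp_le_exp.2 (by linarith [hτ.2])).trans exp_half_le_two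
  nlinarith [norm_nonneg w]

/-- Bounds for a connection form `A` and its first two derivatives on the ball of radius `r` about
`x₀`, together with its flatness `dA + A ∧ A = 0`. -/
structure IsFlatBounded (A : E → E →L[ℝ] V →L[ℝ] V) (x₀ : E) (r K C : ℝ) : Prop where
  r_pos : 0 < r
  r_le : r ≤ 1
  K_nonneg : 0 ≤ K
  C_nonneg : 0 ≤ C
  K_mul : K * r ≤ 1 / 2
  diff : ∀ x ∈ Metric.ball x₀ r, DifferentiableAt ℝ A x
  norm_le : ∀ x ∈ Metric.ball x₀ r, ‖A x‖ ≤ K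
  norm_fderiv_le : ∀ x ∈ Metric.ball x₀ r, ‖fderiv ℝ A x‖ ≤ C
  lip : ∀ x ∈ Metric.ball x₀ r, ∀ y ∈ Metric.ball x₀ r,
    ‖fderiv ℝ A x - fderiv ℝ A y‖ ≤ C * ‖x - y‖
  flat : ∀ x ∈ Metric.ball x₀ r, ∀ p h : E, ∀ v : V,
    fderiv ℝ A x p h v + A x h (A x p v) = fderiv ℝ A x h p v + A x p (A x h v)

/-- The solution of the radial equation `y' = A(x₀ + τ p) p y` on the segment from `x₀` to
`x₀ + p`. -/
structure IsRadialSolution (A : E → E →L[ℝ] V →L[ℝ] V) (x₀ : E) (w : V) (p : E) (y : ℝ → V) :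
    Prop where
  zero : y 0 = w
  deriv : ∀ τ ∈ Set.Icc (0 : ℝ) 1,
    HasDerivWithinAt y (A (x₀ + τ • p) p (y τ)) (Set.Icc 0 1) τ
  norm_le : ∀ τ ∈ Set.Icc (0 : ℝ) 1, ‖y τ‖ ≤ 2 * ‖w‖

theorem add_smul_mem_ball {x₀ p : E} {r τ : ℝ} (hp : ‖p‖ < r) (hτ : τ ∈ Set.Icc (0 : ℝ) 1) :
    x₀ + τ • p ∈ Metric.ball x₀ r := by
  rw [mem_ball_iff_norm, add_sub_cancel_left, norm_smul, Real.norm_of_nonneg hτ.1]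
  nlinarith [hτ.2, norm_nonneg p]

variable {A : E → E →L[ℝ] V →L[ℝ] V} {x₀ : E} {r K C : ℝ}

theorem IsFlatBounded.exists_radialSolution [CompleteSpace V] (h : IsFlatBounded A x₀ r K C) (w : V)
    {p : E} (hp : ‖p‖ < r) : ∃ y, IsRadialSolution A x₀ w p y := by
  have hc : ContinuousOn (fun τ : ℝ => A (x₀ + τ • p) p) (Set.Icc 0 1) := fun τ hτ => by
    have h1 := (h.diff _ (add_smul_mem_ball hp hτ)).continuousAt
    have h2 : ContinuousAt (fun τ : ℝ => x₀ + τ • p) τ := by fun_prop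
    exact (ContinuousAt.clm_apply (ContinuousAt.comp (f := fun τ : ℝ => x₀ + τ • p) h1 h2)
      continuousAt_const).continuousWithinAt
  obtain ⟨y, h1, h2, h3⟩ := exists_linear_ode_solution hc (fun τ hτ => by
    refine ((A _).le_of_opNorm_le (h.norm_le _ (add_smul_mem_ball hp hτ)) p).trans ?_
    exact (mul_le_mul_of_nonneg_left hp.le h.K_nonneg).trans h.K_mul) w
  exact ⟨y, h1, h2, h3⟩

theorem IsFlatBounded.taylor (h : IsFlatBounded A x₀ r K C) {x y : E}
    (hx : x ∈ Metric.ball x₀ r) (hy : y ∈ Metric.ball x₀ r) :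
    ‖A y - A x - fderiv ℝ A x (y - x)‖ ≤ C * ‖y - x‖ ^ 2 := by
  have hseg : segment ℝ x y ⊆ Metric.ball x₀ r := (convex_ball x₀ r).segment_subset hx hy
  have := (convex_segment (𝕜 := ℝ) x y).norm_image_sub_le_of_norm_fderiv_le' (𝕜 := ℝ) (f := A)
    (φ := fderiv ℝ A x) (C := C * ‖y - x‖) (fun z hz => h.diff z (hseg hz))
    (fun z hz => (h.lip z (hseg hz) x hx).trans (mul_le_mul_of_nonneg_left
      (norm_sub_le_of_mem_segment hz) h.C_nonneg)) (left_mem_segment ℝ x y)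
      (right_mem_segment ℝ x y)
  rwa [mul_assoc, ← sq] at this

/-- The algebraic heart of the Frobenius theorem: along the segment to `p`, the candidate
`y + τ A(h) y` for the solution along the segment to `p + h` solves the radial equation up to an
error of order `‖h‖ ^ 2`, because the terms linear in `h` cancel by flatness. -/
theorem IsFlatBounded.error_le (h : IsFlatBounded A x₀ r K C) {p q : E} (hp : ‖p‖ < r)
    (hpq : ‖p + q‖ < r) {τ : ℝ} (hτ : τ ∈ Set.Icc (0 : ℝ) 1) {v : V} {Y : ℝ} (hv : ‖v‖ ≤ Y) :
    ‖A (x₀ + τ • (p + q)) (p + q) (v + τ • A (x₀ + τ • p) q v)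
      - (A (x₀ + τ • p) p v + (A (x₀ + τ • p) q v
        + τ • (fderiv ℝ A (x₀ + τ • p) p q v + A (x₀ + τ • p) q (A (x₀ + τ • p) p v))))‖
      ≤ (K ^ 2 + C + C * K + C * (1 + 2 * K)) * Y * ‖q‖ ^ 2 := by
  have hY : 0 ≤ Y := (norm_nonneg v).trans hv
  have hx := add_smul_mem_ball (x₀ := x₀) hp hτ
  have hx' := add_smul_mem_ball (x₀ := x₀) hpq hτ
  have hK := h.K_nonneg
  have hC := h.C_nonneg
  have hτ0 := hτ.1
  have hτ1 := hτ.2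
  have hq2 : ‖q‖ ≤ 2 := by
    have h1 : ‖q‖ ≤ ‖p + q‖ + ‖p‖ := by
      calc ‖q‖ = ‖(p + q) - p‖ := by rw [add_sub_cancel_left]
        _ ≤ _ := norm_sub_le _ _
    linarith [h.r_le]
  have hpq1 : ‖p + q‖ ≤ 1 := by linarith [h.r_le]
  have hR := h.taylor hx hx'
  have hdiff : x₀ + τ • (p + q) - (x₀ + τ • p) = τ • q := by rw [smul_add]; abel
  rw [hdiff, map_smul] at hR
  have hA := h.norm_le _ hx
  have hD := h.norm_fderiv_le _ hx
  have hflat := h.flat _ hx p q v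
  set B := A (x₀ + τ • p) with hB
  set D := fderiv ℝ A (x₀ + τ • p) with hDdef
  set R := A (x₀ + τ • (p + q)) - B - τ • D q with hRdef
  have hR' : ‖R‖ ≤ C * ‖q‖ ^ 2 := by
    refine hR.trans (mul_le_mul_of_nonneg_left ?_ hC)
    rw [norm_smul, Real.norm_of_nonneg hτ0]
    have : τ * ‖q‖ ≤ ‖q‖ := by nlinarith [norm_nonneg q]
    exact pow_le_pow_left₀ (by positivity) this 2
  have hAeq : A (x₀ + τ • (p + q)) = B + τ • D q + R := by rw [hRdef]; abel
  have nB : ∀ a u, ‖B a u‖ ≤ K * ‖a‖ * ‖u‖ := fun a u =>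
    ((B a).le_opNorm u).trans (mul_le_mul_of_nonneg_right
      (B.le_of_opNorm_le hA a) (norm_nonneg u))
  have nD : ∀ a b u, ‖D a b u‖ ≤ C * ‖a‖ * ‖b‖ * ‖u‖ := fun a b u =>
    ((D a b).le_opNorm u).trans (mul_le_mul_of_nonneg_right
      (((D a).le_opNorm b).trans (mul_le_mul_of_nonneg_right
        (D.le_of_opNorm_le hD a) (norm_nonneg b))) (norm_nonneg u))
  have nR : ∀ b u, ‖R b u‖ ≤ C * ‖q‖ ^ 2 * ‖b‖ * ‖u‖ := fun b u =>
    ((R b).le_opNorm u).trans (mul_le_mul_of_nonneg_right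
      (R.le_of_opNorm_le hR' b) (norm_nonneg u))
  have key : A (x₀ + τ • (p + q)) (p + q) (v + τ • B q v)
      - (B p v + (B q v + τ • (D p q v + B q (B p v)))) =
      τ • B q (B q v) + τ • D q q v + (τ * τ) • D q (p + q) (B q v)
        + R (p + q) (v + τ • B q v) := by
    have h2 : D p q v = D q p v + B p (B q v) - B q (B p v) := by rw [← hflat]; abel
    rw [hAeq, h2]
    simp only [add_apply, smul_apply, map_add, map_smul]
    module
  rw [key]
  have hBq : ‖B q v‖ ≤ K * ‖q‖ * Y := (nB q v).trans (by gcongr)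
  have t1 : ‖τ • B q (B q v)‖ ≤ K ^ 2 * Y * ‖q‖ ^ 2 := by
    rw [norm_smul, Real.norm_of_nonneg hτ0]
    calc τ * ‖B q (B q v)‖ ≤ 1 * (K * ‖q‖ * (K * ‖q‖ * Y)) := by
          gcongr; exact (nB q _).trans (by gcongr)
      _ = _ := by ring
  have t2 : ‖τ • D q q v‖ ≤ C * Y * ‖q‖ ^ 2 := by
    rw [norm_smul, Real.norm_of_nonneg hτ0]
    calc τ * ‖D q q v‖ ≤ 1 * (C * ‖q‖ * ‖q‖ * Y) := by
          gcongr; exact (nD q q v).trans (by gcongr)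
      _ = _ := by ring
  have t3 : ‖(τ * τ) • D q (p + q) (B q v)‖ ≤ C * K * Y * ‖q‖ ^ 2 := by
    rw [norm_smul, Real.norm_of_nonneg (by positivity)]
    calc τ * τ * ‖D q (p + q) (B q v)‖ ≤ 1 * 1 * (C * ‖q‖ * 1 * (K * ‖q‖ * Y)) := by
          gcongr; exact (nD q _ _).trans (by gcongr)
      _ = _ := by ring
  have t4 : ‖R (p + q) (v + τ • B q v)‖ ≤ C * (1 + 2 * K) * Y * ‖q‖ ^ 2 := by
    have h3 : ‖v + τ • B q v‖ ≤ Y + 1 * (K * 2 * Y) := by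
      refine (norm_add_le _ _).trans ?_
      rw [norm_smul, Real.norm_of_nonneg hτ0]
      gcongr
      exact hBq.trans (by gcongr)
    calc ‖R (p + q) (v + τ • B q v)‖ ≤ C * ‖q‖ ^ 2 * 1 * (Y + 1 * (K * 2 * Y)) :=
          (nR _ _).trans (by gcongr)
      _ = _ := by ring
  refine (norm_add_le _ _).trans ((add_le_add ((norm_add_le _ _).trans (add_le_add
    ((norm_add_le _ _).trans (add_le_add t1 t2)) t3)) t4).trans (le_of_eq ?_))
  ring

/-- The radial solutions depend on the end point to first order as the system prescribes. -/
theorem IsFlatBounded.radial_diff_le (h : IsFlatBounded A x₀ r K C) {w : V} {p q : E}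
    (hp : ‖p‖ < r) (hpq : ‖p + q‖ < r) {y z : ℝ → V} (hy : IsRadialSolution A x₀ w p y)
    (hz : IsRadialSolution A x₀ w (p + q) z) :
    ‖z 1 - (y 1 + A (x₀ + p) q (y 1))‖ ≤
      2 * ((K ^ 2 + C + C * K + C * (1 + 2 * K)) * (2 * ‖w‖)) * ‖q‖ ^ 2 := by
  set ε := (K ^ 2 + C + C * K + C * (1 + 2 * K)) * (2 * ‖w‖) * ‖q‖ ^ 2 with hε
  have hK := h.K_nonneg
  have hC := h.C_nonneg
  have hε0 : 0 ≤ ε := by positivity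
  set η : ℝ → V := fun τ => y τ + τ • A (x₀ + τ • p) q (y τ) with hη
  have hη' : ∀ τ ∈ Set.Icc (0 : ℝ) 1, HasDerivWithinAt η
      (A (x₀ + τ • p) p (y τ) + (A (x₀ + τ • p) q (y τ)
        + τ • (fderiv ℝ A (x₀ + τ • p) p q (y τ) + A (x₀ + τ • p) q (A (x₀ + τ • p) p (y τ)))))
      (Set.Icc 0 1) τ := by
    intro τ hτ
    have h1 := hy.deriv τ hτ
    have h2 : HasDerivAt (fun τ : ℝ => x₀ + τ • p) p τ := by
      simpa using ((hasDerivAt_id τ).smul_const p).const_add x₀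
    have h3 : HasDerivAt (fun τ : ℝ => A (x₀ + τ • p)) (fderiv ℝ A (x₀ + τ • p) p) τ :=
      (h.diff _ (add_smul_mem_ball hp hτ)).hasFDerivAt.comp_hasDerivAt τ h2
    have h4 : HasDerivAt (fun τ : ℝ => A (x₀ + τ • p) q) (fderiv ℝ A (x₀ + τ • p) p q) τ := by
      simpa using h3.clm_apply (hasDerivAt_const τ q)
    have h5 := h4.hasDerivWithinAt (s := Set.Icc 0 1) |>.clm_apply h1
    have h6 := (hasDerivWithinAt_id τ (Set.Icc (0 : ℝ) 1)).smul h5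
    have h7 := h1.add h6
    simp only [id, one_smul] at h7
    refine h7.congr_deriv ?_
    abel
  have hg : ∀ τ ∈ Set.Icc (0 : ℝ) 1, HasDerivWithinAt (fun τ => z τ - η τ)
      (A (x₀ + τ • (p + q)) (p + q) (z τ) - (A (x₀ + τ • p) p (y τ) + (A (x₀ + τ • p) q (y τ)
        + τ • (fderiv ℝ A (x₀ + τ • p) p q (y τ)
          + A (x₀ + τ • p) q (A (x₀ + τ • p) p (y τ))))))
      (Set.Icc 0 1) τ := fun τ hτ => (hz.deriv τ hτ).sub (hη' τ hτ)
  have hc : ContinuousOn (fun τ => z τ - η τ) (Set.Icc 0 1) :=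
    fun τ hτ => (hg τ hτ).continuousWithinAt
  have hb := norm_le_gronwallBound_of_norm_deriv_right_le (δ := 0) (K := 1 / 2) (ε := ε) hc
    (fun τ hτ => (hg τ (Set.Ico_subset_Icc_self hτ)).mono_of_mem_nhdsWithin
      (Icc_mem_nhdsGE_of_mem hτ)) (by simp [hη, hy.zero, hz.zero])
    (fun τ hτ => by
      have hτ' := Set.Ico_subset_Icc_self hτ
      have he := h.error_le hp hpq hτ' (hy.norm_le τ hτ')
      have hM : ‖A (x₀ + τ • (p + q)) (p + q) (z τ - η τ)‖ ≤ 1 / 2 * ‖z τ - η τ‖ := by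
        refine (A _ _).le_of_opNorm_le ?_ _
        refine ((A _).le_of_opNorm_le (h.norm_le _ (add_smul_mem_ball hpq hτ')) _).trans ?_
        exact (mul_le_mul_of_nonneg_left hpq.le hK).trans h.K_mul
      refine le_trans (le_of_eq ?_) ((norm_add_le _ _).trans (add_le_add hM he))
      congr 1
      rw [map_sub]
      abel) 1 (by simp)
  have h1 : gronwallBound 0 (1 / 2) ε (1 - 0) ≤ 2 * ε := by
    rw [gronwallBound_of_K_ne_0 (by norm_num)]
    simp only [sub_zero, zero_mul, zero_add, mul_one]
    nlinarith [exp_half_le_two]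
  refine (le_trans (le_of_eq ?_) (hb.trans h1)).trans (le_of_eq (by rw [hε]; ring))
  simp [hη]

/-- A smooth flat connection form is bounded, with bounded derivatives, near each point. -/
theorem exists_isFlatBounded {U : Set E} (hU : IsOpen U) {x₀ : E} (hx : x₀ ∈ U)
    (hA : ContDiffOn ℝ ∞ A U)
    (hflat : ∀ x ∈ U, ∀ p h : E, ∀ v : V,
      fderiv ℝ A x p h v + A x h (A x p v) = fderiv ℝ A x h p v + A x p (A x h v)) :
    ∃ r K C, Metric.ball x₀ r ⊆ U ∧ IsFlatBounded A x₀ r K C := by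
  have hA' : ContDiffAt ℝ ∞ A x₀ := hA.contDiffAt (hU.mem_nhds hx)
  have hD : ContDiffOn ℝ ∞ (fderiv ℝ A) U := hA.fderiv_of_isOpen hU (by simp)
  have hD' : ContDiffAt ℝ ∞ (fderiv ℝ A) x₀ := hD.contDiffAt (hU.mem_nhds hx)
  obtain ⟨C₁, s, hs, hlip⟩ := (hD'.of_le (m := 1) (by simp)).exists_lipschitzOnWith
  have h1 : ∀ᶠ x in nhds x₀, ‖A x‖ < ‖A x₀‖ + 1 :=
    hA'.continuousAt.norm.eventually_lt_const (by linarith)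
  have h2 : ∀ᶠ x in nhds x₀, ‖fderiv ℝ A x‖ < ‖fderiv ℝ A x₀‖ + 1 :=
    hD'.continuousAt.norm.eventually_lt_const (by linarith)
  obtain ⟨r₀, hr₀, hball⟩ := Metric.eventually_nhds_iff_ball.1
    (((hU.eventually_mem hx).and (Filter.eventually_mem_set.2 hs)).and (h1.and h2))
  set K := ‖A x₀‖ + 1 with hK
  have hK0 : 0 < K := by positivity
  set r := min r₀ (min 1 (1 / (2 * K))) with hr
  have hrr : r ≤ r₀ := min_le_left _ _
  have hsub : ∀ x ∈ Metric.ball x₀ r, x ∈ Metric.ball x₀ r₀ := fun x hx =>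
    Metric.ball_subset_ball hrr hx
  refine ⟨r, K, max C₁ (‖fderiv ℝ A x₀‖ + 1), fun x hx => (hball x (hsub x hx)).1.1, ?_⟩
  constructor
  · exact lt_min hr₀ (lt_min one_pos (by positivity))
  · exact (min_le_right _ _).trans (min_le_left _ _)
  · exact hK0.le
  · exact (NNReal.coe_nonneg C₁).trans (le_max_left _ _)
  · have : r ≤ 1 / (2 * K) := (min_le_right _ _).trans (min_le_right _ _)
    calc K * r ≤ K * (1 / (2 * K)) := mul_le_mul_of_nonneg_left this hK0.le
      _ = 1 / 2 := by field_simp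
  · exact fun x hx => (hA.contDiffAt (hU.mem_nhds (hball x (hsub x hx)).1.1)).differentiableAt
      (by simp)
  · exact fun x hx => (hball x (hsub x hx)).2.1.le
  · exact fun x hx => (hball x (hsub x hx)).2.2.le.trans (le_max_right _ _)
  · intro x hx y hy
    refine (hlip.norm_sub_le (hball x (hsub x hx)).1.2 (hball y (hsub y hy)).1.2).trans ?_
    exact mul_le_mul_of_nonneg_right (le_max_left _ _) (norm_nonneg _)
  · exact fun x hx => hflat x (hball x (hsub x hx)).1.1

/-- A differentiable solution of a linear system with smooth coefficients is smooth. -/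
theorem contDiffOn_of_hasFDerivAt_linear {U : Set E} (hU : IsOpen U) (hA : ContDiffOn ℝ ∞ A U)
    {ψ : E → V} (hψ : ∀ x ∈ U, HasFDerivAt ψ ((A x).flip (ψ x)) x) : ContDiffOn ℝ ∞ ψ U := by
  refine contDiffOn_infty.2 fun n => ?_
  induction n with
  | zero => exact contDiffOn_zero.2 fun x hx => (hψ x hx).continuousAt.continuousWithinAt
  | succ n ih =>
    rw [show ((n + 1 : ℕ) : WithTop ℕ∞) = (n : WithTop ℕ∞) + 1 by norm_cast,
      contDiffOn_succ_iff_fderiv_of_isOpen hU]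
    refine ⟨fun x hx => (hψ x hx).differentiableAt.differentiableWithinAt, by simp, ?_⟩
    refine ContDiffOn.congr ?_ (fun x hx => (hψ x hx).fderiv)
    have hAn : ContDiffOn ℝ n A U := hA.of_le (by exact_mod_cast le_top)
    have hflip : ContDiffOn ℝ n (fun x => (A x).flip) U :=
      (ContinuousLinearMap.flipₗᵢ ℝ E V V).contDiff.comp_contDiffOn hAn
    exact hflip.clm_apply ih

/-- **Frobenius theorem** for linear systems: if `A` is a smooth connection form on an open set
that is flat, `dA + A ∧ A = 0`, then the system `dψ = A ψ` has a local smooth solution with any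
prescribed value at a given point. -/
theorem exists_flat_section [CompleteSpace V] {U : Set E} (hU : IsOpen U) (hx : x₀ ∈ U)
    (hA : ContDiffOn ℝ ∞ A U)
    (hflat : ∀ x ∈ U, ∀ p h : E, ∀ v : V,
      fderiv ℝ A x p h v + A x h (A x p v) = fderiv ℝ A x h p v + A x p (A x h v)) (w : V) :
    ∃ W ⊆ U, IsOpen W ∧ x₀ ∈ W ∧ ∃ ψ : E → V, ContDiffOn ℝ ∞ ψ W ∧ ψ x₀ = w ∧
      ∀ x ∈ W, ∀ h, fderiv ℝ ψ x h = A x h (ψ x) := by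
  obtain ⟨r, K, C, hrU, hb⟩ := exists_isFlatBounded hU hx hA hflat
  have hex : ∀ p : E, ‖p‖ < r → ∃ y, IsRadialSolution A x₀ w p y := fun p hp =>
    hb.exists_radialSolution w hp
  choose! y hy using hex
  set ψ : E → V := fun x => y (x - x₀) 1 with hψ
  have hmem : ∀ x, x ∈ Metric.ball x₀ r ↔ ‖x - x₀‖ < r := fun x => mem_ball_iff_norm
  have hd : ∀ x ∈ Metric.ball x₀ r, HasFDerivAt ψ ((A x).flip (ψ x)) x := by
    intro x hx
    rw [hasFDerivAt_iff_isLittleO_nhds_zero]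
    have hx' := (hmem x).1 hx
    set B := 2 * ((K ^ 2 + C + C * K + C * (1 + 2 * K)) * (2 * ‖w‖)) with hB
    have hbig : (fun q => ψ (x + q) - ψ x - (A x).flip (ψ x) q) =O[nhds 0]
        fun q : E => ‖q‖ ^ 2 := by
      refine Asymptotics.IsBigO.of_bound B ?_
      have hnear : ∀ᶠ q : E in nhds 0, x + q ∈ Metric.ball x₀ r := by
        have : Filter.Tendsto (fun q : E => x + q) (nhds 0) (nhds x) := by
          have h1 : Continuous fun q : E => x + q := by fun_prop
          simpa using h1.tendsto 0
        exact this.eventually (Metric.isOpen_ball.mem_nhds hx)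
      filter_upwards [hnear] with q hq
      have hq' := (hmem _).1 hq
      have e1 : x + q - x₀ = (x - x₀) + q := by abel
      rw [e1] at hq'
      have := hb.radial_diff_le hx' hq' (hy _ hx') (hy _ hq')
      rw [Real.norm_of_nonneg (by positivity)]
      refine le_trans (le_of_eq ?_) this
      simp only [hψ, e1, add_sub_cancel, ContinuousLinearMap.flip_apply]
      congr 1
      abel
    refine hbig.trans_isLittleO ?_
    exact Asymptotics.isLittleO_norm_pow_id one_lt_two
  refine ⟨Metric.ball x₀ r, hrU, Metric.isOpen_ball, Metric.mem_ball_self hb.r_pos, ψ,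
    contDiffOn_of_hasFDerivAt_linear Metric.isOpen_ball (hA.mono hrU) hd, ?_, fun x hx h => ?_⟩
  · -- the radial equation towards `x₀` itself has the zero right-hand side
    have h0 : ‖x₀ - x₀‖ < r := by simpa using hb.r_pos
    have hs := hy _ h0
    have hz : ∀ τ ∈ Set.Icc (0 : ℝ) 1, HasDerivWithinAt (y (x₀ - x₀)) 0 (Set.Icc 0 1) τ :=
      fun τ hτ => by simpa using hs.deriv τ hτ
    have := (convex_Icc (0 : ℝ) 1).norm_image_sub_le_of_norm_hasDerivWithin_le (C := 0)
      (fun τ hτ => hz τ hτ) (by simp) (Set.left_mem_Icc.2 zero_le_one)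
      (Set.right_mem_Icc.2 zero_le_one)
    rw [zero_mul, norm_le_zero_iff, sub_eq_zero, hs.zero] at this
    exact this
  · rw [(hd x hx).fderiv]; rfl

/-- A solution of a linear system on a connected open set that vanishes at one point vanishes. -/
theorem flat_section_eq_zero {U : Set E} (hU : IsOpen U) (hconn : IsPreconnected U)
    (hA : ContinuousOn A U) {ψ : E → V} (hψ : ∀ x ∈ U, DifferentiableAt ℝ ψ x)
    (hd : ∀ x ∈ U, ∀ h, fderiv ℝ ψ x h = A x h (ψ x)) (hx : x₀ ∈ U) (h0 : ψ x₀ = 0) :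
    ∀ x ∈ U, ψ x = 0 := by
  have hloc : ∀ a ∈ U, ∃ r > 0, Metric.ball a r ⊆ U ∧
      ∀ b ∈ Metric.ball a r, ψ b = 0 → ∀ c ∈ Metric.ball a r, ψ c = 0 := by
    intro a ha
    have h1 : ∀ᶠ x in nhds a, ‖A x‖ < ‖A a‖ + 1 :=
      (hA.continuousAt (hU.mem_nhds ha)).norm.eventually_lt_const (by linarith)
    obtain ⟨r, hr, hball⟩ := Metric.eventually_nhds_iff_ball.1
      ((hU.eventually_mem ha).and h1)
    refine ⟨r, hr, fun x hx => (hball x hx).1, fun b hb hb0 c hc => ?_⟩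
    have hmem : ∀ τ ∈ Set.Icc (0 : ℝ) 1, b + τ • (c - b) ∈ Metric.ball a r := fun τ hτ =>
      (convex_ball a r).add_smul_sub_mem hb hc hτ
    have hg : ∀ τ ∈ Set.Icc (0 : ℝ) 1, HasDerivAt (fun τ : ℝ => ψ (b + τ • (c - b)))
        (A (b + τ • (c - b)) (c - b) (ψ (b + τ • (c - b)))) τ := by
      intro τ hτ
      have h2 : HasDerivAt (fun τ : ℝ => b + τ • (c - b)) (c - b) τ := by
        simpa using ((hasDerivAt_id τ).smul_const (c - b)).const_add b
      have hU' := (hball _ (hmem τ hτ)).1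
      rw [← hd _ hU']
      exact (hψ _ hU').hasFDerivAt.comp_hasDerivAt τ h2
    have := eq_zero_of_abs_deriv_le_mul_abs_self_of_eq_zero_right
      (K := (‖A a‖ + 1) * ‖c - b‖)
      (fun τ hτ => (hg τ hτ).continuousAt.continuousWithinAt)
      (fun τ hτ => (hg τ (Set.Ico_subset_Icc_self hτ)).hasDerivWithinAt) (by simpa using hb0)
      (fun τ hτ => (A _ _).le_of_opNorm_le ((A _).le_of_opNorm_le
        (hball _ (hmem τ (Set.Ico_subset_Icc_self hτ))).2.le _) _) 1
      (Set.right_mem_Icc.2 zero_le_one)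
    simpa using this
  -- the zero set and its complement in `U` are both open
  have hopen1 : IsOpen {x | x ∈ U ∧ ψ x = 0} := by
    rw [Metric.isOpen_iff]
    rintro a ⟨ha, ha0⟩
    obtain ⟨r, hr, hrU, hr0⟩ := hloc a ha
    exact ⟨r, hr, fun x hx => ⟨hrU hx, hr0 a (Metric.mem_ball_self hr) ha0 x hx⟩⟩
  have hopen2 : IsOpen {x | x ∈ U ∧ ψ x ≠ 0} := by
    rw [Metric.isOpen_iff]
    rintro a ⟨ha, ha0⟩
    obtain ⟨r, hr, hrU, hr0⟩ := hloc a ha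
    exact ⟨r, hr, fun x hx => ⟨hrU hx, fun hx0 => ha0 (hr0 x hx hx0 a (Metric.mem_ball_self hr))⟩⟩
  intro x hxU
  by_contra hne
  obtain ⟨z, -, ⟨-, hz1⟩, ⟨-, hz2⟩⟩ := hconn _ _ hopen1 hopen2
    (fun z hz => by
      by_cases h : ψ z = 0
      · exact Or.inl ⟨hz, h⟩
      · exact Or.inr ⟨hz, h⟩) ⟨x₀, hx, hx, h0⟩ ⟨x, hxU, hxU, hne⟩
  exact hz2 hz1

end Frobenius

/-! ### Linear systems in the plane with matrix coefficients -/

section LinearSystem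

variable {ι G : Type*} [Fintype ι] [DecidableEq ι] [NormedAddCommGroup G] [NormedSpace ℝ G]
  {S T : ℝ × ℝ → Matrix ι ι ℝ} {x x₀ : ℝ × ℝ} {U : Set (ℝ × ℝ)}

/-- The endomorphism of `ι → G` that moves the component with index `i` to the index `j`. -/
def moveComponent (G : Type*) [NormedAddCommGroup G] [NormedSpace ℝ G] (i j : ι) :
    (ι → G) →L[ℝ] (ι → G) :=
  (ContinuousLinearMap.single ℝ (fun _ : ι => G) j).comp
    (ContinuousLinearMap.proj (R := ℝ) (φ := fun _ : ι => G) i)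

/-- The connection form `S du + T dv`, acting on rows of vectors by right multiplication. -/
def systemForm (G : Type*) [NormedAddCommGroup G] [NormedSpace ℝ G] (S T : ℝ × ℝ → Matrix ι ι ℝ)
    (x : ℝ × ℝ) : ℝ × ℝ →L[ℝ] (ι → G) →L[ℝ] (ι → G) :=
  ∑ i, ∑ j, (S x i j • (ContinuousLinearMap.fst ℝ ℝ ℝ).smulRight (moveComponent G i j)
    + T x i j • (ContinuousLinearMap.snd ℝ ℝ ℝ).smulRight (moveComponent G i j))

theorem systemForm_apply (h : ℝ × ℝ) (v : ι → G) (j : ι) :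
    systemForm G S T x h v j = ∑ i, (h.1 * S x i j + h.2 * T x i j) • v i := by
  simp only [systemForm, moveComponent, sum_apply, add_apply,
    smul_apply, ContinuousLinearMap.smulRight_apply, ContinuousLinearMap.coe_fst',
    ContinuousLinearMap.coe_snd', ContinuousLinearMap.coe_comp, Function.comp_apply,
    ContinuousLinearMap.proj_apply, Finset.sum_apply, Pi.add_apply, Pi.smul_apply]
  refine Finset.sum_congr rfl fun i _ => ?_
  rw [Finset.sum_eq_single j]
  · simp [add_smul, smul_smul, mul_comm]
  · intro k _ hk
    simp [ContinuousLinearMap.single_apply, hk.symm]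
  · simp

theorem contDiffOn_systemForm (hS : ∀ i j, ContDiffOn ℝ ∞ (fun y => S y i j) U)
    (hT : ∀ i j, ContDiffOn ℝ ∞ (fun y => T y i j) U) : ContDiffOn ℝ ∞ (systemForm G S T) U := by
  unfold systemForm
  exact ContDiffOn.sum fun i _ => ContDiffOn.sum fun j _ =>
    ((hS i j).smul contDiffOn_const).add ((hT i j).smul contDiffOn_const)

theorem fderiv_systemForm (hS : ∀ i j, DifferentiableAt ℝ (fun y => S y i j) x)
    (hT : ∀ i j, DifferentiableAt ℝ (fun y => T y i j) x) (p : ℝ × ℝ) :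
    fderiv ℝ (systemForm G S T) x p =
      systemForm G (fun y => Matrix.of fun i j => dd p (fun z => S z i j) y)
        (fun y => Matrix.of fun i j => dd p (fun z => T z i j) y) x := by
  have h : HasFDerivAt (systemForm G S T) (∑ i, ∑ j,
      ((fderiv ℝ (fun y => S y i j) x).smulRight
          ((ContinuousLinearMap.fst ℝ ℝ ℝ).smulRight (moveComponent G i j))
        + (fderiv ℝ (fun y => T y i j) x).smulRight
          ((ContinuousLinearMap.snd ℝ ℝ ℝ).smulRight (moveComponent G i j)))) x := by
    unfold systemForm
    exact HasFDerivAt.fun_sum fun i _ => HasFDerivAt.fun_sum fun j _ =>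
      ((hS i j).hasFDerivAt.smul_const _).add ((hT i j).hasFDerivAt.smul_const _)
  rw [h.fderiv]
  simp only [sum_apply, add_apply, ContinuousLinearMap.smulRight_apply]
  rfl

/-- Existence for a system `dψ = ψ (S du + T dv)` that satisfies its integrability condition. -/
theorem exists_linearSystem_solution [CompleteSpace G] (hU : IsOpen U) (hx : x₀ ∈ U)
    (hS : ∀ i j, ContDiffOn ℝ ∞ (fun y => S y i j) U)
    (hT : ∀ i j, ContDiffOn ℝ ∞ (fun y => T y i j) U)
    (hc : ∀ x ∈ U, ∀ i j, dU (fun y => T y i j) x + (S x * T x) i j =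
      dV (fun y => S y i j) x + (T x * S x) i j) (w : ι → G) :
    ∃ W ⊆ U, IsOpen W ∧ IsPreconnected W ∧ x₀ ∈ W ∧ ∃ ψ : ι → ℝ × ℝ → G,
      (∀ j, ContDiffOn ℝ ∞ (ψ j) W) ∧ (∀ j, ψ j x₀ = w j) ∧
      ∀ x ∈ W, ∀ j, dU (ψ j) x = ∑ i, S x i j • ψ i x ∧ dV (ψ j) x = ∑ i, T x i j • ψ i x := by
  obtain ⟨W, hWU, hW, hxW, ψ, hψ, hψ0, hd⟩ := exists_flat_section (A := systemForm G S T) hU hx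
    (contDiffOn_systemForm hS hT) (fun x hx p h v => by
      have dS := fun i j => differentiableAt_of_smooth (hS i j) hU hx
      have dT := fun i j => differentiableAt_of_smooth (hT i j) hU hx
      rw [fderiv_systemForm dS dT, fderiv_systemForm dS dT]
      ext j
      simp only [Pi.add_apply, systemForm_apply, Matrix.of_apply, Finset.smul_sum, smul_smul]
      rw [Finset.sum_comm (f := fun i k => ((h.1 * S x i j + h.2 * T x i j) *
          (p.1 * S x k i + p.2 * T x k i)) • v k),
        Finset.sum_comm (f := fun i k => ((p.1 * S x i j + p.2 * T x i j) *
          (h.1 * S x k i + h.2 * T x k i)) • v k), ← Finset.sum_add_distrib,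
        ← Finset.sum_add_distrib]
      refine Finset.sum_congr rfl fun k _ => ?_
      rw [← Finset.sum_smul, ← Finset.sum_smul, ← add_smul, ← add_smul]
      congr 1
      have hdd : ∀ (q : ℝ × ℝ) (g : ℝ × ℝ → ℝ), dd q g x = q.1 * dU g x + q.2 * dV g x := by
        intro q g
        have : q = q.1 • ((1, 0) : ℝ × ℝ) + q.2 • ((0, 1) : ℝ × ℝ) := by ext <;> simp
        unfold dd dU dV
        conv_lhs => rw [this]
        rw [map_add, map_smul, map_smul]; rfl
      have hST : ∑ i, (h.1 * S x i j + h.2 * T x i j) * (p.1 * S x k i + p.2 * T x k i)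
          = h.1 * p.1 * (S x * S x) k j + h.2 * p.1 * (S x * T x) k j
            + h.1 * p.2 * (T x * S x) k j + h.2 * p.2 * (T x * T x) k j := by
        simp only [Matrix.mul_apply, Finset.mul_sum, ← Finset.sum_add_distrib]
        exact Finset.sum_congr rfl fun i _ => by ring
      have hST' : ∑ i, (p.1 * S x i j + p.2 * T x i j) * (h.1 * S x k i + h.2 * T x k i)
          = p.1 * h.1 * (S x * S x) k j + p.2 * h.1 * (S x * T x) k j
            + p.1 * h.2 * (T x * S x) k j + p.2 * h.2 * (T x * T x) k j := by
        simp only [Matrix.mul_apply, Finset.mul_sum, ← Finset.sum_add_distrib]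
        exact Finset.sum_congr rfl fun i _ => by ring
      rw [hST, hST', hdd, hdd, hdd, hdd]
      linear_combination (p.1 * h.2 - p.2 * h.1) * hc x hx k j) w
  obtain ⟨r, hr, hrW⟩ := Metric.isOpen_iff.1 hW x₀ hxW
  have hψd : ∀ x ∈ Metric.ball x₀ r, DifferentiableAt ℝ ψ x := fun x hx =>
    (hψ.contDiffAt (hW.mem_nhds (hrW hx))).differentiableAt (by simp)
  have hcomp : ∀ x ∈ Metric.ball x₀ r, ∀ j h,
      fderiv ℝ (fun y => ψ y j) x h = ∑ i, (h.1 * S x i j + h.2 * T x i j) • ψ x i := by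
    intro x hx j h
    have h1 : fderiv ℝ (fun y => ψ y j) x h = fderiv ℝ ψ x h j := by
      rw [((hasFDerivAt_pi'.1 (hψd x hx).hasFDerivAt) j).fderiv]; rfl
    rw [h1, hd x (hrW hx), systemForm_apply]
  refine ⟨Metric.ball x₀ r, hrW.trans hWU, Metric.isOpen_ball,
    (convex_ball x₀ r).isPreconnected, Metric.mem_ball_self hr, fun j y => ψ y j,
    fun j => ?_, fun j => congrFun hψ0 j, fun x hx j => ⟨?_, ?_⟩⟩
  · exact (contDiffOn_pi.1 hψ j).mono hrW
  · unfold dU; rw [hcomp x hx]; simp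
  · unfold dV; rw [hcomp x hx]; simp

/-- Uniqueness for a system `dψ = ψ (S du + T dv)`. -/
theorem linearSystem_eq_zero (hU : IsOpen U) (hconn : IsPreconnected U)
    (hS : ∀ i j, ContDiffOn ℝ ∞ (fun y => S y i j) U)
    (hT : ∀ i j, ContDiffOn ℝ ∞ (fun y => T y i j) U) {ψ : ι → ℝ × ℝ → G}
    (hψ : ∀ j, ContDiffOn ℝ ∞ (ψ j) U)
    (hd : ∀ x ∈ U, ∀ j, dU (ψ j) x = ∑ i, S x i j • ψ i x ∧ dV (ψ j) x = ∑ i, T x i j • ψ i x)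
    (hx : x₀ ∈ U) (h0 : ∀ j, ψ j x₀ = 0) : ∀ x ∈ U, ∀ j, ψ j x = 0 := by
  have hdiff : ∀ x ∈ U, ∀ j, DifferentiableAt ℝ (ψ j) x := fun x hx j =>
    differentiableAt_of_smooth (hψ j) hU hx
  have key := flat_section_eq_zero (A := systemForm G S T) (ψ := fun y j => ψ j y) hU hconn
    (contDiffOn_systemForm hS hT).continuousOn
    (fun x hx => differentiableAt_pi.2 (hdiff x hx)) (fun x hx h => by
      ext j
      have h1 : fderiv ℝ (fun y j => ψ j y) x h j = fderiv ℝ (ψ j) x h := by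
        rw [(hasFDerivAt_pi.2 fun j => (hdiff x hx j).hasFDerivAt).fderiv]; rfl
      have h2 : h = h.1 • ((1, 0) : ℝ × ℝ) + h.2 • ((0, 1) : ℝ × ℝ) := by ext <;> simp
      have h3 : fderiv ℝ (ψ j) x h = h.1 • dU (ψ j) x + h.2 • dV (ψ j) x := by
        conv_lhs => rw [h2]
        rw [map_add, map_smul, map_smul]; rfl
      rw [h1, h3, (hd x hx j).1, (hd x hx j).2, systemForm_apply, Finset.smul_sum,
        Finset.smul_sum, ← Finset.sum_add_distrib]
      exact Finset.sum_congr rfl fun i _ => by rw [smul_smul, smul_smul, add_smul])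
    hx (funext h0)
  exact fun x hx j => congrFun (key x hx) j

end LinearSystem

/-! ### Integrability of the explicit data -/

section Explicit

variable {L ε : ℝ} {lam : ℝ × ℝ → ℝ} {C : Coeffs} {U : Set (ℝ × ℝ)} {x : ℝ × ℝ}

/-- The explicit formulas with `Q_±` eliminated: with `p = P_+`, `q = P_-`, the connection
coefficients `μ_k` are the derivatives of `(q - p) / 2`, and `α_k`, `β_k` are combinations of `e ^ p`
and `e ^ q` with constant coefficients. -/
theorem AreExplicitOn.exists_reduced (hA : AreExplicitOn ε lam C U) (hU : IsOpen U) :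
    ∃ (p q : ℝ × ℝ → ℝ) (c a₁ a₂ b₁ b₂ : ℝ), ContDiffOn ℝ ∞ p U ∧ ContDiffOn ℝ ∞ q U ∧
      4 * (a₁ * b₁ - a₂ * b₂) = ε * Real.exp c ∧ a₁ * b₂ = a₂ * b₁ ∧
      ∀ x ∈ U, lam x = -(p x + q x + c) / 2 ∧
      C.μ₁ x = (dU q x - dU p x) / 2 ∧ C.μ₂ x = (dV q x - dV p x) / 2 ∧
      C.α₁ x = a₁ * Real.exp (p x) + b₁ * Real.exp (q x) ∧
      C.α₂ x = a₂ * Real.exp (p x) + b₂ * Real.exp (q x) ∧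
      C.β₁ x = a₁ * Real.exp (p x) - b₁ * Real.exp (q x) ∧
      C.β₂ x = a₂ * Real.exp (p x) - b₂ * Real.exp (q x) := by
  obtain ⟨Pp, Pm, Qp, Qm, c, εp, εm, ⟨sPp, sPm, sQp, sQm⟩, hεp, hεm, hR, hμ, hX⟩ := hA
  have hp2 : εp ^ 2 = 1 := by rcases hεp with rfl | rfl <;> norm_num
  have hm2 : εm ^ 2 = 1 := by rcases hεm with rfl | rfl <;> norm_num
  refine ⟨Pp, Pm, c, (εp + ε * εm * Real.exp c) / 4, (εp - ε * εm * Real.exp c) / 4,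
    (εm + ε * εp * Real.exp c) / 4, (εm - ε * εp * Real.exp c) / 4, sPp, sPm,
    by linear_combination ε * Real.exp c / 2 * (hp2 + hm2),
    by linear_combination ε * Real.exp c / 8 * (hm2 - hp2), fun x hx => ?_⟩
  obtain ⟨r1, -, r3, r4⟩ := hR x hx
  obtain ⟨m1, m2⟩ := hμ x hx
  obtain ⟨Xp, Xm, Yp, Ym, hXp, hXm, hYp, hYm, a1, a2, b1, b2⟩ := hX x hx
  have dp := differentiableAt_of_smooth sPp hU hx
  have dm := differentiableAt_of_smooth sPm hU hx
  have e1 : ∀ w, dd w (fun y => Pp y - Pm y) x = dd w Pp x - dd w Pm x := fun w => dd_sub dp dm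
  have e2 : ∀ w, dd w (fun y => Qp y - Qm y) x = dd w Pm x - dd w Pp x := fun w => by
    rw [dd_congr_on hU (g := fun y => Pm y - Pp y) (fun y hy => ?_) hx, dd_sub dm dp]
    obtain ⟨-, -, r3, r4⟩ := hR y hy
    rw [r3, r4]; ring
  have hs : Real.sqrt 2 * Real.sqrt 2 = 2 := Real.mul_self_sqrt (by norm_num)
  have hs0 : Real.sqrt 2 ≠ 0 := by positivity
  simp only [dS, dT, dU_eq_dd, dV_eq_dd, e1, e2] at m1 m2
  have hdiv : ∀ z : ℝ, 1 / (2 * Real.sqrt 2) * z = z * Real.sqrt 2 / 4 := fun z => by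
    field_simp; linear_combination (-2 * z) * hs
  have exp_add' : ∀ a : ℝ, Real.exp (a + c) = Real.exp c * Real.exp a := fun a => by
    rw [Real.exp_add, mul_comm]
  simp only [r3, r4, exp_add'] at hXp hXm hYp hYm
  simp only [dU_eq_dd, dV_eq_dd]
  refine ⟨by linarith, ?_, ?_, ?_, ?_, ?_, ?_⟩
  · rw [m1]; field_simp; linear_combination (dd (1, 0) Pp x - dd (1, 0) Pm x) * hs
  · rw [m2]; field_simp; linear_combination (dd (0, 1) Pp x - dd (0, 1) Pm x) * hs
  · rw [a1, hXp, hXm]; ring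
  · rw [a2, hYp, hYm]; ring
  · rw [b1, hYp, hYm]; ring
  · rw [b2, hXp, hXm]; ring

/-- The functions `α_k`, `β_k`, `μ_k` of the explicit formulas are smooth. -/
theorem AreExplicitOn.smooth (hA : AreExplicitOn ε lam C U) (hU : IsOpen U) :
    (ContDiffOn ℝ ∞ C.α₁ U ∧ ContDiffOn ℝ ∞ C.α₂ U) ∧ (ContDiffOn ℝ ∞ C.β₁ U ∧
      ContDiffOn ℝ ∞ C.β₂ U) ∧ ContDiffOn ℝ ∞ C.μ₁ U ∧ ContDiffOn ℝ ∞ C.μ₂ U := by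
  obtain ⟨p, q, c, a₁, a₂, b₁, b₂, sp, sq, -, -, h⟩ := hA.exists_reduced hU
  have hexp : ∀ a b : ℝ, ContDiffOn ℝ ∞ (fun x => a * Real.exp (p x) + b * Real.exp (q x)) U :=
    fun a b => (contDiffOn_const.mul sp.exp).add (contDiffOn_const.mul sq.exp)
  have hd : ∀ w, ContDiffOn ℝ ∞ (fun x => (dd w q x - dd w p x) / 2) U := fun w =>
    ((contDiffOn_dd sq hU).sub (contDiffOn_dd sp hU)).div_const 2
  refine ⟨⟨(hexp a₁ b₁).congr fun x hx => (h x hx).2.2.2.1,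
    (hexp a₂ b₂).congr fun x hx => (h x hx).2.2.2.2.1⟩,
    ⟨(hexp a₁ (-b₁)).congr fun x hx => ?_, (hexp a₂ (-b₂)).congr fun x hx => ?_⟩,
    (hd (1, 0)).congr fun x hx => (h x hx).2.1, (hd (0, 1)).congr fun x hx => (h x hx).2.2.1⟩
  · rw [(h x hx).2.2.2.2.2.1]; ring
  · rw [(h x hx).2.2.2.2.2.2]; ring

/-- The equations of Codazzi, Ricci and Gauss for the coefficients of a surface with zero mean
curvature vector. -/
structure SatisfiesCompatibility (L : ℝ) (lam : ℝ × ℝ → ℝ) (C : Coeffs) (x : ℝ × ℝ) : Prop where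
  gauss : dU (dU lam) x - dV (dV lam) x =
    C.α₁ x ^ 2 - C.α₂ x ^ 2 - C.β₁ x ^ 2 + C.β₂ x ^ 2 - L * Real.exp (2 * lam x)
  codazzi_α : dV C.α₁ x - dU C.α₂ x + dV lam x * C.α₁ x - dU lam x * C.α₂ x
    + C.β₁ x * C.μ₂ x - C.β₂ x * C.μ₁ x = 0
  codazzi_α' : dU C.α₁ x - dV C.α₂ x + dU lam x * C.α₁ x - dV lam x * C.α₂ x
    + C.β₁ x * C.μ₁ x - C.β₂ x * C.μ₂ x = 0
  codazzi_β : dV C.β₁ x - dU C.β₂ x + dV lam x * C.β₁ x - dU lam x * C.β₂ x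
    + C.α₁ x * C.μ₂ x - C.α₂ x * C.μ₁ x = 0
  codazzi_β' : dU C.β₁ x - dV C.β₂ x + dU lam x * C.β₁ x - dV lam x * C.β₂ x
    + C.α₁ x * C.μ₁ x - C.α₂ x * C.μ₂ x = 0
  ricci : dU C.μ₂ x - dV C.μ₁ x + 2 * (C.α₁ x * C.β₂ x - C.α₂ x * C.β₁ x) = 0

/-- The explicit data satisfy the equations of Gauss, Codazzi and Ricci. -/
theorem AreExplicitOn.satisfiesCompatibility (hA : AreExplicitOn ε lam C U) (hU : IsOpen U)
    (hs : SolvesEquationOn L ε lam U) (hx : x ∈ U) : SatisfiesCompatibility L lam C x := by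
  obtain ⟨p, q, c, a₁, a₂, b₁, b₂, sp, sq, hab, hab', h⟩ := hA.exists_reduced hU
  have dp := differentiableAt_of_smooth sp hU hx
  have dq := differentiableAt_of_smooth sq hU hx
  have hexp : ∀ (w : ℝ × ℝ) (a b : ℝ), dd w (fun y => a * Real.exp (p y) + b * Real.exp (q y)) x
      = a * (Real.exp (p x) * dd w p x) + b * (Real.exp (q x) * dd w q x) := fun w a b => by
    rw [dd_add (dp.exp.const_mul a) (dq.exp.const_mul b), dd_const_mul a dp.exp,
      dd_const_mul b dq.exp, dd_exp dp, dd_exp dq]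
  have dα₁ : ∀ w, dd w C.α₁ x = _ := fun w =>
    (dd_congr_on hU (fun y hy => (h y hy).2.2.2.1) hx).trans (hexp w a₁ b₁)
  have dα₂ : ∀ w, dd w C.α₂ x = _ := fun w =>
    (dd_congr_on hU (fun y hy => (h y hy).2.2.2.2.1) hx).trans (hexp w a₂ b₂)
  have dβ₁ : ∀ w, dd w C.β₁ x = _ := fun w =>
    (dd_congr_on hU (fun y hy => by rw [(h y hy).2.2.2.2.2.1]; ring) hx).trans (hexp w a₁ (-b₁))
  have dβ₂ : ∀ w, dd w C.β₂ x = _ := fun w =>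
    (dd_congr_on hU (fun y hy => by rw [(h y hy).2.2.2.2.2.2]; ring) hx).trans (hexp w a₂ (-b₂))
  have dlam : ∀ w, dd w lam x = -(1 / 2) * (dd w p x + dd w q x) := fun w => by
    rw [dd_congr_on hU (g := fun y => -(1 / 2) * (p y + q y + c)) (fun y hy => ?_) hx,
      dd_const_mul _ ((dp.fun_add dq).add_const c), dd_add (dp.fun_add dq) (differentiableAt_const c),
      dd_const, dd_add dp dq, add_zero]
    rw [(h y hy).1]; ring
  have dμ : ∀ w w', dd w (fun y => (dd w' q y - dd w' p y) / 2) x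
      = (1 / 2) * (dd w (dd w' q) x - dd w (dd w' p) x) := fun w w' => by
    have h1 := differentiableAt_of_smooth (contDiffOn_dd (w := w') sp hU) hU hx
    have h2 := differentiableAt_of_smooth (contDiffOn_dd (w := w') sq hU) hU hx
    rw [← dd_sub h2 h1, ← dd_const_mul _ (h2.fun_sub h1)]
    exact dd_congr_on hU (fun y _ => by ring) hx
  have dμ₁ : dV C.μ₁ x = _ := (dd_congr_on hU (fun y hy => (h y hy).2.1) hx).trans (dμ (0, 1) (1, 0))
  have dμ₂ : dU C.μ₂ x = _ :=
    (dd_congr_on hU (fun y hy => (h y hy).2.2.1) hx).trans (dμ (1, 0) (0, 1))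
  have hwed := hA.mul_eq_mul hx
  have hE := hs.2 x hx
  have eq2 : Real.exp (-2 * lam x) = Real.exp c * (Real.exp (p x) * Real.exp (q x)) := by
    rw [(h x hx).1, ← Real.exp_add, ← Real.exp_add]; congr 1; ring
  obtain ⟨-, m1, m2, h1, h2, h3, h4⟩ := h x hx
  constructor
  · rw [hE, eq2, h1, h2, h3, h4]
    linear_combination -(Real.exp (p x) * Real.exp (q x)) * hab
  · simp only [dU_eq_dd, dV_eq_dd, dα₁, dα₂, dlam, m1, m2, h1, h2, h3, h4]; ring
  · simp only [dU_eq_dd, dV_eq_dd, dα₁, dα₂, dlam, m1, m2, h1, h2, h3, h4]; ring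
  · simp only [dU_eq_dd, dV_eq_dd, dβ₁, dβ₂, dlam, m1, m2, h1, h2, h3, h4]; ring
  · simp only [dU_eq_dd, dV_eq_dd, dβ₁, dβ₂, dlam, m1, m2, h1, h2, h3, h4]; ring
  · rw [dμ₁, dμ₂, dd_comm (w := (1, 0)) sq hU hx, dd_comm (w := (1, 0)) sp hU hx]
    linear_combination 2 * hwed

/-- The integrability condition of the moving frame equations. -/
theorem matS_matT_compatible (hU : IsOpen U) (hlam : ContDiffOn ℝ ∞ lam U)
    (h : SatisfiesCompatibility L lam C x) (hx : x ∈ U) (i j : Fin 5) :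
    dU (fun y => matT L lam C y i j) x + (matS L lam C x * matT L lam C x) i j =
      dV (fun y => matS L lam C y i j) x + (matT L lam C x * matS L lam C x) i j := by
  have dl := differentiableAt_of_smooth hlam hU hx
  have hcomm : dU (dV lam) x = dV (dU lam) x := dd_comm hlam hU hx
  have hneg : ∀ (w : ℝ × ℝ) (g : ℝ × ℝ → ℝ), dd w (fun y => -g y) x = -dd w g x := fun w g => by
    unfold dd; rw [fderiv_fun_neg]; rfl
  have hEL : ∀ (w : ℝ × ℝ) (k : ℝ), dd w (fun y => k * Real.exp (2 * lam y)) x =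
      k * (2 * (Real.exp (2 * lam x) * dd w lam x)) := fun w k => by
    rw [dd_const_mul k (dl.const_mul 2).exp, dd_exp_two_mul w hU hlam hx]
  have hU' : ∀ g : ℝ × ℝ → ℝ, dd (1, 0) g = dU g := fun _ => rfl
  have hV' : ∀ g : ℝ × ℝ → ℝ, dd (0, 1) g = dV g := fun _ => rfl
  obtain ⟨g, c1, c2, c3, c4, r⟩ := h
  rw [dU_eq_dd, dV_eq_dd]
  fin_cases i <;> fin_cases j <;>
    simp only [matS, matT, Matrix.mul_apply, Fin.sum_univ_five, Matrix.of_apply, Matrix.cons_val,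
      hneg, hEL, dd_const, hU', hV', Fin.mk_one, Fin.zero_eta, Fin.reduceFinMk] <;>
    first
    | ring1
    | linear_combination hcomm
    | linear_combination g
    | linear_combination c1
    | linear_combination c2
    | linear_combination c3
    | linear_combination c4
    | linear_combination r
    | linear_combination -c1
    | linear_combination -c2
    | linear_combination -c3
    | linear_combination -c4

end Explicit

/-! ### Surfaces with prescribed explicit data: existence -/

section Existence

variable {L ε : ℝ} {lam : ℝ × ℝ → ℝ} {C : Coeffs} {U : Set (ℝ × ℝ)} {x x₀ : ℝ × ℝ}

/-- If vector functions satisfy a linear system, and a matrix function `G` satisfies the system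
that it induces for their Gram matrix, then `G` is the Gram matrix as soon as it is at one point. -/
theorem form_eq_of_linearSystem {ι : Type*} [Fintype ι] [DecidableEq ι]
    {S T G : ℝ × ℝ → Matrix ι ι ℝ} {χ : ι → ℝ × ℝ → Amb L} (hU : IsOpen U)
    (hconn : IsPreconnected U) (hS : ∀ i j, ContDiffOn ℝ ∞ (fun y => S y i j) U)
    (hT : ∀ i j, ContDiffOn ℝ ∞ (fun y => T y i j) U)
    (hG : ∀ i j, ContDiffOn ℝ ∞ (fun y => G y i j) U) (hχ : ∀ j, ContDiffOn ℝ ∞ (χ j) U)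
    (hd : ∀ x ∈ U, ∀ j, dU (χ j) x = ∑ i, S x i j • χ i x ∧ dV (χ j) x = ∑ i, T x i j • χ i x)
    (hdG : ∀ x ∈ U, ∀ i j,
      dU (fun y => G y i j) x = ((S x).transpose * G x) i j + (G x * S x) i j ∧
      dV (fun y => G y i j) x = ((T x).transpose * G x) i j + (G x * T x) i j)
    (hx : x₀ ∈ U) (h0 : ∀ i j, form L (χ i x₀) (χ j x₀) = G x₀ i j) :
    ∀ x ∈ U, ∀ i j, form L (χ i x) (χ j x) = G x i j := by
  -- the matrix of the induced system on functions with two indices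
  set ind : (ℝ × ℝ → Matrix ι ι ℝ) → ℝ × ℝ → Matrix (ι × ι) (ι × ι) ℝ := fun A y =>
    Matrix.of fun a b => A y a.1 b.1 * (1 : Matrix ι ι ℝ) a.2 b.2
      + (1 : Matrix ι ι ℝ) a.1 b.1 * A y a.2 b.2 with hind
  have hsm : ∀ A : ℝ × ℝ → Matrix ι ι ℝ, (∀ i j, ContDiffOn ℝ ∞ (fun y => A y i j) U) →
      ∀ a b, ContDiffOn ℝ ∞ (fun y => ind A y a b) U := fun A hA a b =>
    ((hA _ _).mul contDiffOn_const).add (contDiffOn_const.mul (hA _ _))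
  have hsum : ∀ (A : ℝ × ℝ → Matrix ι ι ℝ) (D : Matrix ι ι ℝ) (x : ℝ × ℝ) (b : ι × ι),
      ∑ a : ι × ι, ind A x a b • D a.1 a.2
        = ((A x).transpose * D) b.1 b.2 + (D * A x) b.1 b.2 := fun A D x b => by
    simp only [hind, Matrix.of_apply, smul_eq_mul, add_mul, Finset.sum_add_distrib,
      Fintype.sum_prod_type, Matrix.mul_apply, Matrix.transpose_apply, Matrix.one_apply]
    congr 1
    · refine Finset.sum_congr rfl fun i _ => ?_
      simp
    · rw [Finset.sum_comm]
      refine Finset.sum_congr rfl fun j _ => ?_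
      simp [mul_comm]
  have key := linearSystem_eq_zero (S := ind S) (T := ind T) (G := ℝ)
    (ψ := fun a y => form L (χ a.1 y) (χ a.2 y) - G y a.1 a.2) hU hconn (hsm S hS) (hsm T hT)
    (fun a => (contDiffOn_form (hχ _) (hχ _)).sub (hG _ _)) (fun x hx b => by
      have hχd := fun j => differentiableAt_of_smooth (hχ j) hU hx
      have hf := differentiableAt_of_smooth (contDiffOn_form (L := L) (hχ b.1) (hχ b.2)) hU hx
      have hg := differentiableAt_of_smooth (hG b.1 b.2) hU hx
      have hgram : ∀ A : ℝ × ℝ → Matrix ι ι ℝ,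
          form L (∑ i, A x i b.1 • χ i x) (χ b.2 x) + form L (χ b.1 x) (∑ i, A x i b.2 • χ i x)
            = ∑ a : ι × ι, ind A x a b • form L (χ a.1 x) (χ a.2 x) := fun A => by
        have := hsum A (Matrix.of fun i j => form L (χ i x) (χ j x)) x b
        simp only [Matrix.of_apply] at this
        rw [this, form_sum_left, form_sum_right]
        simp only [form_smul_left, form_smul_right, Matrix.mul_apply, Matrix.transpose_apply,
          Matrix.of_apply]
        congr 1
        exact Finset.sum_congr rfl fun i _ => mul_comm _ _
      simp only [smul_sub, Finset.sum_sub_distrib]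
      constructor
      · rw [dU_eq_dd, dd_sub hf hg, dd_form (hχd _) (hχd _), ← dU_eq_dd, ← dU_eq_dd, ← dU_eq_dd,
          (hd x hx _).1, (hd x hx _).1, (hdG x hx _ _).1, hgram, hsum S (G x)]
      · rw [dV_eq_dd, dd_sub hf hg, dd_form (hχd _) (hχd _), ← dV_eq_dd, ← dV_eq_dd, ← dV_eq_dd,
          (hd x hx _).2, (hd x hx _).2, (hdG x hx _ _).2, hgram, hsum T (G x)])
    hx (fun a => sub_eq_zero.2 (h0 _ _))
  exact fun x hx i j => sub_eq_zero.1 (key x hx (i, j))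

theorem contDiffOn_matS_matT (hU : IsOpen U) (hlam : ContDiffOn ℝ ∞ lam U)
    (hA : AreExplicitOn ε lam C U) (i j : Fin 5) :
    ContDiffOn ℝ ∞ (fun y => matS L lam C y i j) U ∧
      ContDiffOn ℝ ∞ (fun y => matT L lam C y i j) U := by
  obtain ⟨⟨s1, s2⟩, ⟨s3, s4⟩, s5, s6⟩ := hA.smooth hU
  have s7 : ContDiffOn ℝ ∞ (dU lam) U := contDiffOn_dd hlam hU
  have s8 : ContDiffOn ℝ ∞ (dV lam) U := contDiffOn_dd hlam hU
  have s9 : ∀ k : ℝ, ContDiffOn ℝ ∞ (fun y => k * Real.exp (2 * lam y)) U := fun k =>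
    contDiffOn_const.mul (contDiffOn_const.mul hlam).exp
  fin_cases i <;> fin_cases j <;> constructor <;>
    simp only [matS, matT, Matrix.of_apply, Matrix.cons_val, Fin.mk_one, Fin.zero_eta,
      Fin.reduceFinMk] <;>
    first
    | exact contDiffOn_const
    | exact s7
    | exact s8
    | exact s1
    | exact s2
    | exact s3
    | exact s4
    | exact s5
    | exact s6
    | exact s1.neg
    | exact s2.neg
    | exact s3.neg
    | exact s4.neg
    | exact s9 _

/-- The form on multiples of the standard basis vectors. -/
theorem form_single (i j : Fin (ambDim L)) (a b : ℝ) :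
    form L (Pi.single i a) (Pi.single j b) = if i = j then ambSign L i * (a * b) else 0 := by
  unfold form
  rw [Finset.sum_eq_single i (fun k _ hk => by simp [Pi.single_apply, hk]) (by simp)]
  by_cases h : i = j
  · subst h; simp [mul_assoc]
  · simp [h]

/-- There is a point of the space form together with an orthogonal frame of its tangent space with
prescribed norms. -/
theorem exists_isFrameAt (L : ℝ) {E : ℝ} (hE : 0 < E) :
    ∃ a b c d g : Amb L, IsFrameAt L E a b c d g := by
  have hdim : 4 ≤ ambDim L := by unfold ambDim; split_ifs <;> omega
  have hs : Real.sqrt E * Real.sqrt E = E := Real.mul_self_sqrt hE.le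
  have hsign : ∀ i (hi : i < ambDim L), ambSign L ⟨i, hi⟩ =
      if i < 2 then 1 else if i < 4 then -1 else if 0 < L then 1 else -1 := fun i hi => rfl
  have main : ∀ g : Amb L, (∀ i (hi : i < ambDim L), i < 4 →
      form L (Pi.single ⟨i, hi⟩ (Real.sqrt E)) g = 0) → L * (L * form L g g) = L →
      ∃ a b c d g : Amb L, IsFrameAt L E a b c d g := fun g hg hgg =>
    ⟨Pi.single ⟨0, by omega⟩ (Real.sqrt E), Pi.single ⟨2, by omega⟩ (Real.sqrt E),
      Pi.single ⟨1, by omega⟩ (Real.sqrt E), Pi.single ⟨3, by omega⟩ (Real.sqrt E), g,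
      { pos := hE
        aa := by rw [form_single]; simp [hsign, hs]
        bb := by rw [form_single]; simp [hsign, hs]
        cc := by rw [form_single]; simp [hsign, hs]
        dd := by rw [form_single]; simp [hsign, hs]
        ab := by rw [form_single]; simp
        ac := by rw [form_single]; simp
        ad := by rw [form_single]; simp
        bc := by rw [form_single]; simp
        bd := by rw [form_single]; simp
        cd := by rw [form_single]; simp
        ag := by rw [hg _ _ (by norm_num), mul_zero]
        bg := by rw [hg _ _ (by norm_num), mul_zero]
        cg := by rw [hg _ _ (by norm_num), mul_zero]
        dg := by rw [hg _ _ (by norm_num), mul_zero]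
        gg := hgg }⟩
  by_cases hL : L = 0
  · exact main 0 (fun i hi _ => form_zero_right _) (by rw [hL, zero_mul])
  · have hd5 : 4 < ambDim L := by unfold ambDim; rw [if_neg hL]; norm_num
    refine main (Pi.single ⟨4, hd5⟩ (1 / Real.sqrt |L|)) (fun i hi h4 => ?_) ?_
    · rw [form_single, if_neg]
      rw [Fin.mk.injEq]; omega
    · rw [form_single, if_pos rfl, hsign]
      have hs' : Real.sqrt |L| * Real.sqrt |L| = |L| := Real.mul_self_sqrt (abs_nonneg L)
      have h0 : |L| ≠ 0 := abs_ne_zero.2 hL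
      rw [div_mul_div_comm, hs', one_mul]
      rcases lt_or_gt_of_ne hL with h | h
      · simp only [show ¬ (4 : ℕ) < 2 by norm_num, show ¬ (4 : ℕ) < 4 by norm_num,
          not_lt.2 h.le, if_false, abs_of_neg h]
        field_simp
      · simp only [show ¬ (4 : ℕ) < 2 by norm_num, show ¬ (4 : ℕ) < 4 by norm_num, h, if_true,
          if_false, abs_of_pos h]
        field_simp

/-- The matrix `S` for the moving frame `(T₁, T₂, N₁, N₂, L F)`. -/
def rescaledS (L : ℝ) (lam : ℝ × ℝ → ℝ) (C : Coeffs) (x : ℝ × ℝ) : Matrix (Fin 5) (Fin 5) ℝ :=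
  !![dU lam x, dV lam x, -C.α₁ x, C.β₁ x, L;
     dV lam x, dU lam x, C.α₂ x, -C.β₂ x, 0;
     C.α₁ x, C.α₂ x, dU lam x, C.μ₁ x, 0;
     C.β₁ x, C.β₂ x, C.μ₁ x, dU lam x, 0;
     -Real.exp (2 * lam x), 0, 0, 0, 0]

/-- The matrix `T` for the moving frame `(T₁, T₂, N₁, N₂, L F)`. -/
def rescaledT (L : ℝ) (lam : ℝ × ℝ → ℝ) (C : Coeffs) (x : ℝ × ℝ) : Matrix (Fin 5) (Fin 5) ℝ :=
  !![dV lam x, dU lam x, -C.α₂ x, C.β₂ x, 0;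
     dU lam x, dV lam x, C.α₁ x, -C.β₁ x, L;
     C.α₂ x, C.α₁ x, dV lam x, C.μ₂ x, 0;
     C.β₂ x, C.β₁ x, C.μ₂ x, dV lam x, 0;
     0, Real.exp (2 * lam x), 0, 0, 0]

/-- The Gram matrix of the moving frame `(T₁, T₂, N₁, N₂, L F)`. The last vector is scaled by `L`
because the flat case puts no condition on `F`. -/
def gramMatrix (L : ℝ) (lam : ℝ × ℝ → ℝ) (x : ℝ × ℝ) : Matrix (Fin 5) (Fin 5) ℝ :=
  !![Real.exp (2 * lam x), 0, 0, 0, 0; 0, -Real.exp (2 * lam x), 0, 0, 0;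
     0, 0, Real.exp (2 * lam x), 0, 0; 0, 0, 0, -Real.exp (2 * lam x), 0; 0, 0, 0, 0, L]

theorem contDiffOn_rescaled (hU : IsOpen U) (hlam : ContDiffOn ℝ ∞ lam U)
    (hA : AreExplicitOn ε lam C U) (i j : Fin 5) :
    ContDiffOn ℝ ∞ (fun y => rescaledS L lam C y i j) U ∧
      ContDiffOn ℝ ∞ (fun y => rescaledT L lam C y i j) U ∧
      ContDiffOn ℝ ∞ (fun y => gramMatrix L lam y i j) U := by
  obtain ⟨⟨s1, s2⟩, ⟨s3, s4⟩, s5, s6⟩ := hA.smooth hU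
  have s7 : ContDiffOn ℝ ∞ (dU lam) U := contDiffOn_dd hlam hU
  have s8 : ContDiffOn ℝ ∞ (dV lam) U := contDiffOn_dd hlam hU
  have s9 : ContDiffOn ℝ ∞ (fun y => Real.exp (2 * lam y)) U :=
    (contDiffOn_const.mul hlam).exp
  fin_cases i <;> fin_cases j <;> refine ⟨?_, ?_, ?_⟩ <;>
    simp only [rescaledS, rescaledT, gramMatrix, Matrix.of_apply, Matrix.cons_val, Fin.mk_one,
      Fin.zero_eta, Fin.reduceFinMk] <;>
    first
    | exact contDiffOn_const
    | exact s7
    | exact s8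
    | exact s1
    | exact s2
    | exact s3
    | exact s4
    | exact s5
    | exact s6
    | exact s1.neg
    | exact s2.neg
    | exact s3.neg
    | exact s4.neg
    | exact s9
    | exact s9.neg

theorem dd_gramMatrix (hU : IsOpen U) (hlam : ContDiffOn ℝ ∞ lam U) (hx : x ∈ U) (i j : Fin 5) :
    dU (fun y => gramMatrix L lam y i j) x =
        ((rescaledS L lam C x).transpose * gramMatrix L lam x) i j
      + (gramMatrix L lam x * rescaledS L lam C x) i j ∧
    dV (fun y => gramMatrix L lam y i j) x =
        ((rescaledT L lam C x).transpose * gramMatrix L lam x) i j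
      + (gramMatrix L lam x * rescaledT L lam C x) i j := by
  have hU' : ∀ g : ℝ × ℝ → ℝ, dd (1, 0) g = dU g := fun _ => rfl
  have hV' : ∀ g : ℝ × ℝ → ℝ, dd (0, 1) g = dV g := fun _ => rfl
  have h1 := fun w => dd_exp_two_mul w hU hlam hx
  have h2 := fun w => dd_neg_exp_two_mul w hU hlam hx
  rw [dU_eq_dd, dV_eq_dd]
  fin_cases i <;> fin_cases j <;> constructor <;>
    simp only [rescaledS, rescaledT, gramMatrix, Matrix.mul_apply, Matrix.transpose_apply,
      Fin.sum_univ_five, Matrix.of_apply, Matrix.cons_val, Fin.mk_one, Fin.zero_eta,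
      Fin.reduceFinMk, h1, h2, dd_const, hU', hV'] <;>
    ring

theorem meanCurvature_eq_of_isConformalAt {f : ℝ × ℝ → Amb L} {E : ℝ} (h : IsConformalAt L f E x) :
    meanCurvature L f x =
      (1 / (2 * E)) • normalPart L f x (dU (dU f) x - dV (dV f) x) := by
  have hE := h.pos.ne'
  unfold meanCurvature secondFF
  rw [h.metric_inv_eq, h.normalPart_sub]
  simp only [Fin.sum_univ_two, Matrix.of_apply, Matrix.cons_val', Matrix.cons_val_zero,
    Matrix.cons_val_one, Matrix.cons_val_fin_one, pd_zero, pd_one, zero_smul, add_zero, zero_add]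
  module

/-- **Existence** of a surface with prescribed explicit data. -/
theorem exists_isSurfaceWithDataOn (hU : IsOpen U) (hs : SolvesEquationOn L ε lam U)
    (hA : AreExplicitOn ε lam C U) (hx : x₀ ∈ U) :
    ∃ W ⊆ U, IsOpen W ∧ x₀ ∈ W ∧ ∃ f, IsSurfaceWithDataOn L lam C f W := by
  obtain ⟨a, b, c, d, g, hF⟩ := exists_isFrameAt L (Real.exp_pos (2 * lam x₀))
  obtain ⟨W, hWU, hW, hconn, hxW, ψ, hψ, hψ0, hd⟩ := exists_linearSystem_solution
    (S := matS L lam C) (T := matT L lam C) hU hx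
    (fun i j => (contDiffOn_matS_matT hU hs.1 hA i j).1)
    (fun i j => (contDiffOn_matS_matT hU hs.1 hA i j).2)
    (fun x hx i j => matS_matT_compatible hU hs.1 (hA.satisfiesCompatibility hU hs hx) hx i j)
    ![a, b, c, d, g]
  have hlamW := hs.1.mono hWU
  have hsm := fun i j => contDiffOn_rescaled (L := L) hU hs.1 hA i j
  have hψd : ∀ x ∈ W, ∀ j, DifferentiableAt ℝ (ψ j) x := fun x hx j =>
    differentiableAt_of_smooth (hψ j) hW hx
  -- the derivatives of the moving frame, written out
  have hdU : ∀ x ∈ W, ∀ j, dU (ψ j) x = matS L lam C x 0 j • ψ 0 x + matS L lam C x 1 j • ψ 1 x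
      + matS L lam C x 2 j • ψ 2 x + matS L lam C x 3 j • ψ 3 x + matS L lam C x 4 j • ψ 4 x :=
    fun x hx j => by rw [(hd x hx j).1, Fin.sum_univ_five]
  have hdV : ∀ x ∈ W, ∀ j, dV (ψ j) x = matT L lam C x 0 j • ψ 0 x + matT L lam C x 1 j • ψ 1 x
      + matT L lam C x 2 j • ψ 2 x + matT L lam C x 3 j • ψ 3 x + matT L lam C x 4 j • ψ 4 x :=
    fun x hx j => by rw [(hd x hx j).2, Fin.sum_univ_five]
  have hgram := form_eq_of_linearSystem (L := L) (S := rescaledS L lam C) (T := rescaledT L lam C)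
    (G := gramMatrix L lam) (χ := ![ψ 0, ψ 1, ψ 2, ψ 3, fun y => L • ψ 4 y]) hW hconn
    (fun i j => (hsm i j).1.mono hWU) (fun i j => (hsm i j).2.1.mono hWU)
    (fun i j => (hsm i j).2.2.mono hWU)
    (fun j => by
      fin_cases j
      · exact hψ 0
      · exact hψ 1
      · exact hψ 2
      · exact hψ 3
      · exact (contDiffOn_const (c := L)).smul (hψ 4))
    (fun x hx j => by
      have h4 : ∀ w, dd w (fun y => L • ψ 4 y) x = L • dd w (ψ 4) x := fun w =>
        dd_const_smul L (hψd x hx 4)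
      have h4U : dU (fun y => L • ψ 4 y) x = L • dU (ψ 4) x := h4 _
      have h4V : dV (fun y => L • ψ 4 y) x = L • dV (ψ 4) x := h4 _
      fin_cases j <;>
        simp only [Fin.sum_univ_five, rescaledS, rescaledT, Matrix.of_apply, Matrix.cons_val,
          Fin.mk_one, Fin.zero_eta, Fin.reduceFinMk, h4U, h4V, hdU x hx, hdV x hx, matS, matT] <;>
        constructor <;> module)
    (fun x hx i j => dd_gramMatrix hW hlamW hx i j) hxW
    (fun i j => by
      have e0 := hψ0 0
      have e1 := hψ0 1
      have e2 := hψ0 2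
      have e3 := hψ0 3
      have e4 := hψ0 4
      simp only [Matrix.cons_val] at e0 e1 e2 e3 e4
      fin_cases i <;> fin_cases j <;>
        simp only [gramMatrix, Matrix.of_apply, Matrix.cons_val, Fin.mk_one, Fin.zero_eta,
          Fin.reduceFinMk, e0, e1, e2, e3, e4, form_smul_left, form_smul_right, hF.aa, hF.bb,
          hF.cc, hF.dd, hF.ab, hF.ac, hF.ad, hF.bc, hF.bd, hF.cd, hF.ag, hF.bg, hF.cg, hF.dg,
          hF.gg, hF.ba, hF.ca, hF.da, hF.cb, hF.db, hF.dc, hF.ga, hF.gb, hF.gc, hF.gd])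
  have hfr : ∀ x ∈ W,
      IsFrameAt L (Real.exp (2 * lam x)) (ψ 0 x) (ψ 1 x) (ψ 2 x) (ψ 3 x) (ψ 4 x) := fun x hx => by
    have hg := hgram x hx
    refine
      { pos := Real.exp_pos _
        aa := hg 0 0
        bb := hg 1 1
        cc := hg 2 2
        dd := hg 3 3
        ab := hg 0 1
        ac := hg 0 2
        ad := hg 0 3
        bc := hg 1 2
        bd := hg 1 3
        cd := hg 2 3
        ag := (form_smul_right _ _ _).symm.trans (hg 0 4)
        bg := (form_smul_right _ _ _).symm.trans (hg 1 4)
        cg := (form_smul_right _ _ _).symm.trans (hg 2 4)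
        dg := (form_smul_right _ _ _).symm.trans (hg 3 4)
        gg := ?_ }
    rw [← form_smul_right, ← form_smul_left]
    exact hg 4 4
  have hf0 : ∀ x ∈ W, dU (ψ 4) x = ψ 0 x := fun x hx => by simp [hdU x hx, matS]
  have hf1 : ∀ x ∈ W, dV (ψ 4) x = ψ 1 x := fun x hx => by simp [hdV x hx, matT]
  have hframe : ∀ x ∈ W, ∀ j, frame L (ψ 4) (ψ 2) (ψ 3) j x = ψ j x := fun x hx j => by
    fin_cases j
    · exact hf0 x hx
    · exact hf1 x hx
    all_goals rfl
  have hconf : ∀ x ∈ W, IsConformalAt L (ψ 4) (Real.exp (2 * lam x)) x := fun x hx => by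
    have h := hfr x hx
    refine ⟨h.pos, ?_, ?_, ?_, ?_, ?_, h.gg⟩ <;> simp only [hf0 x hx, hf1 x hx] <;>
      first
      | exact h.aa
      | exact h.bb
      | exact h.ab
      | exact h.ag
      | exact h.bg
  unfold IsSurfaceWithDataOn
  refine ⟨W, hWU, hW, hxW, ψ 4, ⟨hψ 4, fun x hx hL => ?_, fun x hx => ?_, fun x hx => ?_,
    fun x hx => ?_⟩, fun x hx => ?_, ψ 2, ψ 3, ⟨⟨hψ 2, fun x hx hL => ?_, fun x hx => ?_⟩,
    ⟨hψ 3, fun x hx hL => ?_, fun x hx => ?_⟩, fun x hx => ?_⟩, fun x hx j => ?_⟩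
  · have := (hfr x hx).gg
    field_simp
    exact mul_left_cancel₀ hL (by linear_combination this)
  · rw [(hconf x hx).form_UU]; exact Real.exp_pos _
  · rw [(hconf x hx).form_UU]
    exact ⟨(hconf x hx).form_VV, (hconf x hx).form_UV⟩
  · have e1 : dU (dU (ψ 4)) x = dU (ψ 0) x := dd_congr_on hW hf0 hx
    have e2 : dV (dV (ψ 4)) x = dV (ψ 1) x := dd_congr_on hW hf1 hx
    have e3 : dU (ψ 0) x - dV (ψ 1) x = (-2 * Real.exp (2 * lam x)) • (L • ψ 4 x) := by
      rw [hdU x hx, hdV x hx]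
      simp only [matS, matT, Matrix.of_apply, Matrix.cons_val]
      module
    rw [meanCurvature_eq_of_isConformalAt (hconf x hx), e1, e2, e3, (hconf x hx).normalPart_smul,
      (hconf x hx).normalPart_smul_self, smul_zero, smul_zero]
  · exact ⟨(hconf x hx).form_UU, (hconf x hx).form_VV, (hconf x hx).form_UV⟩
  · exact (mul_eq_zero.1 (hfr x hx).cg).resolve_left hL
  · rw [hf0 x hx, hf1 x hx]; exact ⟨(hfr x hx).ca, (hfr x hx).cb⟩
  · exact (mul_eq_zero.1 (hfr x hx).dg).resolve_left hL
  · rw [hf0 x hx, hf1 x hx]; exact ⟨(hfr x hx).da, (hfr x hx).db⟩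
  · exact ⟨(hfr x hx).cc, (hfr x hx).dd, (hfr x hx).cd⟩
  · have e : ∀ w, dd w (frame L (ψ 4) (ψ 2) (ψ 3) j) x = dd w (ψ j) x := fun w =>
      dd_congr_on hW (fun y hy => hframe y hy j) hx
    simp only [hframe x hx]
    exact ⟨(e (1, 0)).trans (hd x hx j).1, (e (0, 1)).trans (hd x hx j).2⟩

/-- A surface with explicit data has curvature different from that of the space form, and a flat
normal connection. -/
theorem IsSurfaceWithDataOn.curvature_ne_and_flat {f : ℝ × ℝ → Amb L} {W : Set (ℝ × ℝ)}
    (h : IsSurfaceWithDataOn L lam C f W) (hW : IsOpen W) (hε : ε = 1 ∨ ε = -1)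
    (hs : SolvesEquationOn L ε lam W) (hA : AreExplicitOn ε lam C W) :
    (∀ x ∈ W, curvature (metric L f) x ≠ L) ∧ HasFlatNormalConnectionOn L f W := by
  obtain ⟨hf, hc, N₁, N₂, hN, hC⟩ := h
  refine ⟨fun x hx => ?_, (hf.flat_iff hW).2 fun x hx => ?_⟩
  · rw [hf.curvature_ne_iff hW hx, hf.form_sff_of_solves hW hc hs hx]
    rcases hε with rfl | rfl <;> norm_num
  · exact (hC.hasProportionalSff_iff hf hW hN hx).2 (hA.mul_eq_mul hx)

end Existence

/-! ### Surfaces with prescribed explicit data: uniqueness -/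

section Uniqueness

variable {L E : ℝ} {a b c d g a' b' c' d' g' : Amb L}

/-- The linear map of the ambient space that takes the frame `(a, b, c, d, g)` to the frame
`(a', b', c', d', g')`; in the flat case, where `g` is not part of the frame, only its first four
vectors. -/
def frameMap (L E : ℝ) (a b c d g a' b' c' d' g' : Amb L) : Amb L →L[ℝ] Amb L :=
  (E⁻¹ • (formL L a).smulRight a' - E⁻¹ • (formL L b).smulRight b')
    + (E⁻¹ • (formL L c).smulRight c' - E⁻¹ • (formL L d).smulRight d')
    + L • (formL L g).smulRight g'

theorem frameMap_apply (y : Amb L) : frameMap L E a b c d g a' b' c' d' g' y =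
    (form L y a / E) • a' - (form L y b / E) • b' + (form L y c / E) • c' - (form L y d / E) • d'
      + (L * form L y g) • g' := by
  simp only [frameMap, add_apply, sub_apply, smul_apply, ContinuousLinearMap.smulRight_apply,
    formL_apply, form_comm y]
  module

namespace IsFrameAt

theorem form_eq (h : IsFrameAt L E a b c d g) (y w : Amb L) :
    form L y w = form L y a * form L w a / E - form L y b * form L w b / E
      + form L y c * form L w c / E - form L y d * form L w d / E
      + L * form L y g * form L w g := by
  conv_lhs => rw [h.expand y]
  simp only [form_add_left, form_smul_left]
  rw [form_comm a w, form_comm b w, form_comm c w, form_comm d w, form_comm g w]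
  ring

/-- The products of the image with the second frame are those of the vector with the first one. -/
theorem form_frameMap (h' : IsFrameAt L E a' b' c' d' g') (y : Amb L) :
    (form L (frameMap L E a b c d g a' b' c' d' g' y) a' = form L y a ∧
      form L (frameMap L E a b c d g a' b' c' d' g' y) b' = form L y b) ∧
    (form L (frameMap L E a b c d g a' b' c' d' g' y) c' = form L y c ∧
      form L (frameMap L E a b c d g a' b' c' d' g' y) d' = form L y d) ∧
    L * form L (frameMap L E a b c d g a' b' c' d' g' y) g' = L * form L y g := by
  have hE := h'.pos.ne'
  have ga := h'.ga
  have gb := h'.gb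
  have gc := h'.gc
  have gd := h'.gd
  have ag := h'.ag
  have bg := h'.bg
  have cg := h'.cg
  have dg := h'.dg
  have gg := h'.gg
  simp only [frameMap_apply, form_add_left, form_sub_left, form_smul_left, h'.aa, h'.bb, h'.cc,
    h'.dd, h'.ab, h'.ac, h'.ad, h'.bc, h'.bd, h'.cd, h'.ba, h'.ca, h'.da, h'.cb, h'.db, h'.dc]
  refine ⟨⟨?_, ?_⟩, ⟨?_, ?_⟩, ?_⟩
  · field_simp
    linear_combination form L y g * E * ga
  · field_simp
    linear_combination form L y g * E * gb
  · field_simp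
    linear_combination form L y g * E * gc
  · field_simp
    linear_combination form L y g * E * gd
  · linear_combination form L y a / E * ag - form L y b / E * bg + form L y c / E * cg
      - form L y d / E * dg + form L y g * gg

/-- The map between two frames with the same norms preserves the form. -/
theorem form_frameMap_frameMap (h : IsFrameAt L E a b c d g) (h' : IsFrameAt L E a' b' c' d' g')
    (y w : Amb L) : form L (frameMap L E a b c d g a' b' c' d' g' y)
      (frameMap L E a b c d g a' b' c' d' g' w) = form L y w := by
  obtain ⟨⟨y1, y2⟩, ⟨y3, y4⟩, y5⟩ := form_frameMap (a := a) (b := b) (c := c) (d := d) (g := g) h' y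
  obtain ⟨⟨w1, w2⟩, ⟨w3, w4⟩, w5⟩ := form_frameMap (a := a) (b := b) (c := c) (d := d) (g := g) h' w
  rw [h'.form_eq, h.form_eq y w, y1, y2, y3, y4, w1, w2, w3, w4, y5]
  linear_combination form L y g * w5

/-- The maps between two frames in the two directions are inverse to each other. -/
theorem frameMap_frameMap (h : IsFrameAt L E a b c d g) (h' : IsFrameAt L E a' b' c' d' g')
    (y : Amb L) : frameMap L E a' b' c' d' g' a b c d g
      (frameMap L E a b c d g a' b' c' d' g' y) = y := by
  obtain ⟨⟨y1, y2⟩, ⟨y3, y4⟩, y5⟩ := form_frameMap (a := a) (b := b) (c := c) (d := d) (g := g) h' y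
  obtain ⟨⟨z1, z2⟩, ⟨z3, z4⟩, z5⟩ := form_frameMap (a := a') (b := b') (c := c') (d := d')
    (g := g') h (frameMap L E a b c d g a' b' c' d' g' y)
  exact h.ext (z1.trans y1) (z2.trans y2) (z3.trans y3) (z4.trans y4) (z5.trans y5)

theorem frameMap_frame (h : IsFrameAt L E a b c d g) :
    (frameMap L E a b c d g a' b' c' d' g' a = a' ∧
      frameMap L E a b c d g a' b' c' d' g' b = b') ∧
    (frameMap L E a b c d g a' b' c' d' g' c = c' ∧
      frameMap L E a b c d g a' b' c' d' g' d = d') ∧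
    L • frameMap L E a b c d g a' b' c' d' g' g = L • g' := by
  have hE := h.pos.ne'
  simp only [frameMap_apply, h.aa, h.bb, h.cc, h.dd, h.ab, h.ac, h.ad, h.bc, h.bd, h.cd, h.ba,
    h.ca, h.da, h.cb, h.db, h.dc, h.ag, h.bg, h.cg, h.dg, neg_div, div_self hE, zero_div,
    smul_add, smul_sub, smul_smul, h.gg, mul_div_assoc', h.ga, h.gb, h.gc, h.gd]
  refine ⟨⟨?_, ?_⟩, ⟨?_, ?_⟩, ?_⟩ <;> module

end IsFrameAt

variable {ε : ℝ} {lam : ℝ × ℝ → ℝ} {C : Coeffs} {U W : Set (ℝ × ℝ)}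

theorem isIsometryOfN_id : IsIsometryOfN L (fun y => y) :=
  ⟨contDiff_id, Set.bijOn_id _, fun x _ w _ w' _ => by rw [fderiv_fun_id]; rfl⟩

/-- An affine bijection with linear part preserving the form is an isometry of the space form,
provided that it is linear unless the space form is flat. -/
theorem isIsometryOfN_affine {A B : Amb L →L[ℝ] Amb L} {t : Amb L}
    (hA : ∀ y w, form L (A y) (A w) = form L y w) (hBA : ∀ y, B (A y) = y)
    (hAB : ∀ y, A (B y) = y) (ht : L • t = 0) : IsIsometryOfN L (fun y => A y + t) := by
  have ht0 : L ≠ 0 → t = 0 := fun hL => (smul_eq_zero.1 ht).resolve_left hL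
  refine ⟨A.contDiff.add contDiff_const, Set.InvOn.bijOn (f' := fun z => B (z - t))
    ⟨fun y _ => ?_, fun z _ => ?_⟩ (fun y hy hL => ?_) (fun z hz hL => ?_),
    fun x _ w _ w' _ => ?_⟩
  · simp [hBA]
  · simp [hAB]
  · simp only [ht0 hL, add_zero]
    rw [hA]; exact hy hL
  · simp only [ht0 hL, sub_zero]
    rw [← hA, hAB]; exact hz hL
  · rw [fderiv_add_const, A.fderiv, hA]

theorem contDiffOn_frame {f N₁ N₂ : ℝ × ℝ → Amb L} (hf : IsZeroMeanOn L f W) (hW : IsOpen W)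
    (hN : IsNormalFrameOn L f lam N₁ N₂ W) (j : Fin 5) : ContDiffOn ℝ ∞ (frame L f N₁ N₂ j) W := by
  fin_cases j
  · exact contDiffOn_dd hf.smooth hW
  · exact contDiffOn_dd hf.smooth hW
  · exact hN.normal₁.smooth
  · exact hN.normal₂.smooth
  · exact hf.smooth

/-- **Uniqueness** of a surface with prescribed explicit data, up to an isometry of the space
form. -/
theorem exists_isometry_of_isSurfaceWithDataOn (hU : IsOpen U) (hlam : ContDiffOn ℝ ∞ lam U)
    (hA : AreExplicitOn ε lam C U) (hWU : W ⊆ U) (hW : IsOpen W) (hconn : IsPreconnected W)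
    {f f' : ℝ × ℝ → Amb L} (hf : IsSurfaceWithDataOn L lam C f W)
    (hf' : IsSurfaceWithDataOn L lam C f' W) :
    ∃ Φ : Amb L → Amb L, IsIsometryOfN L Φ ∧ ∀ x ∈ W, f' x = Φ (f x) := by
  rcases W.eq_empty_or_nonempty with rfl | ⟨x₀, hx₀⟩
  · exact ⟨fun y => y, isIsometryOfN_id, fun x hx => hx.elim⟩
  obtain ⟨hz, hc, N₁, N₂, hN, hC⟩ := hf
  obtain ⟨hz', hc', N₁', N₂', hN', hC'⟩ := hf'
  have h := hN.isFrameAt hz hW hc hx₀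
  have h' := hN'.isFrameAt hz' hW hc' hx₀
  have hmap := h.frameMap_frame (a' := dU f' x₀) (b' := dV f' x₀) (c' := N₁' x₀)
    (d' := N₂' x₀) (g' := f' x₀)
  have hform := h.form_frameMap_frameMap h'
  have hinv := h.frameMap_frameMap h'
  have hinv' := h'.frameMap_frameMap h
  set A := frameMap L (Real.exp (2 * lam x₀)) (dU f x₀) (dV f x₀) (N₁ x₀) (N₂ x₀) (f x₀)
    (dU f' x₀) (dV f' x₀) (N₁' x₀) (N₂' x₀) (f' x₀) with hAdef
  obtain ⟨⟨m1, m2⟩, ⟨m3, m4⟩, m5⟩ := hmap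
  -- the translation part, which vanishes unless the space form is flat
  set t := f' x₀ - A (f x₀) with htdef
  have ht : L • t = 0 := by rw [htdef, smul_sub, m5, sub_self]
  refine ⟨fun y => A y + t, isIsometryOfN_affine hform hinv hinv' ht, ?_⟩
  have hsm := contDiffOn_frame hz hW hN
  have hsm' := contDiffOn_frame hz' hW hN'
  set β : Fin 5 → Amb L := ![0, 0, 0, 0, t] with hβ
  have hkill : ∀ (S : Fin 5 → ℝ) (k : ℝ), S 4 = k * L → ∑ i, S i • β i = 0 := fun S k hk => by
    rw [Fin.sum_univ_five, hk, mul_smul]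
    simp [hβ, ht]
  -- the last rows of `S` and `T` are divisible by `L`, so the translation does not disturb the
  -- linear system
  have hS4 : ∀ x j, ∃ k, matS L lam C x 4 j = k * L := fun x j => by
    fin_cases j
    · exact ⟨-Real.exp (2 * lam x), by simp [matS]; ring⟩
    all_goals exact ⟨0, by simp [matS]⟩
  have hT4 : ∀ x j, ∃ k, matT L lam C x 4 j = k * L := fun x j => by
    fin_cases j
    · exact ⟨0, by simp [matT]⟩
    · exact ⟨Real.exp (2 * lam x), by simp [matT]; ring⟩
    all_goals exact ⟨0, by simp [matT]⟩
  have key := linearSystem_eq_zero (S := matS L lam C) (T := matT L lam C) (x₀ := x₀)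
    (ψ := fun j y => A (frame L f N₁ N₂ j y) - frame L f' N₁' N₂' j y + β j) hW hconn
    (fun i j => (contDiffOn_matS_matT hU hlam hA i j).1.mono hWU)
    (fun i j => (contDiffOn_matS_matT hU hlam hA i j).2.mono hWU)
    (fun j => ((A.contDiff.comp_contDiffOn (hsm j)).sub (hsm' j)).add contDiffOn_const)
    (fun x hx j => by
      have hdd : ∀ w, dd w (fun y => A (frame L f N₁ N₂ j y) - frame L f' N₁' N₂' j y + β j) x
          = A (dd w (frame L f N₁ N₂ j) x) - dd w (frame L f' N₁' N₂' j) x := fun w => by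
        have h1 := (differentiableAt_of_smooth (hsm j) hW hx).hasFDerivAt
        have h2 := (differentiableAt_of_smooth (hsm' j) hW hx).hasFDerivAt
        have h3 : HasFDerivAt (fun y => A (frame L f N₁ N₂ j y)) _ x := A.hasFDerivAt.comp x h1
        unfold dd
        rw [((h3.fun_sub h2).add_const (β j)).fderiv]
        rfl
      have hlin : ∀ S : Fin 5 → ℝ, (∃ k, S 4 = k * L) →
          A (∑ i, S i • frame L f N₁ N₂ i x) - ∑ i, S i • frame L f' N₁' N₂' i x =
          ∑ i, S i • (A (frame L f N₁ N₂ i x) - frame L f' N₁' N₂' i x + β i) := by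
        rintro S ⟨k, hk⟩
        simp only [smul_add, smul_sub, Finset.sum_add_distrib, Finset.sum_sub_distrib,
          hkill S k hk, map_sum, map_smul, add_zero]
      refine ⟨(hdd (1, 0)).trans ?_, (hdd (0, 1)).trans ?_⟩
      · rw [← dU_eq_dd, ← dU_eq_dd, (hC x hx j).1, (hC' x hx j).1]
        exact hlin (fun i => matS L lam C x i j) (hS4 x j)
      · rw [← dV_eq_dd, ← dV_eq_dd, (hC x hx j).2, (hC' x hx j).2]
        exact hlin (fun i => matT L lam C x i j) (hT4 x j))
    hx₀ (fun j => by
      fin_cases j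
      · simp [frame, m1, hβ]
      · simp [frame, m2, hβ]
      · simp [frame, m3, hβ]
      · simp [frame, m4, hβ]
      · simp [frame, hβ, htdef])
  intro x hx
  have := key x hx 4
  simp only [frame, hβ, Matrix.cons_val] at this
  rw [sub_add_eq_add_sub, sub_eq_zero] at this
  exact this.symm

end Uniqueness

/-! ### Paraholomorphic local diffeomorphisms -/

section Diffeo

variable {U V : Set (ℝ × ℝ)} {x x₀ : ℝ × ℝ} {φ : ℝ × ℝ → ℝ × ℝ}

theorem IsParaholomorphicOn.mono (hφ : IsParaholomorphicOn φ U) (hV : V ⊆ U) :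
    IsParaholomorphicOn φ V :=
  ⟨hφ.1.mono hV, fun x hx => hφ.2 x (hV hx)⟩

/-- A map is paraholomorphic if its differential preserves the two null directions, stretching
them by factors of equal sign. -/
theorem isParaholomorphicOn_of_null (hφ : ContDiffOn ℝ ∞ φ V)
    (h : ∀ x ∈ V, ∃ p q : ℝ, 0 < p * q ∧ dP φ x = p • ((1, 1) : ℝ × ℝ) ∧
      dM φ x = q • ((1, -1) : ℝ × ℝ)) : IsParaholomorphicOn φ V := by
  refine ⟨hφ, fun x hx => ?_⟩
  obtain ⟨p, q, hpq, hP, hM⟩ := h x hx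
  rw [dU_eq_half, dV_eq_half, hP, hM]
  simp only [Prod.smul_fst, Prod.smul_snd, Prod.fst_add, Prod.snd_add, Prod.fst_sub, Prod.snd_sub,
    smul_eq_mul]
  refine ⟨by ring, by ring, ?_⟩
  linear_combination hpq

theorem IsParaholomorphicOn.exists_equiv (hφ : IsParaholomorphicOn φ V) (hV : IsOpen V)
    (hx : x ∈ V) : ∃ D : (ℝ × ℝ) ≃L[ℝ] (ℝ × ℝ), HasFDerivAt φ (D : (ℝ × ℝ) →L[ℝ] (ℝ × ℝ)) x ∧
      D (1, 1) = stretchP φ x • ((1, 1) : ℝ × ℝ) ∧ D (1, -1) = stretchM φ x • ((1, -1) : ℝ × ℝ) := by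
  have hd := (differentiableAt_of_smooth hφ.1 hV hx).hasFDerivAt
  have hP : fderiv ℝ φ x (1, 1) = stretchP φ x • ((1, 1) : ℝ × ℝ) := hφ.dP_eq hx
  have hM : fderiv ℝ φ x (1, -1) = stretchM φ x • ((1, -1) : ℝ × ℝ) := hφ.dM_eq hx
  have hpq := hφ.stretch_pos hx
  have hp : stretchP φ x ≠ 0 := left_ne_zero_of_mul hpq.ne'
  have hq : stretchM φ x ≠ 0 := right_ne_zero_of_mul hpq.ne'
  have hinj : Function.Injective (fderiv ℝ φ x : (ℝ × ℝ) →ₗ[ℝ] (ℝ × ℝ)) := by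
    rw [← LinearMap.ker_eq_bot, LinearMap.ker_eq_bot']
    intro h h0
    have e : h = ((h.1 + h.2) / 2) • ((1, 1) : ℝ × ℝ) + ((h.1 - h.2) / 2) • ((1, -1) : ℝ × ℝ) := by
      ext <;> simp <;> ring
    rw [ContinuousLinearMap.coe_coe, e, map_add, map_smul, map_smul, hP, hM] at h0
    have h1 := congrArg Prod.fst h0
    have h2 := congrArg Prod.snd h0
    simp only [Prod.fst_add, Prod.snd_add, Prod.smul_fst, Prod.smul_snd, smul_eq_mul, mul_one,
      mul_neg, Prod.fst_zero, Prod.snd_zero] at h1 h2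
    have h3 : h.1 + h.2 = 0 := by
      have : (h.1 + h.2) * stretchP φ x = 0 := by linarith
      exact (mul_eq_zero.1 this).resolve_right hp
    have h4 : h.1 - h.2 = 0 := by
      have : (h.1 - h.2) * stretchM φ x = 0 := by linarith
      exact (mul_eq_zero.1 this).resolve_right hq
    ext
    · rw [Prod.fst_zero]; linarith
    · rw [Prod.snd_zero]; linarith
  refine ⟨(LinearEquiv.ofInjectiveEndo _ hinj).toContinuousLinearEquiv, ?_, hP, hM⟩
  exact hd

/-- A paraholomorphic map with positive Jacobian has local inverses in the groupoid. -/
theorem IsParaholomorphicOn.exists_mem_groupoid (hφ : IsParaholomorphicOn φ V) (hV : IsOpen V)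
    (hx : x₀ ∈ V) : ∃ ψ : OpenPartialHomeomorph (ℝ × ℝ) (ℝ × ℝ), ψ ∈ lorentzGroupoid ∧
      ψ.source ⊆ V ∧ x₀ ∈ ψ.source ∧ ∀ y ∈ ψ.target,
        stretchP ψ.symm y = (stretchP φ (ψ.symm y))⁻¹ ∧
        stretchM ψ.symm y = (stretchM φ (ψ.symm y))⁻¹ := by
  obtain ⟨D, hD, -, -⟩ := hφ.exists_equiv hV hx
  have hφ₀ : ContDiffAt ℝ ∞ φ x₀ := hφ.1.contDiffAt (hV.mem_nhds hx)
  set ψ := (hφ₀.toOpenPartialHomeomorph φ hD (by simp)).restrOpen V hV with hψ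
  have hsrc : ψ.source ⊆ V := Set.inter_subset_right
  have hsymm : ∀ y ∈ ψ.target, ψ.symm y ∈ V := fun y hy => hsrc (ψ.map_target hy)
  have hinv : ∀ y ∈ ψ.target, dP ψ.symm y = (stretchP φ (ψ.symm y))⁻¹ • ((1, 1) : ℝ × ℝ) ∧
      dM ψ.symm y = (stretchM φ (ψ.symm y))⁻¹ • ((1, -1) : ℝ × ℝ) := fun y hy => by
    obtain ⟨D', hD', hP, hM⟩ := hφ.exists_equiv hV (hsymm y hy)
    have hs := ψ.hasFDerivAt_symm hy hD'
    have hpq := hφ.stretch_pos (hsymm y hy)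
    have hp := left_ne_zero_of_mul hpq.ne'
    have hq := right_ne_zero_of_mul hpq.ne'
    unfold dd
    rw [hs.fderiv]
    constructor
    · change D'.symm (1, 1) = _
      rw [ContinuousLinearEquiv.symm_apply_eq, map_smul, hP, smul_smul, inv_mul_cancel₀ hp,
        one_smul]
    · change D'.symm (1, -1) = _
      rw [ContinuousLinearEquiv.symm_apply_eq, map_smul, hM, smul_smul, inv_mul_cancel₀ hq,
        one_smul]
  have hsm : ContDiffOn ℝ ∞ ψ.symm ψ.target := fun y hy => by
    obtain ⟨D', hD', -, -⟩ := hφ.exists_equiv hV (hsymm y hy)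
    exact (ψ.contDiffAt_symm hy hD' (hφ.1.contDiffAt (hV.mem_nhds (hsymm y hy)))).contDiffWithinAt
  have hpara : IsParaholomorphicOn ψ.symm ψ.target :=
    isParaholomorphicOn_of_null hsm fun y hy => ⟨_, _, by
      rw [← mul_inv]; exact inv_pos.2 (hφ.stretch_pos (hsymm y hy)), hinv y hy⟩
  refine ⟨ψ, ⟨hφ.mono hsrc, hpara⟩, hsrc, ⟨hφ₀.mem_toOpenPartialHomeomorph_source hD _, hx⟩,
    fun y hy => ?_⟩
  have h1 := (hpara.dP_eq hy).symm.trans (hinv y hy).1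
  have h2 := (hpara.dM_eq hy).symm.trans (hinv y hy).2
  exact ⟨by simpa using congrArg Prod.fst h1, by simpa using congrArg Prod.fst h2⟩

/-- A closed smooth `1`-form `α du + β dv` has a local potential. -/
theorem exists_potential {α β : ℝ × ℝ → ℝ} (hU : IsOpen U) (hα : ContDiffOn ℝ ∞ α U)
    (hβ : ContDiffOn ℝ ∞ β U) (hc : ∀ x ∈ U, dU β x = dV α x) (hx : x₀ ∈ U) :
    ∃ W ⊆ U, IsOpen W ∧ x₀ ∈ W ∧ ∃ a : ℝ × ℝ → ℝ, ContDiffOn ℝ ∞ a W ∧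
      ∀ x ∈ W, dU a x = α x ∧ dV a x = β x := by
  have hsm : ∀ g : ℝ × ℝ → ℝ, ContDiffOn ℝ ∞ g U → ∀ i j : Fin 2,
      ContDiffOn ℝ ∞ (fun y => (!![0, 0; g y, 0] : Matrix (Fin 2) (Fin 2) ℝ) i j) U := by
    intro g hg i j
    fin_cases i <;> fin_cases j
    · exact contDiffOn_const
    · exact contDiffOn_const
    · exact hg
    · exact contDiffOn_const
  -- a potential is the first component of a solution of a flat system with constant second one
  obtain ⟨W, hWU, hW, hconn, hxW, ψ, hψ, hψ0, hd⟩ := exists_linearSystem_solution (G := ℝ)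
    (S := fun y => !![0, 0; α y, 0]) (T := fun y => !![0, 0; β y, 0]) hU hx (hsm α hα) (hsm β hβ)
    (fun x hx i j => by
      have h0 : ∀ w, dd w (fun _ : ℝ × ℝ => (0 : ℝ)) x = 0 := fun w => dd_const 0
      have h := hc x hx
      rw [dU_eq_dd, dV_eq_dd] at *
      fin_cases i <;> fin_cases j <;> simp [Matrix.mul_apply, h0, h]) ![0, 1]
  have hd1 : ∀ x ∈ W, dU (ψ 1) x = 0 ∧ dV (ψ 1) x = 0 := fun x hx => by
    simpa using hd x hx 1
  obtain ⟨c, hc1⟩ := exists_const_of_null_derivs hW hconn (hψ 1)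
    (fun y hy => by rw [dP_eq, (hd1 y hy).1, (hd1 y hy).2, add_zero])
    (fun y hy => by rw [dM_eq, (hd1 y hy).1, (hd1 y hy).2, sub_zero])
  have hone : ∀ x ∈ W, ψ 1 x = 1 := fun x hx => by
    rw [hc1 x hx, ← hc1 x₀ hxW, hψ0]; rfl
  refine ⟨W, hWU, hW, hxW, ψ 0, hψ 0, fun x hx => ?_⟩
  have h0 := hd x hx 0
  simpa [hone x hx] using h0

/-- If the positive functions `p`, `q` are constant along `∂_-`, `∂_+` respectively, there is a
local paracomplex coordinate whose differential stretches `∂_+`, `∂_-` by these factors. -/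
theorem exists_paraholomorphic {p q : ℝ × ℝ → ℝ} (hU : IsOpen U) (hp : ContDiffOn ℝ ∞ p U)
    (hq : ContDiffOn ℝ ∞ q U) (hp0 : ∀ x ∈ U, 0 < p x) (hq0 : ∀ x ∈ U, 0 < q x)
    (hpM : ∀ x ∈ U, dM p x = 0) (hqP : ∀ x ∈ U, dP q x = 0) (hx : x₀ ∈ U) :
    ∃ V ⊆ U, IsOpen V ∧ x₀ ∈ V ∧ ∃ φ, IsParaholomorphicOn φ V ∧
      ∀ x ∈ V, stretchP φ x = p x ∧ stretchM φ x = q x := by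
  obtain ⟨W₁, hW₁U, hW₁, hx₁, a, ha, hda⟩ := exists_potential hU hp hp (fun x hx => by
    have := hpM x hx; rw [dM_eq] at this; linarith) hx
  obtain ⟨W₂, hW₂U, hW₂, hx₂, b, hb, hdb⟩ := exists_potential hU hq hq.neg (fun x hx => by
    have h1 := hqP x hx
    have h2 : dU (fun y => -q y) x = -dU q x := by
      unfold dU; rw [fderiv_fun_neg]; rfl
    rw [dP_eq] at h1
    rw [h2]; linarith) hx
  have hV : IsOpen (W₁ ∩ W₂) := hW₁.inter hW₂
  have hsm1 : ContDiffOn ℝ ∞ a (W₁ ∩ W₂) := ha.mono Set.inter_subset_left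
  have hsm2 : ContDiffOn ℝ ∞ b (W₁ ∩ W₂) := hb.mono Set.inter_subset_right
  set φ : ℝ × ℝ → ℝ × ℝ := fun y => ((1 / 2) * (a y + b y), (1 / 2) * (a y - b y)) with hφ
  have hsm : ContDiffOn ℝ ∞ φ (W₁ ∩ W₂) :=
    (contDiffOn_const.mul (hsm1.add hsm2)).prodMk (contDiffOn_const.mul (hsm1.sub hsm2))
  have hdd : ∀ w, ∀ x ∈ W₁ ∩ W₂, dd w φ x =
      ((1 / 2) * (dd w a x + dd w b x), (1 / 2) * (dd w a x - dd w b x)) := fun w x hx => by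
    have da := differentiableAt_of_smooth hsm1 hV hx
    have db := differentiableAt_of_smooth hsm2 hV hx
    have h1 := ((da.hasFDerivAt.fun_add db.hasFDerivAt).const_mul (1 / 2)).prodMk
      ((da.hasFDerivAt.fun_sub db.hasFDerivAt).const_mul (1 / 2))
    unfold dd
    rw [h1.fderiv]
    rfl
  have hnull : ∀ x ∈ W₁ ∩ W₂, dP φ x = p x • ((1, 1) : ℝ × ℝ) ∧
      dM φ x = q x • ((1, -1) : ℝ × ℝ) := fun x hx => by
    obtain ⟨a1, a2⟩ := hda x hx.1
    obtain ⟨b1, b2⟩ := hdb x hx.2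
    rw [hdd _ x hx, hdd _ x hx, dP_eq, dP_eq, dM_eq, dM_eq, a1, a2, b1, b2]
    constructor <;> ext <;> simp <;> ring
  have hpara : IsParaholomorphicOn φ (W₁ ∩ W₂) := isParaholomorphicOn_of_null hsm fun x hx =>
    ⟨_, _, mul_pos (hp0 x (hW₁U hx.1)) (hq0 x (hW₁U hx.1)), hnull x hx⟩
  refine ⟨W₁ ∩ W₂, fun x hx => hW₁U hx.1, hV, ⟨hx₁, hx₂⟩, φ, hpara, fun x hx => ?_⟩
  have h1 := (hpara.dP_eq hx).symm.trans (hnull x hx).1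
  have h2 := (hpara.dM_eq hx).symm.trans (hnull x hx).2
  exact ⟨by simpa using congrArg Prod.fst h1, by simpa using congrArg Prod.fst h2⟩

end Diffeo

/-! ### The normalized local paracomplex coordinate -/

section Normalized

variable {L : ℝ} {f : ℝ × ℝ → Amb L} {U : Set (ℝ × ℝ)} {x x₀ : ℝ × ℝ}

theorem HasProportionalSff.mul_eq_sq (h : HasProportionalSff L f x) :
    form L (sffP L f x) (sffP L f x) * form L (sffM L f x) (sffM L f x)
      = form L (sffP L f x) (sffM L f x) ^ 2 := by
  have := congrArg (fun w => form L w (sffM L f x)) (h (sffP L f x))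
  simp only [form_smul_left] at this
  rw [this, sq]

/-- Where `σ(∂_+, ∂_+)` and `σ(∂_-, ∂_-)` are proportional and not orthogonal, there is a change
of the local paracomplex coordinate after which their product is `± 4`. The stretching factors are
the fourth roots of `|⟨f_++, f_++⟩| / 4`, `|⟨f_--, f_--⟩| / 4`, which depend on one null variable
each. -/
theorem IsZeroMeanOn.exists_normalizing (h : IsZeroMeanOn L f U) (hU : IsOpen U)
    (hp : ∀ x ∈ U, HasProportionalSff L f x)
    (hne : ∀ x ∈ U, form L (sffP L f x) (sffM L f x) ≠ 0) (hx : x₀ ∈ U) :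
    ∃ ψ : OpenPartialHomeomorph (ℝ × ℝ) (ℝ × ℝ), ψ ∈ lorentzGroupoid ∧ ψ.source ⊆ U ∧
      x₀ ∈ ψ.source ∧ ∀ y ∈ ψ.target, (stretchP ψ.symm y * stretchM ψ.symm y) ^ 2 *
        |form L (sffP L f (ψ.symm y)) (sffM L f (ψ.symm y))| = 4 := by
  set H := fun y => form L (dP (dP f) y) (dP (dP f) y) with hH
  set G := fun y => form L (dM (dM f) y) (dM (dM f) y) with hG
  have hHs : ContDiffOn ℝ ∞ H U :=
    contDiffOn_form (h.smooth_dd_dd hU _ _) (h.smooth_dd_dd hU _ _)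
  have hGs : ContDiffOn ℝ ∞ G U :=
    contDiffOn_form (h.smooth_dd_dd hU _ _) (h.smooth_dd_dd hU _ _)
  have hHG : ∀ y ∈ U, H y * G y = form L (sffP L f y) (sffM L f y) ^ 2 := fun y hy => by
    rw [← (hp y hy).mul_eq_sq]
    exact congrArg₂ (· * ·) (h.form_normalPart_PP_PP hU hy).symm
      (h.form_normalPart_MM_MM hU hy).symm
  have hHG0 : ∀ y ∈ U, H y * G y ≠ 0 := fun y hy => by
    rw [hHG y hy]; exact pow_ne_zero 2 (hne y hy)
  have hH0 : ∀ y ∈ U, H y ≠ 0 := fun y hy => left_ne_zero_of_mul (hHG0 y hy)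
  have hG0 : ∀ y ∈ U, G y ≠ 0 := fun y hy => right_ne_zero_of_mul (hHG0 y hy)
  have hsm : ∀ g : ℝ × ℝ → ℝ, ContDiffOn ℝ ∞ g U → (∀ y ∈ U, g y ≠ 0) →
      ContDiffOn ℝ ∞ (fun y => (1 / 4) * (Real.log (g y) + -Real.log 4)) U := fun g hg h0 =>
    contDiffOn_const.mul ((hg.log h0).add contDiffOn_const)
  have hroot : ∀ (w : ℝ × ℝ) (g : ℝ × ℝ → ℝ), ContDiffOn ℝ ∞ g U → (∀ y ∈ U, g y ≠ 0) →
      ∀ x ∈ U, dd w g x = 0 →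
      dd w (fun y => Real.exp ((1 / 4) * (Real.log (g y) + -Real.log 4))) x = 0 := by
    intro w g hg h0 x hx hd
    have dg := differentiableAt_of_smooth hg hU hx
    have dl := dg.log (h0 x hx)
    rw [dd_exp (differentiableAt_of_smooth (hsm g hg h0) hU hx),
      dd_const_mul _ (dl.add_const _), dd_add dl (differentiableAt_const _), dd_const,
      dd_log dg (h0 x hx), hd]
    simp
  obtain ⟨V, hVU, hV, hxV, φ, hφ, hst⟩ := exists_paraholomorphic hU (hsm H hHs hH0).exp
    (hsm G hGs hG0).exp (fun _ _ => Real.exp_pos _) (fun _ _ => Real.exp_pos _)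
    (fun x hx => hroot _ H hHs hH0 x hx (h.dM_form_PP hU hx))
    (fun x hx => hroot _ G hGs hG0 x hx (h.dP_form_MM hU hx)) hx
  obtain ⟨ψ, hψ, hsrc, hxψ, hinv⟩ := hφ.exists_mem_groupoid hV hxV
  refine ⟨ψ, hψ, hsrc.trans hVU, hxψ, fun y hy => ?_⟩
  have hyV := hsrc (ψ.map_target hy)
  have hyU := hVU hyV
  obtain ⟨i1, i2⟩ := hinv y hy
  obtain ⟨s1, s2⟩ := hst _ hyV
  have hB := abs_pos.2 (hne _ hyU)
  rw [i1, i2, s1, s2, ← Real.exp_neg, ← Real.exp_neg, ← Real.exp_add, ← Real.exp_nat_mul]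
  -- `log H + log G = 2 log |B|`, whatever the signs
  have hlog : Real.log (H (ψ.symm y)) + Real.log (G (ψ.symm y)) =
      2 * Real.log (form L (sffP L f (ψ.symm y)) (sffM L f (ψ.symm y))) := by
    rw [← Real.log_mul (hH0 _ hyU) (hG0 _ hyU), hHG _ hyU, Real.log_pow]; norm_num
  rw [show (2 : ℕ) * (-((1 / 4) * (Real.log (H (ψ.symm y)) + -Real.log 4))
      + -((1 / 4) * (Real.log (G (ψ.symm y)) + -Real.log 4))) =
      Real.log 4 - Real.log (form L (sffP L f (ψ.symm y)) (sffM L f (ψ.symm y))) by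
    push_cast; linear_combination -(1 / 2) * hlog, Real.exp_sub, Real.exp_log (by norm_num),
    Real.exp_log_eq_abs (hne _ hyU)]
  field_simp

end Normalized

/-! ### Surfaces parametrized by a Lorentz surface -/

section Charts

open OpenPartialHomeomorph

variable {M : Type*} [TopologicalSpace M] [ChartedSpace (ℝ × ℝ) M] {L : ℝ} {F : M → Amb L}

theorem trans_mem_maximalAtlas {e : OpenPartialHomeomorph M (ℝ × ℝ)}
    {φ : OpenPartialHomeomorph (ℝ × ℝ) (ℝ × ℝ)} (he : e ∈ lorentzGroupoid.maximalAtlas M)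
    (hφ : φ ∈ lorentzGroupoid) : e.trans φ ∈ lorentzGroupoid.maximalAtlas M := fun e' he' => by
  have h1 : (e.trans φ).symm.trans e' = φ.symm.trans (e.symm.trans e') := by
    rw [trans_symm_eq_symm_trans_symm, trans_assoc]
  have h2 : e'.symm.trans (e.trans φ) = (e'.symm.trans e).trans φ := (trans_assoc _ _ _).symm
  rw [h1, h2]
  exact ⟨lorentzGroupoid.trans (lorentzGroupoid.symm hφ) (he e' he').1,
    lorentzGroupoid.trans (he e' he').2 hφ⟩

theorem ofSet_mem_lorentzGroupoid {s : Set (ℝ × ℝ)} (hs : IsOpen s) :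
    ofSet s hs ∈ lorentzGroupoid :=
  ⟨paraPregroupoid.id_mem.mono (Set.subset_univ s), paraPregroupoid.id_mem.mono (Set.subset_univ s)⟩

/-- The nonvanishing of `⟨σ(∂_+, ∂_+), σ(∂_-, ∂_-)⟩` and the proportionality of these two vectors
do not depend on the local paracomplex coordinate. -/
theorem IsZeroMean.sff_transfer [HasGroupoid M lorentzGroupoid] (hF : IsZeroMean L F)
    {e e' : OpenPartialHomeomorph M (ℝ × ℝ)} (he : e ∈ lorentzGroupoid.maximalAtlas M)
    (he' : e' ∈ lorentzGroupoid.maximalAtlas M) {p : M} (hp : p ∈ e.source) (hp' : p ∈ e'.source) :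
    (form L (sffP L (F ∘ e.symm) (e p)) (sffM L (F ∘ e.symm) (e p)) ≠ 0 →
      form L (sffP L (F ∘ e'.symm) (e' p)) (sffM L (F ∘ e'.symm) (e' p)) ≠ 0) ∧
    (HasProportionalSff L (F ∘ e.symm) (e p) → HasProportionalSff L (F ∘ e'.symm) (e' p)) := by
  have hφ : IsParaholomorphicOn (e'.symm.trans e) (e'.symm.trans e).source :=
    (lorentzGroupoid.compatible_of_mem_maximalAtlas he' he).1
  have hV : IsOpen (e'.symm.trans e).source := (e'.symm.trans e).open_source
  have hVt : (e'.symm.trans e).source ⊆ e'.target := fun y hy => hy.1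
  have hx : e' p ∈ (e'.symm.trans e).source :=
    ⟨e'.map_source hp', by rw [Set.mem_preimage]; simpa [hp'] using hp⟩
  have hφx : (e'.symm.trans e) (e' p) = e p := by simp [hp']
  have hmaps : Set.MapsTo (e'.symm.trans e) (e'.symm.trans e).source e.target := fun y hy =>
    e.map_source hy.2
  have heq : ∀ y ∈ (e'.symm.trans e).source,
      (F ∘ e'.symm) y = (F ∘ e.symm) ((e'.symm.trans e) y) := fun y hy => by
    have : e'.symm y ∈ e.source := hy.2
    simp [this]
  have h1 := form_sff_reparam (hF e he) e.open_target ((hF e' he').mono hVt) hV hφ hmaps heq hx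
  have h2 := fun hpr => HasProportionalSff.reparam (hF e he) e.open_target ((hF e' he').mono hVt)
    hV hφ hmaps heq hx hpr
  rw [hφx] at h1 h2
  refine ⟨fun h0 => ?_, h2⟩
  rw [h1]
  exact mul_ne_zero (pow_ne_zero 2 (hφ.stretch_pos hx).ne') h0

/-- The curvature condition in terms of the second fundamental form in any coordinate. -/
theorem IsZeroMean.gaussCurvature_ne_iff [HasGroupoid M lorentzGroupoid] (hF : IsZeroMean L F)
    {e : OpenPartialHomeomorph M (ℝ × ℝ)} (he : e ∈ lorentzGroupoid.maximalAtlas M) {p : M}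
    (hp : p ∈ e.source) : gaussCurvature L F p ≠ L ↔
      form L (sffP L (F ∘ e.symm) (e p)) (sffM L (F ∘ e.symm) (e p)) ≠ 0 := by
  have hc := lorentzGroupoid.chart_mem_maximalAtlas p
  have hp' := mem_chart_source (ℝ × ℝ) p
  unfold gaussCurvature
  rw [(hF _ hc).curvature_ne_iff (chartAt (ℝ × ℝ) p).open_target (mem_chart_target (ℝ × ℝ) p)]
  exact ⟨(hF.sff_transfer hc he hp' hp).1, (hF.sff_transfer he hc hp hp').1⟩

theorem IsNormalFrameOn.mono {f N₁ N₂ : ℝ × ℝ → Amb L} {lam : ℝ × ℝ → ℝ} {U V : Set (ℝ × ℝ)}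
    (h : IsNormalFrameOn L f lam N₁ N₂ U) (hV : V ⊆ U) : IsNormalFrameOn L f lam N₁ N₂ V :=
  ⟨h.normal₁.mono hV, h.normal₂.mono hV, fun x hx => h.gram x (hV hx)⟩

/-- In a coordinate on a connected domain in which `⟨σ(∂_+, ∂_+), σ(∂_-, ∂_-)⟩ = ± 4`, the sign is
constant and the conformal factor solves the equation with this sign. -/
theorem IsZeroMeanOn.exists_solvesEquationOn {f : ℝ × ℝ → Amb L} {U : Set (ℝ × ℝ)}
    (h : IsZeroMeanOn L f U) (hU : IsOpen U) (hconn : IsPreconnected U)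
    (h4 : ∀ y ∈ U, |form L (sffP L f y) (sffM L f y)| = 4) :
    ∃ ε : ℝ, (ε = 1 ∨ ε = -1) ∧ SolvesEquationOn L ε (confFactor L f) U ∧
      ∀ y ∈ U, form L (sffP L f y) (sffM L f y) = 4 * ε := by
  have hlam := h.smooth_confFactor hU
  have hsm : ContDiffOn ℝ ∞ (fun y => form L (sffP L f y) (sffM L f y)) U :=
    contDiffOn_form (h.smooth_normalPart hU (h.smooth_dd_dd hU _ _))
      (h.smooth_normalPart hU (h.smooth_dd_dd hU _ _))
  obtain ⟨ε, hε, hs⟩ := exists_sign_eq hconn hsm.continuousOn fun y hy h0 => by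
    have := h4 y hy
    simp [h0] at this
  have hs4 : ∀ y ∈ U, form L (sffP L f y) (sffM L f y) = 4 * ε := fun y hy => by
    rw [hs y hy, h4 y hy, mul_comm]
  refine ⟨ε, hε, ⟨hlam, fun x hx => ?_⟩, hs4⟩
  have hg := h.gauss hU hlam h.isConformalFactorOn hx
  have h4x := hs4 x hx
  rw [sffP, sffM, hg, dM_dP_eq_sub hlam hU hx] at h4x
  rw [show -2 * confFactor L f x = -(2 * confFactor L f x) by ring, Real.exp_neg]
  have hE := (Real.exp_pos (2 * confFactor L f x)).ne'
  field_simp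
  linear_combination h4x / 4

/-- The geometric conditions imply the explicit formulas: the normalized coordinate is restricted to
a ball, so that the domain is connected, on which there is a normal frame. -/
theorem IsZeroMean.explicit_for_every_frame [HasGroupoid M lorentzGroupoid] (hF : IsZeroMean L F)
    (hK : ∀ p : M, gaussCurvature L F p ≠ L) (hflat : HasFlatNormalConnection L F) :
    HasExplicitFormForEveryFrame L F := fun p => by
  have he := lorentzGroupoid.chart_mem_maximalAtlas p
  set e := chartAt (ℝ × ℝ) p with he_def
  have hpe : p ∈ e.source := mem_chart_source (ℝ × ℝ) p
  obtain ⟨ψ, hψ, hsrc, hxψ, hnorm⟩ := (hF e he).exists_normalizing e.open_target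
    (((hF e he).flat_iff e.open_target).1 (hflat e he))
    (fun y hy => by
      have := (hF.gaussCurvature_ne_iff he (e.map_target hy)).1 (hK _)
      rwa [e.right_inv hy] at this) (e.map_source hpe)
  have he₂ := trans_mem_maximalAtlas he hψ
  set e₂ := e.trans ψ with he₂_def
  have hpe₂ : p ∈ e₂.source := ⟨hpe, hxψ⟩
  have h₂ := hF e₂ he₂
  have hlam := h₂.smooth_confFactor e₂.open_target
  obtain ⟨V, hVt, hV, hpV, N₁, N₂, hN⟩ := h₂.exists_normalFrame e₂.open_target hlam
    (e₂.map_source hpe₂)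
  obtain ⟨r, hr, hrV⟩ := Metric.isOpen_iff.1 hV _ hpV
  have hrt : Metric.ball (e₂ p) r ⊆ e₂.target := hrV.trans hVt
  set e₃ := e₂.trans (ofSet (Metric.ball (e₂ p) r) Metric.isOpen_ball) with he₃_def
  have he₃ : e₃ ∈ lorentzGroupoid.maximalAtlas M :=
    trans_mem_maximalAtlas he₂ (ofSet_mem_lorentzGroupoid _)
  have ht₃ : e₃.target = Metric.ball (e₂ p) r := by
    ext y
    exact ⟨fun hy => hy.1, fun hy => ⟨hy, hrt hy⟩⟩
  have hf₃ : F ∘ e₃.symm = F ∘ e₂.symm := rfl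
  refine ⟨e₃, he₃, ⟨hpe₂, Metric.mem_ball_self hr⟩, ?_⟩
  rw [hf₃, ht₃]
  have hconn : IsPreconnected (Metric.ball (e₂ p) r) := (convex_ball _ r).isPreconnected
  have hB : IsOpen (Metric.ball (e₂ p) r) := Metric.isOpen_ball
  have h₃ := h₂.mono hrt
  have hψt : Metric.ball (e₂ p) r ⊆ ψ.target := fun y hy => (hrt hy).1
  have hmaps : Set.MapsTo ψ.symm (Metric.ball (e₂ p) r) e.target := fun y hy => (hrt hy).2
  have hpara : IsParaholomorphicOn ψ.symm (Metric.ball (e₂ p) r) :=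
    IsParaholomorphicOn.mono hψ.2 hψt
  have hprop : ∀ y ∈ Metric.ball (e₂ p) r, HasProportionalSff L (F ∘ e₂.symm) y :=
    (h₃.flat_iff hB).1 fun W hW => hflat e₂ he₂ W (hW.trans hrt)
  obtain ⟨ε, hε, hsol, hs⟩ := h₃.exists_solvesEquationOn hB hconn fun y hy => by
    rw [form_sff_reparam (hF e he) e.open_target h₃ hB hpara hmaps (fun _ _ => rfl) hy, abs_mul,
      abs_of_nonneg (sq_nonneg _)]
    exact hnorm y (hψt hy)
  refine ⟨confFactor L (F ∘ e₂.symm), ε, hε, h₃.isConformalFactorOn, hsol,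
    ⟨N₁, N₂, hN.mono hrV⟩, fun N₁' N₂' hN' => ?_⟩
  have hC := hasCoeffsOn_frameCoeffs h₃ hB hsol.1 h₃.isConformalFactorOn hN'
  exact ⟨_, hC, hC.areExplicitOn h₃ hB hconn hsol.1 h₃.isConformalFactorOn hN' hε hprop hs⟩

theorem HasExplicitFormForEveryFrame.for_some_frame (h : HasExplicitFormForEveryFrame L F) :
    HasExplicitFormForSomeFrame L F := fun p => by
  obtain ⟨e, he, hp, lam, ε, hε, hc, hs, ⟨N₁, N₂, hN⟩, hall⟩ := h p
  exact ⟨e, he, hp, lam, ε, hε, hc, hs, N₁, N₂, hN, hall N₁ N₂ hN⟩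

/-- The explicit formulas imply the geometric conditions. The flatness of the normal connection has
to be shown in every coordinate, and is transferred from the ones of the hypothesis. -/
theorem IsZeroMean.curvature_ne_and_flat [HasGroupoid M lorentzGroupoid] (hF : IsZeroMean L F)
    (h : HasExplicitFormForSomeFrame L F) :
    (∀ p : M, gaussCurvature L F p ≠ L) ∧ HasFlatNormalConnection L F := by
  refine ⟨fun p => ?_, fun e he => ((hF e he).flat_iff e.open_target).2 fun y hy => ?_⟩
  · obtain ⟨e, he, hp, lam, ε, hε, hc, hs, -⟩ := h p
    rw [hF.gaussCurvature_ne_iff he hp,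
      (hF e he).form_sff_of_solves e.open_target hc hs (e.map_source hp)]
    rcases hε with rfl | rfl <;> norm_num
  · obtain ⟨e', he', hp, lam, ε, hε, hc, hs, N₁, N₂, hN, C, hC, hA⟩ := h (e.symm y)
    have hprop := (hC.hasProportionalSff_iff (hF e' he') e'.open_target hN
      (e'.map_source hp)).2 (hA.mul_eq_mul (e'.map_source hp))
    have := (hF.sff_transfer he' he hp (e.map_target hy)).2 hprop
    rwa [e.right_inv hy] at this

theorem AreExplicitOn.mono {lam : ℝ × ℝ → ℝ} {C : Coeffs} {ε : ℝ} {U V : Set (ℝ × ℝ)}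
    (h : AreExplicitOn ε lam C U) (hV : V ⊆ U) : AreExplicitOn ε lam C V := by
  obtain ⟨Pp, Pm, Qp, Qm, c, εp, εm, ⟨s1, s2, s3, s4⟩, hp, hm, hR, hμ, hX⟩ := h
  exact ⟨Pp, Pm, Qp, Qm, c, εp, εm, ⟨s1.mono hV, s2.mono hV, s3.mono hV, s4.mono hV⟩, hp, hm,
    fun x hx => hR x (hV hx), fun x hx => hμ x (hV hx), fun x hx => hX x (hV hx)⟩

end Charts

end NeutralSurface

end

theorem theorem5p1 (L₀ : ℝ) :
    (∀ (M : Type*) [TopologicalSpace M] [ChartedSpace (ℝ × ℝ) M]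
      [HasGroupoid M NeutralSurface.lorentzGroupoid]
      (F : M → NeutralSurface.Amb L₀), NeutralSurface.IsZeroMean L₀ F →
      List.TFAE
        [(∀ p : M, NeutralSurface.gaussCurvature L₀ F p ≠ L₀) ∧
            NeutralSurface.HasFlatNormalConnection L₀ F,
          NeutralSurface.HasExplicitFormForSomeFrame L₀ F,
          NeutralSurface.HasExplicitFormForEveryFrame L₀ F]) ∧
    (∀ (U : Set (ℝ × ℝ)) (lam : ℝ × ℝ → ℝ) (C : NeutralSurface.Coeffs) (ε : ℝ), IsOpen U →
      (ε = 1 ∨ ε = -1) → NeutralSurface.SolvesEquationOn L₀ ε lam U →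
      NeutralSurface.AreExplicitOn ε lam C U →
      (∀ x₀ ∈ U, ∃ W ⊆ U, IsOpen W ∧ x₀ ∈ W ∧ ∃ f : ℝ × ℝ → NeutralSurface.Amb L₀,
        NeutralSurface.IsSurfaceWithDataOn L₀ lam C f W ∧
        (∀ x ∈ W, NeutralSurface.curvature (NeutralSurface.metric L₀ f) x ≠ L₀) ∧
        NeutralSurface.HasFlatNormalConnectionOn L₀ f W) ∧
      (∀ W ⊆ U, IsOpen W → IsPreconnected W → ∀ f f' : ℝ × ℝ → NeutralSurface.Amb L₀,
        NeutralSurface.IsSurfaceWithDataOn L₀ lam C f W →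
        NeutralSurface.IsSurfaceWithDataOn L₀ lam C f' W →
        ∃ Φ : NeutralSurface.Amb L₀ → NeutralSurface.Amb L₀,
          NeutralSurface.IsIsometryOfN L₀ Φ ∧ ∀ x ∈ W, f' x = Φ (f x))) := by
  refine ⟨fun M _ _ _ F hF => ?_, fun U lam C ε hU hε hs hA => ⟨fun x₀ hx₀ => ?_, ?_⟩⟩
  · tfae_have 1 → 3 := fun h => hF.explicit_for_every_frame h.1 h.2
    tfae_have 3 → 2 := fun h => h.for_some_frame
    tfae_have 2 → 1 := fun h => hF.curvature_ne_and_flat h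
    tfae_finish
  · obtain ⟨W, hWU, hW, hxW, f, hf⟩ := NeutralSurface.exists_isSurfaceWithDataOn hU hs hA hx₀
    have hsW : NeutralSurface.SolvesEquationOn L₀ ε lam W :=
      ⟨hs.1.mono hWU, fun x hx => hs.2 x (hWU hx)⟩
    exact ⟨W, hWU, hW, hxW, f, hf, hf.curvature_ne_and_flat hW hε hsW (hA.mono hWU)⟩
  · exact fun W hWU hW hconn f f' hf hf' =>
      NeutralSurface.exists_isometry_of_isSurfaceWithDataOn hU hs.1 hA hWU hW hconn hf hf'
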